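/- **Setting.** Let $T>0$, let $(\Omega,\mathcal F,(\mathcal F_t)_{t\in[0,T]},\mathbb P)$ be a filtered probability space (no completeness or right-continuity of the filtration is assumed), write $\mathbb E_s=\mathbb E[\,\cdot\,|\mathcal F_s]$, and let $V,E,F$ be finite-dimensional real normed spaces (for instance $V=\mathbb R^d$). Write $\delta A_{s,t}=A_t-A_s$. A partition $\mathcal P$ of $[s,t]$ is a finite sequence $s=t_0<\dots<t_n=t$, $|\mathcal P|$ is its mesh size, and $\sum_{[u,v]\in\mathcal P}$ runs over its consecutive points. * *Norms.* $\|Z\|_{q,r,s}=\big\|\mathbb E_s[|Z|^q]\big\|_{L^r}^{1/q}$. For a two-parameter process $A$, $\|A\|_{p,q}=\big(\sup_{\mathcal P}\sum_{[u,v]\in\mathcal P}\|A_{u,v}\|_{L^q}^p\big)^{1/p}$ and $\|A\|_{p,q,r}=\big(\sup_{\mathcal P}\sum_{[u,v]\in\mathcal P}\|A_{u,v}\|_{q,r,u}^p\big)^{1/p}$, the suprema being over partitions of $[0,T]$. $V^pL^q$ (resp. $V^pL^{q,r}$) is the space of processes $Z$ on $[0,T]$ that are right-continuous in probability with $Z_0\in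 L^q$ and $\|\delta Z\|_{p,q}<\infty$ (resp. $\|\delta Z\|_{p,q,r}<\infty$). * *Rough path.* A càdlàg rough path $\mathbf X=(X,\mathbb X)\in\mathscr V^p$ consists of a deterministic càdlàg path $X:[0,T]\to V$ of finite $p$-variation and a càdlàg two-parameter function $\mathbb X_{s,t}\in V\otimes V$, $0\le s\le t\le T$, of finite $\frac p2$-variation, with $\mathbb X_{s,t}=\mathbb X_{s,u}+\mathbb X_{u,t}+\delta X_{s,u}\otimes\delta X_{u,t}$ for $s\le u\le t$. * *Stochastic controlled path.* $(Y,Y')\in\mathcal V^{p,q,r}_X$ means: $Y$ is $E$-valued and $Y'$ is $\mathcal L(V;E)$-valued, both are adapted and in $V^pL^{q,r}$, $\sup_{s\in[0,T]}\|Y'_s\|_{L^{qr}}<\infty$, and, with $R^Y_{s,t}=\delta Y_{s,t}-Y'_s\delta X_{s,t}$, the process $(s,t)\mapsto\mathbb E_s[R^Y_{s,t}]$ satisfies $\sup_{\mathcal P}\sum_{[u,v]\in\mathcal P}\|\mathbb E_u[R^Y_{u,v}]\|_{L^{qr}}^{p/2}<\infty$ (supremum over partitions of $[0,T]$). * $f\in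 C^3_b$ means that $f:E\to F$ is twice continuously differentiable, $f,\mathrm Df,\mathrm D^2f$ are bounded, and $\mathrm D^2f$ is Lipschitz. $\mathrm{Sym}$ denotes the symmetric part of a tensor. Bilinear maps act on tensors by linear extension. **Theorem.** Let $p\in[2,3)$, $q\in[4,\infty)$, $r\in[2,\infty]$, $f\in C^3_b$, $\mathbf X=(X,\mathbb X)\in\mathscr V^p$ and $(Y,Y')\in\mathcal V^{p,q,r}_X$. Then the following objects exist: * for each $t\in(0,T]$, the left limit $Y_{t-}=\lim_{s\nearrow t}Y_s$ in $L^q$, and $f(Y_{t-})=\lim_{s\nearrow t}f(Y_s)$ in $L^q$; write $\Delta Y_t=Y_t-Y_{t-}$ and $\Delta f(Y)_t=f(Y_t)-f(Y_{t-})$; * the bracket, an adapted process $[Y]\in V^{\frac p2}L^{\frac q2}$ with, for every $t\in[0,T]$, as a limit in $L^{\frac q2}$ along partitions of $[0,t]$, $$[Y]_t=\lim_{|\mathcal P|\to0}\sum_{[u,v]\in\mathcal P}\delta Y_{u,v}\otimes\delta Y_{u,v}-2(Y'_u\otimes Y'_u)\,\mathrm{Sym}(\mathbb X_{u,v});$$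 * the integral of $(\mathrm Df(Y),\mathrm D^2f(Y)Y')$ against $(Y,Y')$, an adapted process $\int_0^\cdot\mathrm Df(Y_s)\,\mathrm dY_s\in V^pL^{\frac q2}$ starting from $0$, with, for all $0\le s\le t\le T$, as a limit in $L^{\frac q2}$ along partitions of $[s,t]$, $$\int_s^t\mathrm Df(Y_u)\,\mathrm dY_u=\lim_{|\mathcal P|\to0}\sum_{[u,v]\in\mathcal P}\mathrm Df(Y_u)\,\delta Y_{u,v}+\mathrm D^2f(Y_u)\,(Y'_u\otimes Y'_u)\,\mathbb X_{u,v};$$ * the $L^{\frac q2}$-valued Young integral, starting from $0$, with, for all $0\le s\le t\le T$, as a limit in $L^{\frac q2}$ along partitions of $[s,t]$, $$\int_s^t\mathrm D^2f(Y_u)\,\mathrm d[Y]_u=\lim_{|\mathcal P|\to0}\sum_{[u,v]\in\mathcal P}\mathrm D^2f(Y_u)\,\delta[Y]_{u,v}.$$ Moreover, for each $t\in[0,T]$, almost surely, $$f(Y_t)=f(Y_0)+\int_0^t\mathrm Df(Y_s)\,\mathrm dY_s+\frac12\int_0^t\mathrm D^2f(Y_s)\,\mathrm d[Y]_s+\sum_{0<s\le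 t}\Big(\Delta f(Y)_s-\mathrm Df(Y_{s-})\Delta Y_s-\frac12\mathrm D^2f(Y_{s-})(\Delta Y_s\otimes\Delta Y_s)\Big),$$ where the sum is over the deterministic times $s\in(0,t]$ with $\|\Delta Y_s\|_{L^q}\ne0$ and converges absolutely in $L^1$ (the $L^1$-norms of its terms are summable, and the sum is the limit in $L^1$ of the finite partial sums). -/

import Mathlib

set_option maxSynthPendingDepth 3

open MeasureTheory Set Filter Topology
open scoped ENNReal NNReal TensorProduct

namespace RoughIto

/-! ### Tensor products of finite-dimensional spaces

For finite-dimensional `U`, `W` we norm `U ⊗ W` by duality with the bilinear forms on `U × W`,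
which is the projective tensor norm; all norms on `U ⊗ W` are equivalent. -/

section Tensor

variable {U W G : Type*} [NormedAddCommGroup U] [NormedSpace ℝ U] [FiniteDimensional ℝ U]
  [NormedAddCommGroup W] [NormedSpace ℝ W] [FiniteDimensional ℝ W]
  [NormedAddCommGroup G] [NormedSpace ℝ G]

/-- The linear map `U ⊗ W → G`, `u ⊗ w ↦ B u w`, induced by a bilinear map `B`. -/
noncomputable def contract (B : U →L[ℝ] W →L[ℝ] G) : U ⊗[ℝ] W →ₗ[ℝ] G :=
  TensorProduct.lift B.toLinearMap₁₂

/-- A tensor acts on bilinear forms as `B ↦ contract B τ`. -/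
noncomputable def tensorDual (U W : Type*) [NormedAddCommGroup U] [NormedSpace ℝ U]
    [FiniteDimensional ℝ U] [NormedAddCommGroup W] [NormedSpace ℝ W] [FiniteDimensional ℝ W] :
    U ⊗[ℝ] W →ₗ[ℝ] ((U →L[ℝ] W →L[ℝ] ℝ) →L[ℝ] ℝ) where
  toFun τ := LinearMap.toContinuousLinearMap
    { toFun := fun B => contract B τ
      map_add' := fun B C => by
        induction τ with
        | zero => simp
        | tmul u w => simp [contract]
        | add σ τ hσ hτ => simp only [map_add, hσ, hτ]; abel
      map_smul' := fun c B => by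
        induction τ with
        | zero => simp
        | tmul u w => simp [contract]
        | add σ τ hσ hτ => simp_all [mul_add] }
  map_add' σ τ := by ext B; simp
  map_smul' c τ := by ext B; simp

theorem tensorDual_injective : Function.Injective (tensorDual U W) := by
  refine (injective_iff_map_eq_zero _).2 fun τ hτ => ?_
  rw [← Module.forall_dual_apply_eq_zero_iff ℝ τ]
  intro ℓ
  let B : U →L[ℝ] W →L[ℝ] ℝ := LinearMap.toContinuousLinearMap
    ((LinearMap.toContinuousLinearMap (𝕜 := ℝ) (E := W) (F' := ℝ)).toLinearMap ∘ₗ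
      TensorProduct.curry ℓ)
  have h1 : contract B = ℓ := by
    apply TensorProduct.ext'
    intro u w
    simp [contract, B]
  have h2 := DFunLike.congr_fun hτ B
  rw [← h1]
  simpa [tensorDual] using h2

noncomputable instance tensorNormedAddCommGroup : NormedAddCommGroup (U ⊗[ℝ] W) :=
  NormedAddCommGroup.induced (U ⊗[ℝ] W) (((U →L[ℝ] W →L[ℝ] ℝ) →L[ℝ] ℝ))
    (tensorDual U W) tensorDual_injective

noncomputable instance tensorNormedSpace : NormedSpace ℝ (U ⊗[ℝ] W) :=
  NormedSpace.induced ℝ (U ⊗[ℝ] W) (((U →L[ℝ] W →L[ℝ] ℝ) →L[ℝ] ℝ)) (tensorDual U W)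

/-- The symmetric part of a two-tensor. -/
noncomputable def symPart (τ : U ⊗[ℝ] U) : U ⊗[ℝ] U :=
  (1 / 2 : ℝ) • (τ + TensorProduct.comm ℝ U U τ)

end Tensor

/-! ### Partitions and variation -/

/-- A partition `s = t₀ < t₁ < ⋯ < tₙ = t` (the values `pt i` for `i > n` are irrelevant). -/
structure TimePartition (s t : ℝ) where
  n : ℕ
  pt : ℕ → ℝ
  first : pt 0 = s
  last : pt n = t
  lt_succ : ∀ i < n, pt i < pt (i + 1)

/-- The mesh size of the partition is less than `δ`. -/
def TimePartition.MeshLT {s t : ℝ} (P : TimePartition s t) (δ : ℝ) : Prop :=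
  ∀ i < P.n, P.pt (i + 1) - P.pt i < δ

/-- The sum of `Ξ u v` over consecutive points `u < v` of the partition. -/
def TimePartition.sum {M : Type*} [AddCommMonoid M] {s t : ℝ} (P : TimePartition s t)
    (Ξ : ℝ → ℝ → M) : M :=
  ∑ i ∈ Finset.range P.n, Ξ (P.pt i) (P.pt (i + 1))

/-- The `p`-th power of the `p`-variation over `[s, t]` of a two-parameter family of sizes. -/
noncomputable def pVarPow (p : ℝ) (N : ℝ → ℝ → ℝ≥0∞) (s t : ℝ) : ℝ≥0∞ :=
  ⨆ P : TimePartition s t, P.sum fun u v => N u v ^ p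

/-- The `p`-variation over `[s, t]` of a two-parameter family of sizes. -/
noncomputable def pVar (p : ℝ) (N : ℝ → ℝ → ℝ≥0∞) (s t : ℝ) : ℝ≥0∞ :=
  pVarPow p N s t ^ (1 / p)

/-- The function `x` is càdlàg on `[a, b]`. -/
def IsCadlagOn {G : Type*} [TopologicalSpace G] (x : ℝ → G) (a b : ℝ) : Prop :=
  (∀ t ∈ Ico a b, Tendsto x (𝓝[>] t) (𝓝 (x t))) ∧ ∀ t ∈ Ioc a b, ∃ l, Tendsto x (𝓝[<] t) (𝓝 l)

/-- `(X, 𝕏)` is a càdlàg rough path of finite `p`-variation on `[0, T]`. -/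
structure IsRoughPath {V : Type*} [NormedAddCommGroup V] [NormedSpace ℝ V] [FiniteDimensional ℝ V]
    (T p : ℝ) (X : ℝ → V) (XX : ℝ → ℝ → V ⊗[ℝ] V) : Prop where
  cadlag : IsCadlagOn X 0 T
  cadlag_right : ∀ s ∈ Icc 0 T, IsCadlagOn (fun t => XX s t) s T
  cadlag_left : ∀ t ∈ Icc 0 T, IsCadlagOn (fun s => XX s t) 0 t
  pVar_lt : pVar p (fun s t => ‖X t - X s‖ₑ) 0 T < ∞
  pVar_lt' : pVar (p / 2) (fun s t => ‖XX s t‖ₑ) 0 T < ∞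
  chen : ∀ s u t : ℝ, 0 ≤ s → s ≤ u → u ≤ t → t ≤ T →
    XX s t = XX s u + XX u t + (X u - X s) ⊗ₜ[ℝ] (X t - X u)

/-! ### Spaces of processes -/

section Stoch

variable {Ω : Type*} {m0 : MeasurableSpace Ω}
variable {G : Type*} [NormedAddCommGroup G] [NormedSpace ℝ G]

/-- The norm `‖Z‖_{q,r,s} = ‖𝔼[|Z|^q | 𝒢]‖_{L^r}^{1/q}` for the sub-σ-algebra `𝒢 = ℱ_s`.
Mathlib's conditional expectation is `0` on non-integrable functions, so the value `∞` outside of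
`L^q` is set by hand. -/
noncomputable def condNorm (μ : Measure Ω) (𝒢 : MeasurableSpace Ω) (q : ℝ) (r : ℝ≥0∞)
    (Z : Ω → G) : ℝ≥0∞ :=
  open Classical in
  if MemLp Z (ENNReal.ofReal q) μ then
    eLpNorm (μ[fun ω => ‖Z ω‖ ^ q | 𝒢]) r μ ^ (1 / q)
  else ∞

/-- Adaptedness on `[0, T]`. -/
def IsAdaptedOn (ℱ : Filtration ℝ m0) (T : ℝ) (Z : ℝ → Ω → G) : Prop :=
  ∀ t ∈ Icc 0 T, StronglyMeasurable[ℱ t] (Z t)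

/-- Right-continuity in probability on `[0, T]`. -/
def IsRightContInProb (μ : Measure Ω) (T : ℝ) (Z : ℝ → Ω → G) : Prop :=
  ∀ s ∈ Ico 0 T, TendstoInMeasure μ Z (𝓝[>] s) (Z s)

/-- The space `V^p L^q` of processes on `[0, T]`. -/
structure InVpLq (μ : Measure Ω) (T p q : ℝ) (Z : ℝ → Ω → G) : Prop where
  meas : ∀ t ∈ Icc 0 T, AEStronglyMeasurable (Z t) μ
  rightCont : IsRightContInProb μ T Z
  init : MemLp (Z 0) (ENNReal.ofReal q) μ
  pVar_lt : pVar p (fun s t => eLpNorm (Z t - Z s) (ENNReal.ofReal q) μ) 0 T < ∞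

/-- The space `V^p L^{q,r}` of processes on `[0, T]`. -/
structure InVpLqr (μ : Measure Ω) (ℱ : Filtration ℝ m0) (T p q : ℝ) (r : ℝ≥0∞)
    (Z : ℝ → Ω → G) : Prop where
  meas : ∀ t ∈ Icc 0 T, AEStronglyMeasurable (Z t) μ
  rightCont : IsRightContInProb μ T Z
  init : MemLp (Z 0) (ENNReal.ofReal q) μ
  pVar_lt : pVar p (fun s t => condNorm μ (ℱ s) q r (Z t - Z s)) 0 T < ∞

/-- `L` is the limit in `L^a`, as the mesh size tends to zero, of the sums of `Ξ` over partitions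
of `[s, t]`. -/
def IsMeshLimit (μ : Measure Ω) (a : ℝ) (Ξ : ℝ → ℝ → Ω → G) (s t : ℝ) (L : Ω → G) : Prop :=
  MemLp L (ENNReal.ofReal a) μ ∧ ∀ ε : ℝ≥0∞, 0 < ε → ∃ δ : ℝ, 0 < δ ∧
    ∀ P : TimePartition s t, P.MeshLT δ → eLpNorm (L - P.sum Ξ) (ENNReal.ofReal a) μ ≤ ε

/-- `L` is the left limit `Z_{t-}`, as a limit in `L^a`. -/
def IsLeftLimit (μ : Measure Ω) (a : ℝ) (Z : ℝ → Ω → G) (t : ℝ) (L : Ω → G) : Prop :=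
  MemLp L (ENNReal.ofReal a) μ ∧
    Tendsto (fun s => eLpNorm (Z s - L) (ENNReal.ofReal a) μ) (𝓝[<] t) (𝓝 0)

/-- The series `∑ J i` converges absolutely in `L^1`, with sum `S`. -/
def IsL1Sum {ι : Type*} (μ : Measure Ω) (J : ι → Ω → G) (S : Ω → G) : Prop :=
  MemLp S 1 μ ∧ (∀ i, MemLp (J i) 1 μ) ∧ ∑' i, eLpNorm (J i) 1 μ < ∞ ∧
    Tendsto (fun A : Finset ι => eLpNorm (S - ∑ i ∈ A, J i) 1 μ) atTop (𝓝 0)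

end Stoch

section Controlled

variable {Ω : Type*} {m0 : MeasurableSpace Ω}
variable {V E G : Type*} [NormedAddCommGroup V] [NormedSpace ℝ V] [FiniteDimensional ℝ V]
  [NormedAddCommGroup E] [NormedSpace ℝ E] [FiniteDimensional ℝ E]
  [NormedAddCommGroup G] [NormedSpace ℝ G] [FiniteDimensional ℝ G]

/-- The remainder `R_{s,t} = δY_{s,t} - Y'_s δX_{s,t}`. -/
def remainder (X : ℝ → V) (Y : ℝ → Ω → E) (Y' : ℝ → Ω → V →L[ℝ] E) (s t : ℝ) (ω : Ω) : E :=
  Y t ω - Y s ω - Y' s ω (X t - X s)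

/-- `(Y, Y')` is a stochastic controlled path relative to `X`, i.e. it belongs to
`𝒱_X^{p,q,r}`. -/
structure IsControlledPath (μ : Measure Ω) (ℱ : Filtration ℝ m0) (T p q : ℝ) (r : ℝ≥0∞)
    (X : ℝ → V) (Y : ℝ → Ω → E) (Y' : ℝ → Ω → V →L[ℝ] E) : Prop where
  adapted : IsAdaptedOn ℱ T Y
  adapted' : IsAdaptedOn ℱ T Y'
  inVpLqr : InVpLqr μ ℱ T p q r Y
  inVpLqr' : InVpLqr μ ℱ T p q r Y'
  bounded' : ⨆ s ∈ Icc 0 T, eLpNorm (Y' s) (ENNReal.ofReal q * r) μ < ∞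
  remainder_lt : pVar (p / 2)
    (fun s t => eLpNorm (μ[remainder X Y Y' s t | ℱ s]) (ENNReal.ofReal q * r) μ) 0 T < ∞

/-- The germ `δY_{u,v} ⊗ δY_{u,v} - 2 (Y'_u ⊗ Y'_u) Sym(𝕏_{u,v})` of the bracket. -/
noncomputable def bracketGerm (XX : ℝ → ℝ → V ⊗[ℝ] V) (Y : ℝ → Ω → E) (Y' : ℝ → Ω → V →L[ℝ] E)
    (u v : ℝ) (ω : Ω) : E ⊗[ℝ] E :=
  (Y v ω - Y u ω) ⊗ₜ[ℝ] (Y v ω - Y u ω) -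
    (2 : ℝ) • TensorProduct.map (Y' u ω).toLinearMap (Y' u ω).toLinearMap (symPart (XX u v))

/-- `B` is the bracket process `[Y] = [Y, Y]` of the stochastic controlled path `(Y, Y')`. -/
structure IsBracket (μ : Measure Ω) (ℱ : Filtration ℝ m0) (T p q : ℝ) (XX : ℝ → ℝ → V ⊗[ℝ] V)
    (Y : ℝ → Ω → E) (Y' : ℝ → Ω → V →L[ℝ] E) (B : ℝ → Ω → E ⊗[ℝ] E) : Prop where
  adapted : IsAdaptedOn ℱ T B
  inVpLq : InVpLq μ T (p / 2) (q / 2) B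
  limit : ∀ t ∈ Icc 0 T, IsMeshLimit μ (q / 2) (bracketGerm XX Y Y') 0 t (B t)

/-- The germ `A_u δY_{u,v} + (A'_u ⊗ Y'_u) 𝕏_{u,v}` of the integral of `(A, A')` against `(Y, Y')`,
where the operator `A_u` is applied to `δY_{u,v}`, and `a ⊗ b` is mapped to
`(A'_u a) (Y'_u b)`. -/
noncomputable def integralGerm (XX : ℝ → ℝ → V ⊗[ℝ] V)
    (A : ℝ → Ω → E →L[ℝ] G) (A' : ℝ → Ω → V →L[ℝ] E →L[ℝ] G)
    (Y : ℝ → Ω → E) (Y' : ℝ → Ω → V →L[ℝ] E) (u v : ℝ) (ω : Ω) : G :=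
  A u ω (Y v ω - Y u ω) +
    contract ((A' u ω).bilinearComp (ContinuousLinearMap.id ℝ V) (Y' u ω)) (XX u v)

/-- `I` is the integral process `∫_0^· A_u dY_u` of the stochastic controlled path `(A, A')`
against the stochastic controlled path `(Y, Y')`. -/
structure IsControlledIntegral (μ : Measure Ω) (ℱ : Filtration ℝ m0) (T p q : ℝ)
    (XX : ℝ → ℝ → V ⊗[ℝ] V) (A : ℝ → Ω → E →L[ℝ] G) (A' : ℝ → Ω → V →L[ℝ] E →L[ℝ] G)
    (Y : ℝ → Ω → E) (Y' : ℝ → Ω → V →L[ℝ] E) (I : ℝ → Ω → G) : Prop where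
  adapted : IsAdaptedOn ℱ T I
  inVpLq : InVpLq μ T p (q / 2) I
  init : I 0 =ᵐ[μ] 0
  limit : ∀ s t : ℝ, 0 ≤ s → s ≤ t → t ≤ T →
    IsMeshLimit μ (q / 2) (integralGerm XX A A' Y Y') s t (I t - I s)

/-- `K` is the `L^a`-valued Young integral `∫_0^· H_u dB_u`, where the bilinear maps `H_u` act on
the tensor-valued increments of `B`. -/
structure IsYoungIntegral (μ : Measure Ω) (T a : ℝ) (H : ℝ → Ω → E →L[ℝ] E →L[ℝ] G)
    (B : ℝ → Ω → E ⊗[ℝ] E) (K : ℝ → Ω → G) : Prop where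
  init : K 0 =ᵐ[μ] 0
  limit : ∀ s t : ℝ, 0 ≤ s → s ≤ t → t ≤ T →
    IsMeshLimit μ a (fun u v ω => contract (H u ω) (B v ω - B u ω)) s t (K t - K s)

/-- The second Fréchet derivative `D²f`. -/
noncomputable def D2 (f : E → G) : E → E →L[ℝ] E →L[ℝ] G := fderiv ℝ (fderiv ℝ f)

/-- `f ∈ C_b^3`: `f` is twice continuously differentiable, `f`, `Df` and `D²f` are bounded, and
`D²f` is Lipschitz continuous. -/
def IsC3b (f : E → G) : Prop :=
  ContDiff ℝ 2 f ∧ (∃ C : ℝ, ∀ x, ‖f x‖ ≤ C ∧ ‖fderiv ℝ f x‖ ≤ C ∧ ‖D2 f x‖ ≤ C) ∧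
    ∃ L : ℝ≥0, LipschitzWith L (D2 f)

/-- The times `s ∈ (0, t]` with `‖ΔY_s‖_{L^q} ≠ 0`, where `Ym s` stands for `Y_{s-}`. -/
def jumpTimes (μ : Measure Ω) (q : ℝ) (Y Ym : ℝ → Ω → E) (t : ℝ) : Set ℝ :=
  {s | 0 < s ∧ s ≤ t ∧ eLpNorm (Y s - Ym s) (ENNReal.ofReal q) μ ≠ 0}

/-- The jump term `Δf(Y)_s - Df(Y_{s-}) ΔY_s - ½ D²f(Y_{s-}) (ΔY_s ⊗ ΔY_s)`, where `Ym s` stands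
for `Y_{s-}`. -/
noncomputable def jumpTerm (f : E → G) (Y Ym : ℝ → Ω → E) (s : ℝ) (ω : Ω) : G :=
  f (Y s ω) - f (Ym s ω) - fderiv ℝ f (Ym s ω) (Y s ω - Ym s ω) -
    (1 / 2 : ℝ) • contract (D2 f (Ym s ω)) ((Y s ω - Ym s ω) ⊗ₜ[ℝ] (Y s ω - Ym s ω))

end Controlled

end RoughIto

open RoughIto

set_option linter.unusedSectionVars false

/-! Write q = 2a, so that all integrals live in L^a with a ≥ 2. The hypotheses on X, 𝕏, Y, Y' are
condensed into one right-continuous increasing function g (`exists_controlledBounds`): first-order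
increments over [s,t] have size (g t - g s)^{1/p}, while 𝕏 and the conditional mean of the remainder
have size (g t - g s)^{2/p}. Jumps of the data are absorbed into jumps of g.

The engine is a stochastic sewing lemma. With x = g u - g s and y = g t - g u, the defect Ξ_{s,t} -
Ξ_{s,u} - Ξ_{u,t} of a germ is required to be of order (xy)^{1/p} in L^a, and its conditional mean
given ℱ_s of order x^{1/p} y^{2/p} + x^{2/p} y^{1/p} (`IsSewable`). The total powers satisfy 2/p >
1/2 and 3/p > 1. Martingale parts add in squares, because L^a is two-smooth (`lpNorm_add_sq_le`, in
the role of Burkholder's inequality); drifts add linearly; bisection then gains a geometric factor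
(`discrete_sewing_real`). The product form of the bounds takes care of jumps. On a short interval g
varies by at most ε before and after a single time τ (`OscLE`). Once the cell around τ is cut out,
every defect that occurs has total increment at most ε, or x ≤ ε, or y ≤ ε, and so gains a power of
ε. Hence Riemann sums converge as the mesh tends to zero, and not only under refinement.

Three germs are sewn. The germ φ(Y)δY + Dφ(Y)(Y'⊗Y')𝕏 with φ = Df gives the rough integral. With
φ(y) = y ⊗ · it controls the bracket, whose germ is δ(Y⊗Y) minus this germ and its transpose
(`bracketGerm_eq`). The bracket germ contracted with D²f(Y) gives the Young integral. Hölder's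
inequality alone does not suffice: |δY|² is only in L^a, and one more unbounded factor would leave
that space. The mixed norm with r ≥ 2 repairs this by conditioning
(`lpBound_mul_sq_of_condNorm_le`).

For the formula, f(Y_v) - f(Y_u) is exactly the germ of the integral, plus half the contracted
bracket germ, plus a second-order Taylor remainder; the terms in 𝕏 cancel because D²f is symmetric
(`IsC3Bounded.comp_sub_eq`). The first two sums converge to the integrals. The remainder is cubic:
over a cell with exceptional time τ it differs from the jump term at τ by O(ε^{3/p-1}(g v - g u)) in
L^1 (`taylorRem_sub_jumpTerm_le`), and all jumps away from the chosen times are at most ε, so their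
total contribution vanishes as well (`exists_jumpSum`). -/

namespace RoughIto

/-! ### Bounds in `L^a` -/

section LpBound

variable {Ω : Type*} {m0 : MeasurableSpace Ω} {μ : Measure Ω}
variable {G G₁ G₂ : Type*} [NormedAddCommGroup G] [NormedAddCommGroup G₁] [NormedAddCommGroup G₂]

/-- `Z ∈ L^a`, with norm at most `c`. -/
structure LpBound (μ : Measure Ω) (a : ℝ) (Z : Ω → G) (c : ℝ) : Prop where
  meas : AEStronglyMeasurable Z μ
  nonneg : 0 ≤ c
  le : eLpNorm Z (ENNReal.ofReal a) μ ≤ ENNReal.ofReal c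

namespace LpBound

variable {a b c d : ℝ} {Z W : Ω → G}

theorem memLp (h : LpBound μ a Z c) : MemLp Z (ENNReal.ofReal a) μ :=
  ⟨h.meas, h.le.trans_lt ENNReal.ofReal_lt_top⟩

theorem _root_.MeasureTheory.MemLp.lpBound (h : MemLp Z (ENNReal.ofReal a) μ) :
    LpBound μ a Z (eLpNorm Z (ENNReal.ofReal a) μ).toReal :=
  ⟨h.1, ENNReal.toReal_nonneg, (ENNReal.ofReal_toReal h.2.ne).ge⟩

theorem mono (h : LpBound μ a Z c) (hcd : c ≤ d) : LpBound μ a Z d :=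
  ⟨h.meas, h.nonneg.trans hcd, h.le.trans (ENNReal.ofReal_le_ofReal hcd)⟩

theorem congr (h : LpBound μ a Z c) (hZ : Z =ᵐ[μ] W) : LpBound μ a W c :=
  ⟨h.meas.congr hZ, h.nonneg, (eLpNorm_congr_ae hZ).symm.trans_le h.le⟩

theorem of_norm_le {Z₁ : Ω → G₁} (h : LpBound μ a Z₁ c) (hZ : AEStronglyMeasurable Z μ)
    (hle : ∀ᵐ ω ∂μ, ‖Z ω‖ ≤ ‖Z₁ ω‖) : LpBound μ a Z c :=
  ⟨hZ, h.nonneg, (eLpNorm_mono_ae hle).trans h.le⟩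

theorem of_norm_le_mul {Z₁ : Ω → G₁} (h : LpBound μ a Z₁ c) (hZ : AEStronglyMeasurable Z μ)
    {K : ℝ} (hK : 0 ≤ K) (hle : ∀ᵐ ω ∂μ, ‖Z ω‖ ≤ K * ‖Z₁ ω‖) : LpBound μ a Z (K * c) := by
  refine ⟨hZ, mul_nonneg hK h.nonneg, ?_⟩
  refine (eLpNorm_le_mul_eLpNorm_of_ae_le_mul hle _).trans ?_
  rw [ENNReal.ofReal_mul hK]
  gcongr
  exact h.le

theorem zero (hc : 0 ≤ c) : LpBound μ a (0 : Ω → G) c :=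
  ⟨aestronglyMeasurable_zero, hc, by simp⟩

theorem neg (h : LpBound μ a Z c) : LpBound μ a (-Z) c :=
  ⟨h.meas.neg, h.nonneg, by rw [eLpNorm_neg]; exact h.le⟩

theorem add (ha : 1 ≤ a) (h : LpBound μ a Z c) (h' : LpBound μ a W d) :
    LpBound μ a (Z + W) (c + d) := by
  refine ⟨h.meas.add h'.meas, add_nonneg h.nonneg h'.nonneg, ?_⟩
  rw [ENNReal.ofReal_add h.nonneg h'.nonneg]
  refine (eLpNorm_add_le h.meas h'.meas (by simpa using ha)).trans ?_
  gcongr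
  exacts [h.le, h'.le]

theorem sub (ha : 1 ≤ a) (h : LpBound μ a Z c) (h' : LpBound μ a W d) :
    LpBound μ a (Z - W) (c + d) := by
  rw [sub_eq_add_neg]
  exact h.add ha h'.neg

theorem sum (ha : 1 ≤ a) {ι : Type*} (A : Finset ι) {Z : ι → Ω → G} {c : ι → ℝ}
    (h : ∀ i ∈ A, LpBound μ a (Z i) (c i)) : LpBound μ a (∑ i ∈ A, Z i) (∑ i ∈ A, c i) := by
  classical
  induction A using Finset.induction_on with
  | empty => simpa using zero le_rfl
  | insert i A hi ih =>
    rw [Finset.sum_insert hi, Finset.sum_insert hi]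
    exact (h i (by simp)).add ha (ih fun j hj => h j (by simp [hj]))

/-- Hölder's inequality `L^{2b} × L^{2b} → L^b`. -/
theorem of_norm_le_mul_mul {Z₁ : Ω → G₁} {Z₂ : Ω → G₂}
    (h₁ : LpBound μ (2 * b) Z₁ c) (h₂ : LpBound μ (2 * b) Z₂ d)
    (hZ : AEStronglyMeasurable Z μ) {K : ℝ} (hK : 0 ≤ K)
    (hle : ∀ᵐ ω ∂μ, ‖Z ω‖ ≤ K * (‖Z₁ ω‖ * ‖Z₂ ω‖)) : LpBound μ b Z (K * (c * d)) := by
  have h12 : LpBound μ b (fun ω => ‖Z₁ ω‖ * ‖Z₂ ω‖) (c * d) := by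
    refine ⟨h₁.meas.norm.mul h₂.meas.norm, mul_nonneg h₁.nonneg h₂.nonneg, ?_⟩
    have : ENNReal.HolderTriple (ENNReal.ofReal (2 * b)) (ENNReal.ofReal (2 * b))
        (ENNReal.ofReal b) := by
      constructor
      rw [ENNReal.ofReal_mul (by norm_num), ENNReal.mul_inv (by simp) (by simp), ← add_mul]
      simp [ENNReal.inv_two_add_inv_two]
    have h := eLpNorm_le_eLpNorm_mul_eLpNorm_of_nnnorm (p := ENNReal.ofReal (2 * b))
      (q := ENNReal.ofReal (2 * b)) (r := ENNReal.ofReal b) h₁.meas h₂.meas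
      (fun x y => ‖x‖ * ‖y‖) 1 (ae_of_all _ fun ω => by simp)
    refine h.trans ?_
    rw [ENNReal.ofReal_mul h₁.nonneg, ENNReal.coe_one, one_mul]
    gcongr
    exacts [h₁.le, h₂.le]
  refine h12.of_norm_le_mul hZ hK (hle.mono fun ω hω => hω.trans_eq ?_)
  simp

theorem exponent_mono [IsProbabilityMeasure μ] (h : LpBound μ a Z c) (hba : b ≤ a) :
    LpBound μ b Z c :=
  ⟨h.meas, h.nonneg, (eLpNorm_le_eLpNorm_of_exponent_le (ENNReal.ofReal_le_ofReal hba)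
    h.meas).trans h.le⟩

theorem of_bound [IsProbabilityMeasure μ] (hZ : AEStronglyMeasurable Z μ) (hc : 0 ≤ c)
    (h : ∀ᵐ ω ∂μ, ‖Z ω‖ ≤ c) : LpBound μ a Z c :=
  ⟨hZ, hc, by simpa using eLpNorm_le_of_ae_bound (p := ENNReal.ofReal a) h⟩

theorem integrable [IsProbabilityMeasure μ] (ha : 1 ≤ a) (h : LpBound μ a Z c) :
    Integrable Z μ := h.memLp.integrable (by simpa using ha)

theorem condExp [NormedSpace ℝ G] [CompleteSpace G] (ha : 1 ≤ a) (h : LpBound μ a Z c)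
    (m : MeasurableSpace Ω) : LpBound μ a (μ[Z | m]) c :=
  ⟨(integrable_condExp).1, h.nonneg, (eLpNorm_condExp_le_eLpNorm _ (by simpa using ha)).trans h.le⟩

theorem of_forall_pos (hc : 0 ≤ c) (h : ∀ ε : ℝ, 0 < ε → LpBound μ a Z (c + ε)) :
    LpBound μ a Z c := by
  refine ⟨(h 1 one_pos).meas, hc, ENNReal.le_of_forall_pos_le_add fun ε hε _ => ?_⟩
  refine (h ε hε).le.trans_eq ?_
  rw [ENNReal.ofReal_add hc ε.coe_nonneg, ENNReal.ofReal_coe_nnreal]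

theorem ae_eq_zero (ha : 1 ≤ a) (h : LpBound μ a Z 0) : Z =ᵐ[μ] 0 := by
  have h0 : eLpNorm Z (ENNReal.ofReal a) μ = 0 := by simpa using h.le
  rwa [eLpNorm_eq_zero_iff h.meas (by simp; linarith)] at h0

/-- Fatou's lemma for `L^a`-bounds. -/
theorem of_tendstoInMeasure {ι : Type*} {l : Filter ι} [NeBot l] [l.IsCountablyGenerated]
    {Z : ι → Ω → G} (h : ∀ᶠ i in l, LpBound μ a (Z i) c) (hW : TendstoInMeasure μ Z l W) :
    LpBound μ a W c := by
  obtain ⟨v, hv⟩ := exists_seq_tendsto l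
  obtain ⟨N, hN⟩ := eventually_atTop.1 (hv.eventually h)
  have hvN : Tendsto (fun n => v (n + N)) atTop l := hv.comp (tendsto_add_atTop_nat N)
  obtain ⟨w, -, hw⟩ := TendstoInMeasure.exists_seq_tendsto_ae (f := fun n => Z (v (n + N)))
    (fun ε hε => (hW ε hε).comp hvN)
  have hb : ∀ n, LpBound μ a (Z (v (w n + N))) c := fun n => hN _ (by omega)
  exact ⟨aestronglyMeasurable_of_tendsto_ae atTop (fun n => (hb n).meas) hw, (hb 0).nonneg,
    Lp.eLpNorm_le_of_ae_tendsto (u := atTop) (.of_forall fun n => (hb n).le)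
      (fun n => (hb n).meas) hw⟩

theorem tendstoInMeasure (ha : 1 ≤ a) {ι : Type*} {l : Filter ι} {Z : ι → Ω → G} {c : ι → ℝ}
    (hZ : ∀ i, AEStronglyMeasurable (Z i) μ) (hW : AEStronglyMeasurable W μ)
    (h : ∀ᶠ i in l, LpBound μ a (Z i - W) (c i)) (hc : Tendsto c l (𝓝 0)) :
    TendstoInMeasure μ Z l W := by
  refine tendstoInMeasure_of_tendsto_eLpNorm (p := ENNReal.ofReal a) (by simp; linarith) hZ hW ?_
  have h0 : Tendsto (fun i => ENNReal.ofReal (c i)) l (𝓝 0) := by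
    simpa using ENNReal.tendsto_ofReal hc
  exact tendsto_of_tendsto_of_tendsto_of_le_of_le' tendsto_const_nhds h0
    (.of_forall fun _ => zero_le) (h.mono fun i hi => hi.le)

end LpBound

end LpBound

end RoughIto

namespace RoughIto

/-! ### Two-smoothness of `L^a` for `a ≥ 2` -/

section Smoothness

/-- Bernoulli's inequality at (1 + z)⁻¹ = 1 - z/(1 + z), multiplied by (1 + z)^b. -/
theorem one_add_rpow_sub_one_le {z b : ℝ} (hz : -1 < z) (hb : 1 ≤ b) :
    (1 + z) ^ b - 1 ≤ b * z * (1 + z) ^ (b - 1) := by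
  have h1 : 0 < 1 + z := by linarith
  have h := one_add_mul_self_le_rpow_one_add (s := -z / (1 + z)) (p := b)
    (by rw [le_div_iff₀ h1]; linarith) hb
  have h2 : 1 + -z / (1 + z) = (1 + z)⁻¹ := by field_simp; ring
  rw [h2, Real.inv_rpow h1.le] at h
  have h3 : 0 < (1 + z) ^ b := by positivity
  have h4 : (1 + z) ^ (b - 1) = (1 + z) ^ b / (1 + z) := by rw [Real.rpow_sub h1, Real.rpow_one]
  rw [h4]
  have h5 := mul_le_mul_of_nonneg_left h h3.le
  rw [mul_inv_cancel₀ h3.ne'] at h5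
  have h6 : (1 + z) ^ b * (1 + b * (-z / (1 + z))) =
      (1 + z) ^ b - b * z * ((1 + z) ^ b / (1 + z)) := by field_simp; ring
  linarith

/-- The previous bound leaves only z((1 + z)^{a-1} - 1) to estimate. For z ≥ 0 the same bound with
exponent a - 1 applies; for z < 0 Bernoulli's lower bound is reversed by the sign of z. -/
theorem one_add_rpow_le {z a : ℝ} (hz : |z| ≤ 1 / 2) (ha : 2 ≤ a) :
    (1 + z) ^ a ≤ 1 + a * z + a * (a - 1) * 2 ^ a * z ^ 2 := by
  obtain ⟨hz1, hz2⟩ := abs_le.1 hz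
  have h1 := one_add_rpow_sub_one_le (z := z) (b := a) (by linarith) (by linarith)
  have hp : (1 : ℝ) ≤ 2 ^ a := Real.one_le_rpow (by norm_num) (by linarith)
  suffices h : z * ((1 + z) ^ (a - 1) - 1) ≤ (a - 1) * 2 ^ a * z ^ 2 by
    nlinarith
  rcases le_or_gt 0 z with h0 | h0
  · have h2 := one_add_rpow_sub_one_le (z := z) (b := a - 1) (by linarith) (by linarith)
    have h3 : (1 + z) ^ (a - 1 - 1) ≤ 2 ^ a :=
      (Real.rpow_le_rpow (by linarith) (by linarith) (by linarith)).trans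
        (Real.rpow_le_rpow_of_exponent_le (by norm_num) (by linarith))
    calc z * ((1 + z) ^ (a - 1) - 1) ≤ z * ((a - 1) * z * (1 + z) ^ (a - 1 - 1)) := by gcongr
      _ ≤ z * ((a - 1) * z * 2 ^ a) := by gcongr; nlinarith
      _ = _ := by ring
  · have h2 := one_add_mul_self_le_rpow_one_add (s := z) (p := a - 1) (by linarith) (by linarith)
    have h3 : (a - 1) * z ≤ (1 + z) ^ (a - 1) - 1 := by linarith
    have h4 := mul_le_mul_of_nonpos_left h3 h0.le
    have h5 : 0 ≤ (a - 1) * z ^ 2 := mul_nonneg (by linarith) (sq_nonneg z)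
    nlinarith

/-- Second-order expansion of |·|^a at x. If |x| ≤ 2|y| every term is dominated by |y|^a; otherwise
factor out |x| and expand in z = y/x, where |z| ≤ 1/2. -/
theorem abs_add_rpow_le {a : ℝ} (ha : 2 ≤ a) : ∃ C : ℝ, 0 ≤ C ∧ ∀ x y : ℝ,
    |x + y| ^ a ≤ |x| ^ a + a * (|x| ^ (a - 2) * x * y) +
      C * (|x| ^ (a - 2) * y ^ 2 + |y| ^ a) := by
  have e : ∀ t : ℝ, 0 < t → t ^ a = t ^ (a - 2) * t ^ 2 := fun t ht => by
    rw [← Real.rpow_natCast, ← Real.rpow_add ht]; norm_num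
  -- The summands come from |x + y| ≤ 3|y| and from the linear term, both for |x| ≤ 2|y|, and from
  -- `one_add_rpow_le` in the other case.
  refine ⟨3 ^ a + a * 2 ^ a + a * (a - 1) * 2 ^ a, ?_, fun x y => ?_⟩
  · have : 0 ≤ a * (a - 1) := by nlinarith
    positivity
  have haa : 0 ≤ a * (a - 1) * 2 ^ a := mul_nonneg (by nlinarith) (by positivity)
  rcases eq_or_ne y 0 with rfl | hy
  · simp [Real.zero_rpow (by linarith : a ≠ 0)]
  have hy0 : 0 < |y| := abs_pos.2 hy
  rcases le_or_gt |x| (2 * |y|) with h | h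
  · have h1 : |x + y| ^ a ≤ 3 ^ a * |y| ^ a := by
      rw [← Real.mul_rpow (by norm_num) (abs_nonneg _)]
      exact Real.rpow_le_rpow (abs_nonneg _) ((abs_add_le x y).trans (by linarith)) (by linarith)
    have h2 : -(a * (|x| ^ (a - 2) * x * y)) ≤ a * 2 ^ a * |y| ^ a := by
      rw [mul_assoc a (2 ^ a), ← Real.mul_rpow (by norm_num) (abs_nonneg _), e _ (by positivity),
        ← mul_neg]
      gcongr
      calc -(|x| ^ (a - 2) * x * y) ≤ |(|x| ^ (a - 2) * x * y)| := neg_le_abs _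
        _ = |x| ^ (a - 2) * (|x| * |y|) := by
          rw [abs_mul, abs_mul, abs_of_nonneg (by positivity), mul_assoc]
        _ ≤ (2 * |y|) ^ (a - 2) * (2 * |y|) ^ 2 := by
          gcongr ?_ * ?_
          · exact Real.rpow_le_rpow (abs_nonneg _) h (by linarith)
          · nlinarith
    have h3 : 0 ≤ |x| ^ a := by positivity
    have h4 : 0 ≤ |x| ^ (a - 2) * y ^ 2 := by positivity
    have h5 : 0 ≤ |y| ^ a := by positivity
    have h6 : (0 : ℝ) ≤ 3 ^ a + a * 2 ^ a := by positivity
    have h7 := mul_nonneg (add_nonneg h6 haa) h4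
    have h8 := mul_nonneg haa h5
    nlinarith
  · have hx0 : 0 < |x| := by linarith
    have hx : x ≠ 0 := abs_pos.1 hx0
    have hz : |y / x| ≤ 1 / 2 := by
      rw [abs_div, div_le_div_iff₀ hx0 (by norm_num)]; linarith
    have h1 := one_add_rpow_le hz ha
    have h2 : |x + y| = |x| * (1 + y / x) := by
      rw [← abs_of_nonneg (show 0 ≤ 1 + y / x by linarith [(abs_le.1 hz).1]), ← abs_mul]
      congr 1
      field_simp
    rw [h2, Real.mul_rpow (abs_nonneg _) (by linarith [(abs_le.1 hz).1])]
    have h3 := mul_le_mul_of_nonneg_left h1 (show 0 ≤ |x| ^ a by positivity)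
    refine h3.trans ?_
    have h4 : |x| ^ a * (a * (y / x)) = a * (|x| ^ (a - 2) * x * y) := by
      rw [e _ hx0, sq_abs]; field_simp
    have h5 : |x| ^ a * (a * (a - 1) * 2 ^ a * (y / x) ^ 2) =
        a * (a - 1) * 2 ^ a * (|x| ^ (a - 2) * y ^ 2) := by
      rw [e _ hx0, sq_abs]; field_simp
    rw [mul_add, mul_add, mul_one, h4, h5]
    have h6 : (0 : ℝ) ≤ 3 ^ a + a * 2 ^ a := by positivity
    have h7 : 0 ≤ |x| ^ (a - 2) * y ^ 2 := by positivity
    have h8 : 0 ≤ |y| ^ a := by positivity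
    nlinarith [mul_nonneg h6 h7, mul_nonneg (add_nonneg h6 haa) h8]

/-- This turns an additive bound on a-th powers into one on squares, the form that can be iterated.
Superadditivity of t ↦ t^{a/2} absorbs d^a and Bernoulli's inequality absorbs the mixed term. -/
theorem rpow_add_le_sq_add_sq_rpow {a C : ℝ} (ha : 2 ≤ a) (hC : 0 ≤ C) :
    ∃ K : ℝ, 0 ≤ K ∧ ∀ s d : ℝ, 0 ≤ s → 0 ≤ d →
      s ^ a + C * (s ^ (a - 2) * d ^ 2 + d ^ a) ≤ (s ^ 2 + K * d ^ 2) ^ (a / 2) := by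
  have ha2 : 1 ≤ a / 2 := by linarith
  have e : ∀ t : ℝ, 0 ≤ t → (t ^ 2) ^ (a / 2) = t ^ a := fun t ht => by
    rw [← Real.rpow_natCast, ← Real.rpow_mul ht]; congr 1; push_cast; ring
  have e' : ∀ t : ℝ, 0 ≤ t → (t ^ 2) ^ (a / 2 - 1) = t ^ (a - 2) := fun t ht => by
    rw [← Real.rpow_natCast, ← Real.rpow_mul ht]; congr 1; push_cast; ring
  -- Each of `h1` and `h2` absorbs one error term with weight K, so their average absorbs both with
  -- weight K/2 ≥ C. The summand 1 ensures K ≤ K^{a/2}.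
  refine ⟨2 * C + 1, by positivity, fun s d hs hd => ?_⟩
  set K := 2 * C + 1
  have hK : 1 ≤ K := by simp only [K]; linarith
  have hy : 0 ≤ K * d ^ 2 := by positivity
  have h1 : s ^ a + K * d ^ a ≤ (s ^ 2 + K * d ^ 2) ^ (a / 2) := by
    have h := NNReal.add_rpow_le_rpow_add (p := a / 2) ⟨s ^ 2, by positivity⟩ ⟨_, hy⟩ ha2
    have h' : (s ^ 2) ^ (a / 2) + (K * d ^ 2) ^ (a / 2) ≤ (s ^ 2 + K * d ^ 2) ^ (a / 2) := by
      exact_mod_cast h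
    rw [e s hs, Real.mul_rpow (by linarith) (by positivity), e d hd] at h'
    have h3 : K ≤ K ^ (a / 2) := Real.self_le_rpow_of_one_le hK ha2
    have h4 : 0 ≤ d ^ a := by positivity
    nlinarith
  have h2 : s ^ a + K * (s ^ (a - 2) * d ^ 2) ≤ (s ^ 2 + K * d ^ 2) ^ (a / 2) := by
    rcases hs.eq_or_lt with rfl | hs
    · rcases ha.eq_or_lt with rfl | ha
      · simp
      · rw [Real.zero_rpow (by linarith), Real.zero_rpow (by linarith)]
        simp only [zero_mul, mul_zero, add_zero]
        positivity
    · have hs2 : 0 < s ^ 2 := by positivity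
      have h := one_add_mul_self_le_rpow_one_add (s := K * d ^ 2 / s ^ 2) (p := a / 2)
        (by have : 0 ≤ K * d ^ 2 / s ^ 2 := by positivity
            linarith) ha2
      have h3 : s ^ 2 + K * d ^ 2 = s ^ 2 * (1 + K * d ^ 2 / s ^ 2) := by field_simp
      rw [h3, Real.mul_rpow hs2.le (by positivity), e s hs.le]
      refine le_trans ?_ (mul_le_mul_of_nonneg_left h (by positivity))
      have h4 : s ^ a = s ^ (a - 2) * s ^ 2 := by
        rw [← e s hs.le, ← e' s hs.le, Real.rpow_sub hs2, Real.rpow_one]; field_simp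
      rw [mul_add, mul_one]
      have h5 : s ^ (a - 2) * s ^ 2 * (a / 2 * (K * d ^ 2 / s ^ 2)) =
        (a / 2) * (K * (s ^ (a - 2) * d ^ 2)) := by field_simp
      rw [h4, h5]
      refine add_le_add le_rfl ?_
      exact le_mul_of_one_le_left (by positivity) ha2
  have h3 : 0 ≤ s ^ (a - 2) * d ^ 2 := by positivity
  have h4 : 0 ≤ d ^ a := by positivity
  simp only [K] at h1 h2 ⊢
  nlinarith

variable {Ω : Type*} {m0 : MeasurableSpace Ω} {μ : Measure Ω}

theorem lpNorm_rpow_eq_integral {a : ℝ} (ha : 0 < a) {Z : Ω → ℝ}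
    (hZ : MemLp Z (ENNReal.ofReal a) μ) :
    lpNorm Z (ENNReal.ofReal a) μ ^ a = ∫ ω, |Z ω| ^ a ∂μ := by
  rw [lpNorm_eq_integral_norm_rpow_toReal (by simpa using ha) (by simp) hZ.1,
    ENNReal.toReal_ofReal ha.le, ← Real.rpow_mul (by positivity), inv_mul_cancel₀ ha.ne',
    Real.rpow_one]
  simp

theorem integrable_abs_rpow {a : ℝ} (ha : 0 < a) {Z : Ω → ℝ}
    (hZ : MemLp Z (ENNReal.ofReal a) μ) : Integrable (fun ω => |Z ω| ^ a) μ := by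
  simpa [ENNReal.toReal_ofReal ha.le] using
    hZ.integrable_norm_rpow (by simpa using ha) (by simp)

/-- A crude domination by the larger of s and d, needed only for integrability of the terms in the
expansion. -/
theorem rpow_sub_mul_le {a s d : ℝ} (ha : 2 ≤ a) (hs : 0 ≤ s) (hd : 0 ≤ d) :
    s ^ (a - 2) * d ^ 2 ≤ s ^ a + d ^ a ∧ s ^ (a - 2) * s * d ≤ s ^ a + d ^ a := by
  have e : ∀ t : ℝ, 0 ≤ t → t ^ (a - 2) * t ^ 2 = t ^ a := fun t ht => by
    rw [← Real.rpow_natCast, ← Real.rpow_add_of_nonneg ht (by linarith) (by norm_num)]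
    congr 1; push_cast; ring
  have hs' : 0 ≤ s ^ a := by positivity
  have hd' : 0 ≤ d ^ a := by positivity
  have h1 := e s hs
  have h2 := e d hd
  have hs2 : 0 ≤ s ^ (a - 2) := by positivity
  have hd2 : 0 ≤ d ^ (a - 2) := by positivity
  rcases le_total s d with h | h
  · have h3 : s ^ (a - 2) ≤ d ^ (a - 2) := Real.rpow_le_rpow hs h (by linarith)
    have h4 : s ^ (a - 2) * d ^ 2 ≤ d ^ (a - 2) * d ^ 2 := by gcongr
    have h5 : s ^ (a - 2) * s * d ≤ d ^ (a - 2) * d * d := by gcongr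
    constructor <;> nlinarith
  · have h4 : s ^ (a - 2) * d ^ 2 ≤ s ^ (a - 2) * s ^ 2 := by gcongr
    have h5 : s ^ (a - 2) * s * d ≤ s ^ (a - 2) * s * s := by gcongr
    constructor <;> nlinarith

/-- Hölder's inequality for |S|^a and |Z|^a with weights (a-2)/a and 2/a. In this form a = 2 needs
no separate treatment. -/
theorem integral_rpow_mul_sq_le {a : ℝ} (ha : 2 ≤ a) {S Z : Ω → ℝ}
    (hS : MemLp S (ENNReal.ofReal a) μ) (hZ : MemLp Z (ENNReal.ofReal a) μ) :
    ∫ ω, |S ω| ^ (a - 2) * Z ω ^ 2 ∂μ ≤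
      lpNorm S (ENNReal.ofReal a) μ ^ (a - 2) * lpNorm Z (ENNReal.ofReal a) μ ^ 2 := by
  have ha0 : 0 < a := by linarith
  have key := ENNReal.lintegral_mul_norm_pow_le (μ := μ)
    (f := fun ω => ENNReal.ofReal (|S ω| ^ a)) (g := fun ω => ENNReal.ofReal (|Z ω| ^ a))
    (integrable_abs_rpow ha0 hS).1.aemeasurable.ennreal_ofReal
    (integrable_abs_rpow ha0 hZ).1.aemeasurable.ennreal_ofReal
    (p := (a - 2) / a) (q := 2 / a) (div_nonneg (by linarith) ha0.le) (by positivity)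
    (by field_simp; ring)
  rw [← ofReal_integral_eq_lintegral_ofReal (integrable_abs_rpow ha0 hS)
      (.of_forall fun _ => by positivity),
    ← ofReal_integral_eq_lintegral_ofReal (integrable_abs_rpow ha0 hZ)
      (.of_forall fun _ => by positivity), ← lpNorm_rpow_eq_integral ha0 hS,
    ← lpNorm_rpow_eq_integral ha0 hZ] at key
  have e1 : ∀ t : ℝ, 0 ≤ t → ENNReal.ofReal (t ^ a) ^ ((a - 2) / a) =
      ENNReal.ofReal (t ^ (a - 2)) := fun t ht => by
    rw [ENNReal.ofReal_rpow_of_nonneg (by positivity) (div_nonneg (by linarith) ha0.le),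
      ← Real.rpow_mul ht]
    congr 2; field_simp
  have e2 : ∀ t : ℝ, 0 ≤ t → ENNReal.ofReal (t ^ a) ^ (2 / a) =
      ENNReal.ofReal (t ^ 2) := fun t ht => by
    rw [ENNReal.ofReal_rpow_of_nonneg (by positivity) (by positivity),
      ← Real.rpow_mul ht, ← Real.rpow_natCast]
    congr 2; field_simp; norm_num
  rw [e1 _ lpNorm_nonneg, e2 _ lpNorm_nonneg,
    ← ENNReal.ofReal_mul (Real.rpow_nonneg lpNorm_nonneg _)] at key
  have hm : AEStronglyMeasurable (fun ω => |S ω| ^ (a - 2) * Z ω ^ 2) μ :=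
    (((hS.1.aemeasurable.abs).pow_const _).mul (hZ.1.aemeasurable.pow_const 2)).aestronglyMeasurable
  rw [integral_eq_lintegral_of_nonneg_ae (.of_forall fun _ => by positivity) hm]
  refine ENNReal.toReal_le_of_le_ofReal
    (mul_nonneg (Real.rpow_nonneg lpNorm_nonneg _) (sq_nonneg _)) (le_trans (le_of_eq ?_) key)
  refine lintegral_congr fun ω => ?_
  rw [e1 _ (abs_nonneg _), e2 _ (abs_nonneg _), ← ENNReal.ofReal_mul (by positivity), sq_abs]

/-- `L^a` is two-smooth: martingale increments are almost orthogonal. -/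
theorem lpNorm_add_sq_le {a : ℝ} (ha : 2 ≤ a) : ∃ K : ℝ, 0 ≤ K ∧
    ∀ {Ω : Type*} {m m0 : MeasurableSpace Ω} {μ : Measure Ω} [IsProbabilityMeasure μ]
      {S Z : Ω → ℝ}, m ≤ m0 →
      StronglyMeasurable[m] S → MemLp S (ENNReal.ofReal a) μ → MemLp Z (ENNReal.ofReal a) μ →
      μ[Z | m] =ᵐ[μ] 0 →
      lpNorm (S + Z) (ENNReal.ofReal a) μ ^ 2 ≤
        lpNorm S (ENNReal.ofReal a) μ ^ 2 + K * lpNorm Z (ENNReal.ofReal a) μ ^ 2 := by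
  obtain ⟨C, hC, hC'⟩ := abs_add_rpow_le ha
  obtain ⟨K, hK, hK'⟩ := rpow_add_le_sq_add_sq_rpow ha hC
  have ha0 : 0 < a := by linarith
  refine ⟨K, hK, fun {Ω m m0 μ _ S Z} hm hSm hS hZ hZ0 => ?_⟩
  have hSi := integrable_abs_rpow ha0 hS
  have hZi := integrable_abs_rpow ha0 hZ
  have hSa := hS.1.aemeasurable
  have hZa := hZ.1.aemeasurable
  have i1 : Integrable (fun ω => |S ω| ^ (a - 2) * S ω * Z ω) μ := by
    refine (hSi.add hZi).mono'
      (((hSa.abs.pow_const _).mul hSa).mul hZa).aestronglyMeasurable (.of_forall fun ω => ?_)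
    rw [Real.norm_eq_abs, abs_mul, abs_mul, abs_of_nonneg (by positivity)]
    exact (rpow_sub_mul_le ha (abs_nonneg _) (abs_nonneg _)).2
  have i2 : Integrable (fun ω => |S ω| ^ (a - 2) * Z ω ^ 2) μ := by
    refine (hSi.add hZi).mono'
      ((hSa.abs.pow_const _).mul (hZa.pow_const 2)).aestronglyMeasurable (.of_forall fun ω => ?_)
    rw [Real.norm_eq_abs, abs_of_nonneg (by positivity), ← sq_abs (Z ω)]
    exact (rpow_sub_mul_le ha (abs_nonneg _) (abs_nonneg _)).1
  -- The linear term of the expansion drops out: |S|^{a-2} S is m-measurable and Z has conditional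
  -- mean zero.
  have z1 : ∫ ω, |S ω| ^ (a - 2) * S ω * Z ω ∂μ = 0 := by
    have hSm' : StronglyMeasurable[m] (fun ω => |S ω| ^ (a - 2) * S ω) :=
      ((continuous_abs.rpow_const fun _ => Or.inr (by linarith)).mul
        continuous_id).comp_stronglyMeasurable hSm
    have h1 : Integrable Z μ := hZ.integrable (by simp; linarith)
    have h2 := condExp_mul_of_stronglyMeasurable_left hSm' i1 h1
    rw [← integral_condExp hm]
    have h3 : μ[fun ω => |S ω| ^ (a - 2) * S ω * Z ω | m] =ᵐ[μ] 0 := by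
      refine EventuallyEq.trans h2 ?_
      filter_upwards [hZ0] with ω hω
      simp [hω]
    rw [integral_congr_ae h3]
    simp
  have h1 : ∫ ω, |(S + Z) ω| ^ a ∂μ ≤ lpNorm S (ENNReal.ofReal a) μ ^ a +
      C * (lpNorm S (ENNReal.ofReal a) μ ^ (a - 2) * lpNorm Z (ENNReal.ofReal a) μ ^ 2 +
        lpNorm Z (ENNReal.ofReal a) μ ^ a) := by
    calc ∫ ω, |(S + Z) ω| ^ a ∂μ
        ≤ ∫ ω, (|S ω| ^ a + a * (|S ω| ^ (a - 2) * S ω * Z ω) +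
            C * (|S ω| ^ (a - 2) * Z ω ^ 2 + |Z ω| ^ a)) ∂μ :=
          integral_mono (integrable_abs_rpow ha0 (hS.add hZ))
            ((hSi.add (i1.const_mul a)).add ((i2.add hZi).const_mul C)) fun ω => hC' _ _
      _ = (∫ ω, |S ω| ^ a ∂μ) + a * (∫ ω, |S ω| ^ (a - 2) * S ω * Z ω ∂μ) +
            C * ((∫ ω, |S ω| ^ (a - 2) * Z ω ^ 2 ∂μ) + ∫ ω, |Z ω| ^ a ∂μ) := by
          rw [integral_add, integral_add, integral_const_mul, integral_const_mul, integral_add]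
          exacts [i2, hZi, hSi, i1.const_mul a, hSi.add (i1.const_mul a), (i2.add hZi).const_mul C]
      _ ≤ _ := by
          rw [z1, mul_zero, add_zero, ← lpNorm_rpow_eq_integral ha0 hS,
            ← lpNorm_rpow_eq_integral ha0 hZ]
          gcongr
          exact integral_rpow_mul_sq_le ha hS hZ
  rw [← lpNorm_rpow_eq_integral ha0 (hS.add hZ)] at h1
  have h2 := h1.trans (hK' _ _ lpNorm_nonneg lpNorm_nonneg)
  have e : (lpNorm (S + Z) (ENNReal.ofReal a) μ ^ 2) ^ (a / 2) =
      lpNorm (S + Z) (ENNReal.ofReal a) μ ^ a := by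
    rw [← Real.rpow_natCast, ← Real.rpow_mul lpNorm_nonneg]; congr 1; push_cast; ring
  rw [← e] at h2
  exact (Real.rpow_le_rpow_iff (by positivity) (by positivity) (by linarith)).1 h2

end Smoothness

end RoughIto

namespace RoughIto

/-! ### Martingale-type increments and discrete sewing -/

section Discrete

variable {Ω : Type*} {m₁ m₂ m0 : MeasurableSpace Ω} {μ : Measure Ω}

/-- `Z` behaves like a martingale increment of size `D` after the σ-algebra `m`: adding it to an
`m`-measurable variable increases the square of the `L^a`-norm by at most `D ^ 2`. -/
structure MartSize (μ : Measure Ω) (m : MeasurableSpace Ω) (a : ℝ) (Z : Ω → ℝ) (D : ℝ) :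
    Prop where
  memLp : MemLp Z (ENNReal.ofReal a) μ
  nonneg : 0 ≤ D
  le : ∀ S : Ω → ℝ, StronglyMeasurable[m] S → MemLp S (ENNReal.ofReal a) μ →
    lpNorm (S + Z) (ENNReal.ofReal a) μ ^ 2 ≤ lpNorm S (ENNReal.ofReal a) μ ^ 2 + D ^ 2

theorem LpBound.lpNorm_le {G : Type*} [NormedAddCommGroup G] {a c : ℝ} {Z : Ω → G}
    (h : LpBound μ a Z c) : lpNorm Z (ENNReal.ofReal a) μ ≤ c :=
  (ENNReal.ofReal_le_ofReal_iff h.nonneg).1 ((ofReal_lpNorm h.memLp).trans_le h.le)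

namespace MartSize

variable {a D D₁ D₂ : ℝ} {Z Z₁ Z₂ : Ω → ℝ}

theorem mono (h : MartSize μ m₁ a Z D₁) (hD : D₁ ≤ D₂) : MartSize μ m₁ a Z D₂ :=
  ⟨h.memLp, h.nonneg.trans hD, fun S hS hS' => (h.le S hS hS').trans (by
    have := h.nonneg
    gcongr)⟩

theorem zero : MartSize μ m₁ a 0 0 := ⟨MemLp.zero, le_rfl, fun S _ _ => by simp⟩

theorem lpBound (h : MartSize μ m₁ a Z D) : LpBound μ a Z D := by
  refine ⟨h.memLp.1, h.nonneg, ?_⟩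
  rw [← ofReal_lpNorm h.memLp]
  refine ENNReal.ofReal_le_ofReal (abs_le_of_sq_le_sq' ?_ h.nonneg).2
  simpa using h.le 0 stronglyMeasurable_zero MemLp.zero

/-- Split S = tS + (1 - t)S with t = D₁/(D₁ + D₂). By homogeneity the two pieces have norms at most
t and 1 - t times √(‖S‖² + (D₁ + D₂)²), and the triangle inequality recombines them. No
orthogonality of Z₁ and Z₂ is needed. -/
theorem add (ha : 1 ≤ a) (h₁ : MartSize μ m₁ a Z₁ D₁) (h₂ : MartSize μ m₁ a Z₂ D₂) :
    MartSize μ m₁ a (Z₁ + Z₂) (D₁ + D₂) := by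
  refine ⟨h₁.memLp.add h₂.memLp, add_nonneg h₁.nonneg h₂.nonneg, fun S hS hS' => ?_⟩
  obtain ⟨t, ht0, ht1, e1, e2⟩ : ∃ t : ℝ, 0 ≤ t ∧ 0 ≤ 1 - t ∧ D₁ = t * (D₁ + D₂) ∧
      D₂ = (1 - t) * (D₁ + D₂) := by
    have n1 := h₁.nonneg
    have n2 := h₂.nonneg
    rcases (add_nonneg n1 n2).eq_or_lt with h0 | h0
    · exact ⟨0, le_rfl, by norm_num, by linarith, by linarith⟩
    · refine ⟨D₁ / (D₁ + D₂), by positivity, ?_, by field_simp, by field_simp; ring⟩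
      rw [sub_nonneg, div_le_one h0]; linarith
  set s := lpNorm S (ENNReal.ofReal a) μ
  set D := D₁ + D₂
  have key : ∀ (τ D' : ℝ) (Z : Ω → ℝ), 0 ≤ τ → D' = τ * D → MartSize μ m₁ a Z D' →
      lpNorm (τ • S + Z) (ENNReal.ofReal a) μ ≤ τ * √(s ^ 2 + D ^ 2) := by
    intro τ D' Z hτ hD hZ
    have h := hZ.le (τ • S) (hS.const_smul τ) (hS'.const_smul τ)
    rw [lpNorm_const_smul, hD, coe_nnnorm, Real.norm_of_nonneg hτ] at h
    refine (abs_le_of_sq_le_sq' ?_ (by positivity)).2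
    rw [mul_pow, Real.sq_sqrt (by positivity)]
    linarith
  have h3 := (lpNorm_add_le (p := ENNReal.ofReal a) ((hS'.const_smul t).add h₁.memLp)
    (g := (1 - t) • S + Z₂) (by simpa using ha)).trans
      (add_le_add (key t D₁ Z₁ ht0 e1 h₁) (key (1 - t) D₂ Z₂ ht1 e2 h₂))
  have h4 : t • S + Z₁ + ((1 - t) • S + Z₂) = S + (Z₁ + Z₂) := by
    ext ω
    simp only [Pi.add_apply, Pi.smul_apply, smul_eq_mul]
    ring
  rw [h4, ← add_mul, add_sub_cancel, one_mul] at h3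
  have h5 := pow_le_pow_left₀ lpNorm_nonneg h3 2
  rwa [Real.sq_sqrt (by positivity)] at h5

/-- Pythagoras for successive increments: S + Z₁ is already known when Z₂ is added. Being able to
iterate this without accumulating constants is the reason for defining `MartSize` by testing against
all S. -/
theorem add_orthogonal (hm : m₁ ≤ m₂) (h₁ : MartSize μ m₁ a Z₁ D₁)
    (hZ₁ : StronglyMeasurable[m₂] Z₁) (h₂ : MartSize μ m₂ a Z₂ D₂) :
    MartSize μ m₁ a (Z₁ + Z₂) √(D₁ ^ 2 + D₂ ^ 2) := by
  refine ⟨h₁.memLp.add h₂.memLp, by positivity, fun S hS hS' => ?_⟩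
  have h3 := h₁.le S hS hS'
  have h4 := h₂.le (S + Z₁) ((hS.mono hm).add hZ₁) (hS'.add h₁.memLp)
  rw [Real.sq_sqrt (by positivity), ← add_assoc]
  linarith

end MartSize

theorem exists_martSize_const (μ : Measure Ω) [IsProbabilityMeasure μ] {a : ℝ} (ha : 2 ≤ a) :
    ∃ K : ℝ, 0 ≤ K ∧ ∀ {m : MeasurableSpace Ω} {Z : Ω → ℝ} {d : ℝ}, m ≤ m0 →
      LpBound μ a Z d → μ[Z | m] =ᵐ[μ] 0 → MartSize μ m a Z (K * d) := by
  obtain ⟨K, hK, h⟩ := lpNorm_add_sq_le ha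
  refine ⟨√K, by positivity, fun {m Z d} hm hZ h0 => ⟨hZ.memLp, mul_nonneg (by positivity)
    hZ.nonneg, fun S hS hS' => (h hm hS hS' hZ.memLp h0).trans ?_⟩⟩
  have := hZ.lpNorm_le
  have h1 : (0 : ℝ) ≤ lpNorm Z (ENNReal.ofReal a) μ := lpNorm_nonneg
  rw [mul_pow, Real.sq_sqrt hK]
  gcongr

theorem condExp_sub_condExp_ae_eq_zero {G : Type*} [NormedAddCommGroup G] [NormedSpace ℝ G]
    [CompleteSpace G] [IsProbabilityMeasure μ] {Z : Ω → G} (hm : m₁ ≤ m0) (hZ : Integrable Z μ) :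
    μ[Z - μ[Z | m₁] | m₁] =ᵐ[μ] 0 := by
  refine (condExp_sub hZ integrable_condExp _).trans ?_
  rw [condExp_of_stronglyMeasurable hm stronglyMeasurable_condExp integrable_condExp, sub_self]

/-- Take k to be the last index before γ has risen past half of its increment. The cell from k to k
+ 1 is left out of both halves, since it may carry most of the increment. -/
theorem exists_split {γ : ℕ → ℝ} (hγ : Monotone γ) {i j : ℕ} (hij : i < j) :
    ∃ k, i ≤ k ∧ k < j ∧ γ k - γ i ≤ (γ j - γ i) / 2 ∧ γ j - γ (k + 1) ≤ (γ j - γ i) / 2 := by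
  by_contra! h
  have hstep : ∀ k, i ≤ k → k < j → γ k - γ i ≤ (γ j - γ i) / 2 := by
    intro k hik
    induction k, hik using Nat.le_induction with
    | base => intro _; have := hγ hij.le; linarith
    | succ k hik ih =>
      intro hk
      have := h k hik (by omega) (ih (by omega))
      linarith
  have h1 := hstep (j - 1) (by omega) (by omega)
  have h2 := h (j - 1) (by omega) (by omega) h1
  rw [Nat.sub_add_cancel (by omega)] at h2
  have := hγ hij.le
  linarith

/-- Induction on j - i, splitting so that γ at least halves on both sides. The error is kept as a
martingale part M plus a drift D: halving multiplies the sum of the two squared martingale bounds by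
at most 2·2^{-2α} < 1 and the sum of the drift bounds by at most 2·2^{-β} < 1. Both recursions are
therefore contractive, with constants independent of the number of points. -/
theorem discrete_sewing_real (μ : Measure Ω) [IsProbabilityMeasure μ] {a α β C : ℝ} (ha : 2 ≤ a)
    (hα : 1 / 2 < α) (hβ : 1 < β) (hC : 0 ≤ C) : ∃ C' : ℝ, 0 ≤ C' ∧
    ∀ (𝒢 : ℕ → MeasurableSpace Ω) (Ξ : ℕ → ℕ → Ω → ℝ) (γ : ℕ → ℝ), Monotone 𝒢 → (∀ i, 𝒢 i ≤ m0) →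
      Monotone γ → (∀ i j, i ≤ j → StronglyMeasurable[𝒢 j] (Ξ i j)) →
      (∀ i j k, i ≤ j → j ≤ k →
        LpBound μ a (Ξ i k - Ξ i j - Ξ j k) (C * (γ k - γ i) ^ α)) →
      (∀ i j k, i ≤ j → j ≤ k →
        LpBound μ a (μ[Ξ i k - Ξ i j - Ξ j k | 𝒢 i]) (C * (γ k - γ i) ^ β)) →
      ∀ i j, i ≤ j → ∃ M D : Ω → ℝ, ∑ k ∈ Finset.Ico i j, Ξ k (k + 1) - Ξ i j =ᵐ[μ] M + D ∧
        StronglyMeasurable[𝒢 j] M ∧ μ[M | 𝒢 i] =ᵐ[μ] 0 ∧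
        MartSize μ (𝒢 i) a M (C' * (γ j - γ i) ^ α) ∧
        LpBound μ a D (C' * (γ j - γ i) ^ β) := by
  obtain ⟨K, hK, hK'⟩ := exists_martSize_const μ ha
  have ha1 : 1 ≤ a := by linarith
  -- L is a contraction factor common to both recursions, namely the larger of 2^{1/2-α} and
  -- 2^{1-β}.
  obtain ⟨L, hL0, hL1, hu, hv⟩ : ∃ L : ℝ, 0 < L ∧ L < 1 ∧ ((2 : ℝ) ^ (-α)) ^ 2 * 2 ≤ L ^ 2 ∧
      (2 : ℝ) ^ (-β) * 2 ≤ L := by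
    refine ⟨max (2 ^ (1 / 2 - α)) (2 ^ (1 - β)), by positivity, max_lt
      (Real.rpow_lt_one_of_one_lt_of_neg (by norm_num) (by linarith))
      (Real.rpow_lt_one_of_one_lt_of_neg (by norm_num) (by linarith)), ?_, ?_⟩
    · refine le_trans (le_of_eq ?_) (pow_le_pow_left₀ (by positivity) (le_max_left _ _) 2)
      rw [← Real.rpow_natCast, ← Real.rpow_natCast, ← Real.rpow_mul (by norm_num),
        ← Real.rpow_mul (by norm_num), ← Real.rpow_add_one (by norm_num)]
      congr 1; push_cast; ring
    · refine le_trans (le_of_eq ?_) (le_max_right _ _)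
      rw [← Real.rpow_add_one (by norm_num)]
      congr 1; ring
  -- The fixed point of C' = C'L + 4CK + 2C. A centred defect costs 4CK in the martingale part, and
  -- the conditional mean of the defects costs 2C in the drift.
  set C' : ℝ := (4 * C * K + 2 * C) / (1 - L) with hC'
  have hC'0 : 0 ≤ C' := div_nonneg (by positivity) (by linarith)
  have hC'1 : C' * L + 4 * C * K + 2 * C = C' := by
    have : 1 - L ≠ 0 := by linarith
    rw [hC']; field_simp; ring
  refine ⟨C', hC'0, fun 𝒢 Ξ γ h𝒢 h𝒢0 hγ hmeas hδ hδE => ?_⟩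
  suffices H : ∀ n i j, i ≤ j → j - i = n →
      ∃ M D : Ω → ℝ, ∑ k ∈ Finset.Ico i j, Ξ k (k + 1) - Ξ i j =ᵐ[μ] M + D ∧
        StronglyMeasurable[𝒢 j] M ∧ μ[M | 𝒢 i] =ᵐ[μ] 0 ∧
        MartSize μ (𝒢 i) a M (C' * (γ j - γ i) ^ α) ∧
        LpBound μ a D (C' * (γ j - γ i) ^ β) from fun i j hij => H _ i j hij rfl
  intro n
  induction n using Nat.strong_induction_on with
  | _ n ih =>
  intro i j hij hn
  rcases hij.eq_or_lt with rfl | hij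
  · have h0 : Ξ i i =ᵐ[μ] 0 := by
      have h := hδ i i i le_rfl le_rfl
      rw [sub_self (γ i), Real.zero_rpow (by linarith), mul_zero] at h
      have := h.ae_eq_zero ha1
      filter_upwards [this] with ω hω
      simpa using hω
    refine ⟨0, 0, ?_, stronglyMeasurable_zero, by rw [condExp_zero],
      MartSize.zero.mono ?_, LpBound.zero ?_⟩
    · filter_upwards [h0] with ω hω
      simp [hω]
    · rw [sub_self, Real.zero_rpow (by linarith), mul_zero]
    · rw [sub_self, Real.zero_rpow (by linarith), mul_zero]
  obtain ⟨k, hik, hkj, hw1, hw2⟩ := exists_split hγ hij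
  obtain ⟨M₁, D₁, e₁, mM₁, cM₁, sM₁, bD₁⟩ := ih (k - i) (by omega) i k hik rfl
  obtain ⟨M₂, D₂, e₂, mM₂, cM₂, sM₂, bD₂⟩ := ih (j - (k + 1)) (by omega) (k + 1) j (by omega) rfl
  set w := γ j - γ i with hw
  have hw0 : 0 ≤ w := sub_nonneg.2 (hγ hij.le)
  have hkw : γ j - γ k ≤ w := sub_le_sub_left (hγ hik) _
  have hkw0 : 0 ≤ γ j - γ k := sub_nonneg.2 (hγ hkj.le)
  -- Two defects replace Ξ i j by Ξ i k + Ξ k (k+1) + Ξ (k+1) j. Only the outer two pieces need the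
  -- induction hypothesis.
  set δ₁ := Ξ i j - Ξ i k - Ξ k j with hδ₁
  set δ₂ := Ξ k j - Ξ k (k + 1) - Ξ (k + 1) j with hδ₂
  have b₁ : LpBound μ a δ₁ (C * w ^ α) := hδ i k j hik hkj.le
  have b₂ : LpBound μ a δ₂ (C * w ^ α) :=
    (hδ k (k + 1) j (by omega) hkj).mono (by gcongr)
  have c₁ : LpBound μ a (μ[δ₁ | 𝒢 i]) (C * w ^ β) := hδE i k j hik hkj.le
  have c₂ : LpBound μ a (μ[δ₂ | 𝒢 i]) (C * w ^ β) :=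
    (((hδE k (k + 1) j (by omega) hkj).condExp ha1 (𝒢 i)).congr
      (condExp_condExp_of_le (h𝒢 hik) (h𝒢0 k))).mono (by gcongr)
  have cd := c₁.add ha1 c₂
  replace cd := cd.congr (condExp_add (b₁.integrable ha1) (b₂.integrable ha1) (𝒢 i)).symm
  set δ := δ₁ + δ₂ with hδdef
  have bd : LpBound μ a δ (2 * C * w ^ α) := (b₁.add ha1 b₂).mono (by linarith)
  have mδ : StronglyMeasurable[𝒢 j] δ :=
    (((hmeas i j hij.le).sub ((hmeas i k hik).mono (h𝒢 hkj.le))).sub (hmeas k j hkj.le)).add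
      (((hmeas k j hkj.le).sub ((hmeas k (k + 1) (by omega)).mono (h𝒢 hkj))).sub
        (hmeas (k + 1) j hkj))
  have i1 : Integrable M₁ μ := sM₁.lpBound.integrable ha1
  have i2 : Integrable M₂ μ := sM₂.lpBound.integrable ha1
  have i3 : Integrable δ μ := bd.integrable ha1
  have cM₂' : μ[M₂ | 𝒢 i] =ᵐ[μ] 0 := by
    have h1 := condExp_condExp_of_le (μ := μ) (f := M₂) (h𝒢 (by omega : i ≤ k + 1)) (h𝒢0 (k + 1))
    refine h1.symm.trans ?_
    rw [← condExp_zero (m := 𝒢 i)]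
    exact condExp_congr_ae cM₂
  have c0 := condExp_sub_condExp_ae_eq_zero (h𝒢0 i) i3
  have c0' : μ[-(δ - μ[δ | 𝒢 i]) | 𝒢 i] =ᵐ[μ] 0 := by
    refine (condExp_neg _ _).trans ?_
    filter_upwards [c0] with ω hω
    simp [hω]
  have wp : ∀ x y : ℝ, 0 ≤ x → x ≤ w / 2 → 0 ≤ y → x ^ y ≤ 2 ^ (-y) * w ^ y := by
    intro x y hx hxw hy
    calc x ^ y ≤ (2⁻¹ * w) ^ y := Real.rpow_le_rpow hx (by linarith) hy
      _ = 2 ^ (-y) * w ^ y := by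
        rw [Real.mul_rpow (by norm_num) hw0, Real.rpow_neg (by norm_num),
          Real.inv_rpow (by norm_num)]
  have hx1 : 0 ≤ γ k - γ i := sub_nonneg.2 (hγ hik)
  have hx2 : 0 ≤ γ j - γ (k + 1) := sub_nonneg.2 (hγ hkj)
  refine ⟨M₁ + M₂ + -(δ - μ[δ | 𝒢 i]), D₁ + D₂ - μ[δ | 𝒢 i], ?_, ?_, ?_, ?_, ?_⟩
  · have hsum : ∑ l ∈ Finset.Ico i j, Ξ l (l + 1) = ∑ l ∈ Finset.Ico i k, Ξ l (l + 1) +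
        (Ξ k (k + 1) + ∑ l ∈ Finset.Ico (k + 1) j, Ξ l (l + 1)) := by
      rw [← Finset.sum_eq_sum_Ico_succ_bot hkj (fun l => Ξ l (l + 1)),
        Finset.sum_Ico_consecutive _ hik hkj.le]
    filter_upwards [e₁, e₂] with ω h1 h2
    rw [hsum]
    simp only [Pi.sub_apply, Pi.add_apply, Pi.neg_apply, hδdef, hδ₁, hδ₂] at h1 h2 ⊢
    linarith
  · exact ((mM₁.mono (h𝒢 hkj.le)).add mM₂).add
      (mδ.sub (stronglyMeasurable_condExp.mono (h𝒢 hij.le))).neg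
  · refine (condExp_add (i1.add i2) (i3.sub integrable_condExp).neg _).trans ?_
    filter_upwards [condExp_add i1 i2 (𝒢 i), cM₁, cM₂', c0'] with ω h1 h2 h3 h4
    simp only [Pi.add_apply, Pi.zero_apply] at h1 h2 h3 h4 ⊢
    rw [h1, h2, h3, h4]
    simp
  -- M₁ is known at time k + 1, where M₂ starts, so their sizes add in squares. The centred defect
  -- is added with the triangle inequality.
  · have s12 := sM₁.add_orthogonal (h𝒢 (by omega : i ≤ k + 1)) (mM₁.mono (h𝒢 (by omega))) sM₂
    have s3 := hK' (h𝒢0 i) (bd.sub ha1 (bd.condExp ha1 (𝒢 i))).neg c0'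
    refine (s12.add ha1 s3).mono ?_
    have hh : √((C' * (γ k - γ i) ^ α) ^ 2 +
        (C' * (γ j - γ (k + 1)) ^ α) ^ 2) ≤ C' * L * w ^ α := by
      refine Real.sqrt_le_iff.2 ⟨by positivity, ?_⟩
      have h1 := wp _ α hx1 hw1 (by positivity)
      have h2 := wp _ α hx2 hw2 (by positivity)
      calc (C' * (γ k - γ i) ^ α) ^ 2 + (C' * (γ j - γ (k + 1)) ^ α) ^ 2
          ≤ (C' * (2 ^ (-α) * w ^ α)) ^ 2 +
            (C' * (2 ^ (-α) * w ^ α)) ^ 2 := by gcongr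
        _ = C' ^ 2 * (((2 : ℝ) ^ (-α)) ^ 2 * 2) * (w ^ α) ^ 2 := by ring
        _ ≤ C' ^ 2 * L ^ 2 * (w ^ α) ^ 2 := by gcongr
        _ = _ := by ring
    have hw' : 0 ≤ w ^ α := by positivity
    have := mul_nonneg hC hw'
    nlinarith
  · refine ((bD₁.add ha1 bD₂).sub ha1 cd).mono ?_
    have h1 := wp _ β hx1 hw1 (by positivity)
    have h2 := wp _ β hx2 hw2 (by positivity)
    have h3 : C' * (γ k - γ i) ^ β + C' * (γ j - γ (k + 1)) ^ β ≤
        C' * L * w ^ β := by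
      calc C' * (γ k - γ i) ^ β + C' * (γ j - γ (k + 1)) ^ β
          ≤ C' * (2 ^ (-β) * w ^ β) + C' * (2 ^ (-β) * w ^ β) := by gcongr
        _ = C' * ((2 : ℝ) ^ (-β) * 2) * w ^ β := by ring
        _ ≤ C' * L * w ^ β := by
          gcongr
    have hw' : 0 ≤ w ^ β := by positivity
    have h4 := mul_nonneg hC hw'
    have h5 : 0 ≤ C * K * w ^ β := by positivity
    nlinarith

end Discrete

end RoughIto

namespace RoughIto

/-! ### Vector-valued versions -/

section Vector

variable {Ω : Type*} {m0 : MeasurableSpace Ω} {μ : Measure Ω}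
variable {G : Type*} [NormedAddCommGroup G] [NormedSpace ℝ G]

theorem exists_coordinates (G : Type*) [NormedAddCommGroup G] [NormedSpace ℝ G]
    [FiniteDimensional ℝ G] : ∃ (n : ℕ) (ℓ : Fin n → G →L[ℝ] ℝ) (C : ℝ), 0 ≤ C ∧
      (∀ k, ‖ℓ k‖ ≤ 1) ∧ ∀ z, ‖z‖ ≤ ∑ k, C * |ℓ k z| := by
  let b := Module.finBasis ℝ G
  let c : Fin (Module.finrank ℝ G) → G →L[ℝ] ℝ := fun k => LinearMap.toContinuousLinearMap (b.coord k)
  let C : ℝ := ∑ k, ‖b k‖ * (1 + ‖c k‖)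
  have hpos : ∀ k, 0 < 1 + ‖c k‖ := fun k => by positivity
  refine ⟨_, fun k => (1 + ‖c k‖)⁻¹ • c k, C, Finset.sum_nonneg fun k _ => by positivity,
    fun k => ?_, fun z => ?_⟩
  · rw [norm_smul, norm_inv, Real.norm_of_nonneg (hpos k).le, inv_mul_le_iff₀ (hpos k)]
    linarith
  · calc ‖z‖ = ‖∑ k, c k z • b k‖ := by
          congr 1
          exact (b.sum_repr z).symm
      _ ≤ ∑ k, ‖c k z • b k‖ := norm_sum_le _ _
      _ ≤ ∑ k, C * |((1 + ‖c k‖)⁻¹ • c k) z| := by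
          refine Finset.sum_le_sum fun k _ => ?_
          have h1 : ‖b k‖ * (1 + ‖c k‖) ≤ C :=
            Finset.single_le_sum (f := fun k => ‖b k‖ * (1 + ‖c k‖))
              (fun k _ => by positivity) (Finset.mem_univ k)
          rw [norm_smul, Real.norm_eq_abs, smul_apply, smul_eq_mul, abs_mul,
            abs_of_pos (inv_pos.2 (hpos k))]
          calc |c k z| * ‖b k‖ = (‖b k‖ * (1 + ‖c k‖)) * ((1 + ‖c k‖)⁻¹ * |c k z|) := by
                have := (hpos k).ne'
                field_simp
            _ ≤ _ := by gcongr

theorem LpBound.clm_comp {G' : Type*} [NormedAddCommGroup G'] [NormedSpace ℝ G'] {a c K : ℝ}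
    {Z : Ω → G} (h : LpBound μ a Z c) (ℓ : G →L[ℝ] G') (hℓ : ‖ℓ‖ ≤ K) :
    LpBound μ a (fun ω => ℓ (Z ω)) (K * c) :=
  h.of_norm_le_mul (ℓ.continuous.comp_aestronglyMeasurable h.meas) ((norm_nonneg _).trans hℓ)
    (.of_forall fun ω => (ℓ.le_opNorm _).trans (by gcongr))

theorem LpBound.clm_comp_le_one {G' : Type*} [NormedAddCommGroup G'] [NormedSpace ℝ G'] {a c : ℝ}
    {Z : Ω → G} (h : LpBound μ a Z c) (ℓ : G →L[ℝ] G') (hℓ : ‖ℓ‖ ≤ 1) :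
    LpBound μ a (fun ω => ℓ (Z ω)) c := by
  simpa using h.clm_comp ℓ hℓ

theorem condExp_clm_comp [CompleteSpace G] {G' : Type*} [NormedAddCommGroup G'] [NormedSpace ℝ G']
    [CompleteSpace G'] {Z : Ω → G} (hZ : Integrable Z μ) (ℓ : G →L[ℝ] G') (m : MeasurableSpace Ω) :
    μ[fun ω => ℓ (Z ω) | m] =ᵐ[μ] fun ω => ℓ (μ[Z | m] ω) :=
  (ContinuousLinearMap.comp_condExp_comm hZ ℓ).symm

theorem LpBound.condExp_clm_comp_le_one [CompleteSpace G] {a c : ℝ} {Z : Ω → G}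
    {m : MeasurableSpace Ω} (h : LpBound μ a (μ[Z | m]) c) (hZ : Integrable Z μ) (ℓ : G →L[ℝ] ℝ)
    (hℓ : ‖ℓ‖ ≤ 1) : LpBound μ a (μ[fun ω => ℓ (Z ω) | m]) c :=
  (h.clm_comp_le_one ℓ hℓ).congr (condExp_clm_comp hZ ℓ m).symm

/-- `L^a`-bounds may be checked on coordinates. -/
theorem exists_lpBound_of_coordinates (μ : Measure Ω) (G : Type*) [NormedAddCommGroup G]
    [NormedSpace ℝ G] [FiniteDimensional ℝ G] {a : ℝ} (ha : 1 ≤ a) : ∃ C : ℝ, 0 ≤ C ∧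
      ∀ {Z : Ω → G} {c : ℝ}, AEStronglyMeasurable Z μ → 0 ≤ c →
        (∀ ℓ : G →L[ℝ] ℝ, ‖ℓ‖ ≤ 1 → LpBound μ a (fun ω => ℓ (Z ω)) c) → LpBound μ a Z (C * c) := by
  obtain ⟨n, ℓ, C, hC, hℓ, h⟩ := exists_coordinates G
  refine ⟨n * C, by positivity, fun {Z c} hZ hc H => ?_⟩
  have h1 : LpBound μ a (∑ k, fun ω => C * |ℓ k (Z ω)|) (∑ _k : Fin n, C * c) :=
    LpBound.sum ha _ fun k _ => (H (ℓ k) (hℓ k)).of_norm_le_mul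
      ((((ℓ k).continuous.comp_aestronglyMeasurable hZ).norm).const_mul C) hC
      (.of_forall fun ω => by simp [abs_of_nonneg hC])
  refine (h1.of_norm_le hZ (.of_forall fun ω => ?_)).mono (by simp; linarith)
  refine (h (Z ω)).trans ((le_abs_self _).trans_eq ?_)
  simp [Finset.sum_apply]

/-- A sum of increments is bounded by the sum of their conditional means plus the square function
of their sizes. -/
theorem exists_lpBound_sum (μ : Measure Ω) [IsProbabilityMeasure μ] (G : Type*)
    [NormedAddCommGroup G] [NormedSpace ℝ G] [FiniteDimensional ℝ G] {a : ℝ} (ha : 2 ≤ a) :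
    ∃ C : ℝ, 0 ≤ C ∧ ∀ (𝒢 : ℕ → MeasurableSpace Ω) (Z : ℕ → Ω → G) (d e : ℕ → ℝ) (n : ℕ),
      Monotone 𝒢 → (∀ i, 𝒢 i ≤ m0) → (∀ i, StronglyMeasurable[𝒢 (i + 1)] (Z i)) →
      (∀ i < n, LpBound μ a (Z i) (d i)) → (∀ i < n, LpBound μ a (μ[Z i | 𝒢 i]) (e i)) →
      LpBound μ a (∑ i ∈ Finset.range n, Z i)
        (C * (√(∑ i ∈ Finset.range n, d i ^ 2) + ∑ i ∈ Finset.range n, e i)) := by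
  obtain ⟨C, hC, hC'⟩ := exists_lpBound_of_coordinates μ G (by linarith : 1 ≤ a)
  obtain ⟨K, hK, hK'⟩ := exists_martSize_const μ ha
  have ha1 : 1 ≤ a := by linarith
  have : CompleteSpace G := FiniteDimensional.complete ℝ G
  refine ⟨C * (2 * K + 1), by positivity, fun 𝒢 Z d e n h𝒢 h𝒢0 hZ hd he => ?_⟩
  have hs0 : 0 ≤ ∑ i ∈ Finset.range n, e i :=
    Finset.sum_nonneg fun i hi => (he i (Finset.mem_range.1 hi)).nonneg
  have hm : AEStronglyMeasurable (∑ i ∈ Finset.range n, Z i) μ :=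
    Finset.aestronglyMeasurable_sum _ fun i hi => (hd i (Finset.mem_range.1 hi)).meas
  refine (hC' (c := 2 * K * √(∑ i ∈ Finset.range n, d i ^ 2) + ∑ i ∈ Finset.range n, e i)
    hm (by positivity) fun ℓ hℓ => ?_).mono ?_
  swap
  · have h1 : 0 ≤ C * √(∑ i ∈ Finset.range n, d i ^ 2) := by positivity
    have h2 : 0 ≤ C * K * ∑ i ∈ Finset.range n, e i := by positivity
    nlinarith
  -- The centred increments are martingale differences. Centring doubles their size, whence the
  -- factor 2.
  have key : ∀ k ≤ n, MartSize μ (𝒢 0) a (∑ i ∈ Finset.range k,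
      ((fun ω => ℓ (Z i ω)) - μ[fun ω => ℓ (Z i ω) | 𝒢 i]))
      (2 * K * √(∑ i ∈ Finset.range k, d i ^ 2)) := by
    intro k
    induction k with
    | zero => intro _; simpa using MartSize.zero
    | succ k ih =>
      intro hk
      have b := (hd k hk).clm_comp_le_one ℓ hℓ
      have s2 := hK' (h𝒢0 k) (b.sub ha1 (b.condExp ha1 (𝒢 k)))
        (condExp_sub_condExp_ae_eq_zero (h𝒢0 k) (b.integrable ha1))
      rw [Finset.sum_range_succ, Finset.sum_range_succ]
      refine ((ih (by omega)).add_orthogonal (h𝒢 (zero_le)) ?_ s2).mono ?_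
      · refine Finset.stronglyMeasurable_sum _ fun i hi => ?_
        have hi' := Finset.mem_range.1 hi
        exact (ℓ.continuous.comp_stronglyMeasurable ((hZ i).mono (h𝒢 hi'))).sub
          (stronglyMeasurable_condExp.mono (h𝒢 hi'.le))
      · refine Real.sqrt_le_iff.2 ⟨by positivity, le_of_eq ?_⟩
        have h0 : 0 ≤ ∑ i ∈ Finset.range k, d i ^ 2 := Finset.sum_nonneg fun i _ => sq_nonneg _
        have e1 := Real.sq_sqrt h0
        have e2 := Real.sq_sqrt (add_nonneg h0 (sq_nonneg (d k)))
        linear_combination 4 * K ^ 2 * e1 - 4 * K ^ 2 * e2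
  have h2 : LpBound μ a (∑ i ∈ Finset.range n, μ[fun ω => ℓ (Z i ω) | 𝒢 i])
      (∑ i ∈ Finset.range n, e i) := by
    refine LpBound.sum ha1 _ fun i hi => ?_
    have hi := Finset.mem_range.1 hi
    exact (he i hi).condExp_clm_comp_le_one ((hd i hi).integrable ha1) ℓ hℓ
  refine ((key n le_rfl).lpBound.add ha1 h2).congr (.of_forall fun ω => ?_)
  simp [Finset.sum_apply]

/-- Discrete stochastic sewing. -/
theorem discrete_sewing (μ : Measure Ω) [IsProbabilityMeasure μ] (G : Type*)
    [NormedAddCommGroup G] [NormedSpace ℝ G] [FiniteDimensional ℝ G]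
    {a α β C : ℝ} (ha : 2 ≤ a) (hα : 1 / 2 < α) (hβ : 1 < β) (hC : 0 ≤ C) : ∃ C' : ℝ, 0 ≤ C' ∧
    ∀ (𝒢 : ℕ → MeasurableSpace Ω) (Ξ : ℕ → ℕ → Ω → G) (γ : ℕ → ℝ), Monotone 𝒢 → (∀ i, 𝒢 i ≤ m0) →
      Monotone γ → (∀ i j, i ≤ j → StronglyMeasurable[𝒢 j] (Ξ i j)) →
      (∀ i j k, i ≤ j → j ≤ k →
        LpBound μ a (Ξ i k - Ξ i j - Ξ j k) (C * (γ k - γ i) ^ α)) →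
      (∀ i j k, i ≤ j → j ≤ k →
        LpBound μ a (μ[Ξ i k - Ξ i j - Ξ j k | 𝒢 i]) (C * (γ k - γ i) ^ β)) →
      (∀ i j, i ≤ j → Integrable (Ξ i j) μ) →
      ∀ i j, i ≤ j →
        LpBound μ a (∑ k ∈ Finset.Ico i j, Ξ k (k + 1) - Ξ i j)
          (C' * ((γ j - γ i) ^ α + (γ j - γ i) ^ β)) ∧
        LpBound μ a (μ[∑ k ∈ Finset.Ico i j, Ξ k (k + 1) - Ξ i j | 𝒢 i])
          (C' * (γ j - γ i) ^ β) := by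
  obtain ⟨C₁, hC₁, hC₁'⟩ := exists_lpBound_of_coordinates μ G (by linarith : 1 ≤ a)
  obtain ⟨C₂, hC₂, hC₂'⟩ := discrete_sewing_real μ ha hα hβ hC
  have ha1 : 1 ≤ a := by linarith
  have : CompleteSpace G := FiniteDimensional.complete ℝ G
  refine ⟨C₁ * C₂, by positivity, fun 𝒢 Ξ γ h𝒢 h𝒢0 hγ hmeas hδ hδE hint i j hij => ?_⟩
  have hw : 0 ≤ γ j - γ i := sub_nonneg.2 (hγ hij)
  have hi : Integrable (∑ k ∈ Finset.Ico i j, Ξ k (k + 1) - Ξ i j) μ :=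
    (integrable_finsetSum' _ fun k _ => hint k (k + 1) (by omega)).sub (hint i j hij)
  have key : ∀ ℓ : G →L[ℝ] ℝ, ‖ℓ‖ ≤ 1 →
      LpBound μ a (fun ω => ℓ ((∑ k ∈ Finset.Ico i j, Ξ k (k + 1) - Ξ i j) ω))
        (C₂ * ((γ j - γ i) ^ α + (γ j - γ i) ^ β)) ∧
      LpBound μ a (fun ω => ℓ (μ[∑ k ∈ Finset.Ico i j, Ξ k (k + 1) - Ξ i j | 𝒢 i] ω))
        (C₂ * (γ j - γ i) ^ β) := by
    intro ℓ hℓ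
    obtain ⟨M, D, hMD, hM, hM0, hMs, hD⟩ := hC₂' 𝒢 (fun i j ω => ℓ (Ξ i j ω)) γ h𝒢 h𝒢0 hγ
      (fun i j hij => ℓ.continuous.comp_stronglyMeasurable (hmeas i j hij))
      (fun i j k hij hjk => ((hδ i j k hij hjk).clm_comp_le_one ℓ hℓ).congr
        (.of_forall fun ω => by simp))
      (fun i j k hij hjk => by
        have h := (hδE i j k hij hjk).condExp_clm_comp_le_one ((hδ i j k hij hjk).integrable ha1)
          ℓ hℓ
        refine h.congr (condExp_congr_ae (.of_forall fun ω => ?_))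
        simp) i j hij
    have e : (fun ω => ℓ ((∑ k ∈ Finset.Ico i j, Ξ k (k + 1) - Ξ i j) ω)) =ᵐ[μ] M + D := by
      refine EventuallyEq.trans (.of_forall fun ω => ?_) hMD
      simp [Finset.sum_apply]
    refine ⟨((hMs.lpBound.add ha1 hD).congr e.symm).mono (by rw [mul_add]), ?_⟩
    -- The martingale part has zero conditional mean, so only the drift survives and the bound
    -- involves β alone.
    refine (hD.condExp ha1 (𝒢 i)).congr ?_
    refine EventuallyEq.trans ?_ (condExp_clm_comp hi ℓ (𝒢 i))
    refine EventuallyEq.trans ?_ (condExp_congr_ae e).symm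
    refine EventuallyEq.trans ?_
      (condExp_add (hMs.lpBound.integrable ha1) (hD.integrable ha1) (𝒢 i)).symm
    filter_upwards [hM0] with ω hω
    simp [hω]
  constructor
  · rw [mul_assoc]
    exact hC₁' hi.1 (by positivity) fun ℓ hℓ => (key ℓ hℓ).1
  · rw [mul_assoc]
    exact hC₁' integrable_condExp.1 (by positivity) fun ℓ hℓ => (key ℓ hℓ).2

end Vector

end RoughIto

namespace RoughIto

/-! ### Partitions -/

namespace TimePartition

variable {s t u : ℝ} (P : TimePartition s t)

theorem pt_mono {i j : ℕ} (hij : i ≤ j) (hj : j ≤ P.n) : P.pt i ≤ P.pt j := by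
  induction j, hij using Nat.le_induction with
  | base => rfl
  | succ k hik ih => exact (ih (by omega)).trans (P.lt_succ k (by omega)).le

theorem le (P : TimePartition s t) : s ≤ t := by
  have := P.pt_mono (zero_le : 0 ≤ P.n) le_rfl
  rwa [P.first, P.last] at this

theorem pt_mem {i : ℕ} (hi : i ≤ P.n) : P.pt i ∈ Icc s t := by
  constructor
  · exact P.first.symm.trans_le (P.pt_mono zero_le hi)
  · exact (P.pt_mono hi le_rfl).trans_eq P.last

/-- The points of the partition, continued constantly. -/
def seq (i : ℕ) : ℝ := P.pt (min i P.n)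

theorem seq_mono : Monotone P.seq := fun _ _ hij =>
  P.pt_mono (min_le_min_right _ hij) (min_le_right _ _)

theorem seq_mem (i : ℕ) : P.seq i ∈ Icc s t := P.pt_mem (min_le_right _ _)

theorem seq_eq {i : ℕ} (hi : i ≤ P.n) : P.seq i = P.pt i := by rw [seq, min_eq_left hi]

theorem sum_eq_seq {M : Type*} [AddCommMonoid M] (Ξ : ℝ → ℝ → M) :
    P.sum Ξ = ∑ i ∈ Finset.range P.n, Ξ (P.seq i) (P.seq (i + 1)) := by
  refine Finset.sum_congr rfl fun i hi => ?_
  have := Finset.mem_range.1 hi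
  rw [P.seq_eq (by omega), P.seq_eq (by omega)]

/-- The partition without interior points. -/
def single (h : s < t) : TimePartition s t where
  n := 1
  pt i := if i = 0 then s else t
  first := by simp
  last := by simp
  lt_succ i hi := by
    obtain rfl : i = 0 := by omega
    simpa using h

/-- The partition of a degenerate interval. -/
def trivial (s : ℝ) : TimePartition s s where
  n := 0
  pt _ := s
  first := rfl
  last := rfl
  lt_succ i hi := by omega

theorem sum_single {M : Type*} [AddCommMonoid M] (h : s < t) (Ξ : ℝ → ℝ → M) :
    (single h).sum Ξ = Ξ s t := by
  simp [sum, single]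

theorem sum_trivial {M : Type*} [AddCommMonoid M] (Ξ : ℝ → ℝ → M) :
    (trivial s).sum Ξ = 0 := by
  simp [sum, trivial]

/-- Concatenation of partitions. -/
def append (P : TimePartition s t) (Q : TimePartition t u) : TimePartition s u where
  n := P.n + Q.n
  pt i := if i ≤ P.n then P.pt i else Q.pt (i - P.n)
  first := by simp [P.first]
  last := by
    split_ifs with h
    · obtain h0 : Q.n = 0 := by omega
      rw [h0, add_zero, P.last, ← Q.last, h0, Q.first]
    · rw [Nat.add_sub_cancel_left, Q.last]
  lt_succ i hi := by
    rcases lt_trichotomy i P.n with h | h | h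
    · rw [if_pos h.le, if_pos (by omega)]
      exact P.lt_succ i h
    · subst h
      rw [if_pos le_rfl, if_neg (by omega), Nat.add_sub_cancel_left, P.last]
      exact Q.first.symm.trans_lt (Q.lt_succ 0 (by omega))
    · rw [if_neg (by omega), if_neg (by omega), show i + 1 - P.n = (i - P.n) + 1 by omega]
      exact Q.lt_succ _ (by omega)

theorem append_pt_left (P : TimePartition s t) (Q : TimePartition t u) {i : ℕ} (hi : i ≤ P.n) :
    (P.append Q).pt i = P.pt i := if_pos hi

theorem append_pt_right (P : TimePartition s t) (Q : TimePartition t u) (i : ℕ) :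
    (P.append Q).pt (P.n + i) = Q.pt i := by
  rcases Nat.eq_zero_or_pos i with rfl | hi
  · rw [add_zero, append_pt_left _ _ le_rfl, P.last, Q.first]
  · simp only [append]
    rw [if_neg (by omega), Nat.add_sub_cancel_left]

theorem sum_append {M : Type*} [AddCommMonoid M] (P : TimePartition s t) (Q : TimePartition t u)
    (Ξ : ℝ → ℝ → M) : (P.append Q).sum Ξ = P.sum Ξ + Q.sum Ξ := by
  have h : (P.append Q).n = P.n + Q.n := rfl
  rw [sum, h, Finset.sum_range_add]
  congr 1
  · refine Finset.sum_congr rfl fun i hi => ?_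
    have := Finset.mem_range.1 hi
    rw [append_pt_left _ _ (by omega), append_pt_left _ _ (by omega)]
  · refine Finset.sum_congr rfl fun i _ => ?_
    rw [append_pt_right, add_assoc, append_pt_right]

theorem exists_meshLT (h : s ≤ t) {δ : ℝ} (hδ : 0 < δ) : ∃ P : TimePartition s t, P.MeshLT δ := by
  rcases h.eq_or_lt with rfl | h
  · exact ⟨trivial s, fun i hi => by simp [trivial] at hi⟩
  obtain ⟨n, hn⟩ := exists_nat_gt ((t - s) / δ)
  have hn0 : (0 : ℝ) < n := (div_pos (sub_pos.2 h) hδ).trans hn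
  have hst : 0 < (t - s) / n := div_pos (sub_pos.2 h) hn0
  refine ⟨⟨n, fun i => s + i * ((t - s) / n), by simp, by field_simp; ring, fun i _ => ?_⟩,
    fun i _ => ?_⟩
  · push_cast; linarith
  · rw [div_lt_iff₀ hδ] at hn
    have : (t - s) / n < δ := by rw [div_lt_iff₀ hn0]; linarith
    push_cast
    linarith

/-- Two arbitrary partitions are compared through the sequence of all their points. The index maps k
locate each partition inside it, so that a cell of P becomes a block of consecutive points of x. -/
theorem exists_common_refinement (P Q : TimePartition s t) : ∃ (x : ℕ → ℝ) (N : ℕ), Monotone x ∧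
    (∀ l, x l ∈ Icc s t) ∧
    (∃ k : ℕ → ℕ, Monotone k ∧ k 0 = 0 ∧ k P.n = N ∧ ∀ i, x (k i) = P.seq i) ∧
    (∃ k : ℕ → ℕ, Monotone k ∧ k 0 = 0 ∧ k Q.n = N ∧ ∀ i, x (k i) = Q.seq i) := by
  classical
  let S : Finset ℝ := (Finset.range (P.n + 1)).image P.seq ∪ (Finset.range (Q.n + 1)).image Q.seq
  have hSP : ∀ i, P.seq i ∈ S := fun i => Finset.mem_union_left _ <| Finset.mem_image.2
    ⟨min i P.n, by simp, by simp [seq]⟩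
  have hSQ : ∀ i, Q.seq i ∈ S := fun i => Finset.mem_union_right _ <| Finset.mem_image.2
    ⟨min i Q.n, by simp, by simp [seq]⟩
  have hS : ∀ y ∈ S, y ∈ Icc s t := by
    intro y hy
    rcases Finset.mem_union.1 hy with h | h
    · obtain ⟨i, -, rfl⟩ := Finset.mem_image.1 h
      exact P.seq_mem i
    · obtain ⟨i, -, rfl⟩ := Finset.mem_image.1 h
      exact Q.seq_mem i
  obtain ⟨N, hN⟩ : ∃ N, S.card = N + 1 :=
    Nat.exists_eq_succ_of_ne_zero (Finset.card_ne_zero_of_mem (hSP 0))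
  -- The increasing enumeration of the merged points; `x` continues it constantly after index N.
  let e := S.orderEmbOfFin hN
  let x : ℕ → ℝ := fun l => e ⟨min l N, by omega⟩
  have hx : ∀ l, x l ∈ S := fun l => S.orderEmbOfFin_mem hN _
  have key : ∀ R : TimePartition s t, (∀ i, R.seq i ∈ S) →
      ∃ k : ℕ → ℕ, Monotone k ∧ k 0 = 0 ∧ k R.n = N ∧ ∀ i, x (k i) = R.seq i := by
    intro R hR
    have h1 : ∀ i, ∃ l : Fin (N + 1), e l = R.seq i := by
      intro i
      have : R.seq i ∈ Set.range e := by
        rw [Finset.range_orderEmbOfFin]; exact hR i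
      exact this
    choose k hk using h1
    have hxk : ∀ l : Fin (N + 1), x l = e l := fun l => by
      simp only [x]
      congr 1
      exact Fin.ext (min_eq_left (by omega))
    refine ⟨fun i => k i, fun i j hij => ?_, ?_, ?_, fun i => by rw [hxk, hk]⟩
    · have := R.seq_mono hij
      rw [← hk, ← hk, e.le_iff_le] at this
      exact this
    · have h0 : e (k 0) ≤ e 0 := by
        rw [hk, R.seq_eq zero_le, R.first]
        exact (hS _ (S.orderEmbOfFin_mem hN 0)).1
      have := e.le_iff_le.1 h0
      simpa using nonpos_iff_eq_zero.1 this
    · have h0 : e (Fin.last N) ≤ e (k R.n) := by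
        rw [hk, R.seq_eq le_rfl, R.last]
        exact (hS _ (S.orderEmbOfFin_mem hN _)).2
      have := e.le_iff_le.1 h0
      simp [Fin.last_le_iff.1 this]
  refine ⟨x, N, fun l l' h => ?_, fun l => hS _ (hx l), key P hSP, key Q hSQ⟩
  exact e.monotone (Fin.mk_le_mk.2 (min_le_min_right _ h))

end TimePartition

/-! ### Oscillation of right-continuous increasing functions -/

/-- Up to a jump at one time `τ ∈ (u, v]`, the function `g` varies by at most `ε` on `[u, v]`. -/
def OscLE (g : ℝ → ℝ) (ε u v : ℝ) : Prop :=
  ∃ τ ∈ Ioc u v, (∀ y ∈ Ico u τ, g y - g u ≤ ε) ∧ g v - g τ ≤ ε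

/-- All intervals of the partition satisfy `OscLE`. -/
def TimePartition.Osc {s t : ℝ} (P : TimePartition s t) (g : ℝ → ℝ) (ε : ℝ) : Prop :=
  ∀ i < P.n, OscLE g ε (P.pt i) (P.pt (i + 1))

theorem TimePartition.Osc.append {s t u ε : ℝ} {g : ℝ → ℝ} {P : TimePartition s t}
    {Q : TimePartition t u} (hP : P.Osc g ε) (hQ : Q.Osc g ε) : (P.append Q).Osc g ε := by
  intro i hi
  have h : (P.append Q).n = P.n + Q.n := rfl
  rcases lt_or_ge i P.n with hi' | hi'
  · rw [append_pt_left _ _ hi'.le, append_pt_left _ _ hi']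
    exact hP i hi'
  · obtain ⟨j, rfl⟩ := Nat.exists_eq_add_of_le hi'
    rw [append_pt_right, add_assoc, append_pt_right]
    exact hQ j (by omega)

theorem oscLE_of_sub_le {g : ℝ → ℝ} {ε u v : ℝ} (hg : Monotone g) (huv : u < v) (hε : 0 ≤ ε)
    (h : g v - g u ≤ ε) : OscLE g ε u v :=
  ⟨v, right_mem_Ioc.2 huv, fun y hy => by have := hg hy.2.le; linarith, by simpa using hε⟩

/-- Around every t there is a ball on each side of which g varies by at most ε, with t itself
excluded on the left. By compactness, an interval shorter than a Lebesgue number of this cover lies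
in one ball; its centre serves as τ when it lies in (u, v], and otherwise the whole increment is at
most ε. -/
theorem exists_oscLE (g : StieltjesFunction ℝ) (T : ℝ) {ε : ℝ} (hε : 0 < ε) : ∃ δ > 0,
    ∀ u v : ℝ, u ∈ Icc 0 T → u < v → v - u < δ → OscLE g ε u v := by
  have h1 : ∀ t : ℝ, ∃ r > 0, (∀ y ∈ Ioo t (t + r), g y - g t ≤ ε) ∧
      ∀ y ∈ Ioo (t - r) t, Function.leftLim g t - g y ≤ ε := by
    intro t
    have hr : ∀ᶠ y in 𝓝[>] t, g y < g t + ε :=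
      ((g.right_continuous t).mono Ioi_subset_Ici_self).eventually
        (gt_mem_nhds (by linarith))
    have hl : ∀ᶠ y in 𝓝[<] t, Function.leftLim g t - ε < g y :=
      (g.mono.tendsto_leftLim t).eventually (lt_mem_nhds (by linarith))
    obtain ⟨b, hb, hb'⟩ := mem_nhdsGT_iff_exists_Ioo_subset.1 hr
    obtain ⟨c, hc, hc'⟩ := mem_nhdsLT_iff_exists_Ioo_subset.1 hl
    refine ⟨min (b - t) (t - c), lt_min (sub_pos.2 hb) (sub_pos.2 hc), fun y hy => ?_,
      fun y hy => ?_⟩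
    · have : g y < g t + ε := hb' ⟨hy.1, by have := min_le_left (b - t) (t - c); linarith [hy.2]⟩
      linarith
    · have : Function.leftLim g t - ε < g y :=
        hc' ⟨by have := min_le_right (b - t) (t - c); linarith [hy.1], hy.2⟩
      linarith
  choose r hr hr1 hr2 using h1
  obtain ⟨δ, hδ, H⟩ := lebesgue_number_lemma_of_metric (s := Icc 0 T)
    (c := fun t => Metric.ball t (r t)) isCompact_Icc (fun _ => Metric.isOpen_ball)
    (fun t _ => mem_iUnion.2 ⟨t, Metric.mem_ball_self (hr t)⟩)
  refine ⟨δ, hδ, fun u v hu huv hδuv => ?_⟩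
  obtain ⟨t, ht⟩ := H u hu
  have hut := ht (Metric.mem_ball_self hδ)
  have hvt := ht (show v ∈ Metric.ball u δ by
    rw [Metric.mem_ball, Real.dist_eq, abs_of_pos (by linarith)]; exact hδuv)
  rw [Metric.mem_ball, Real.dist_eq, abs_lt] at hut hvt
  rcases le_or_gt t u with h | h
  · refine oscLE_of_sub_le g.mono huv hε.le ?_
    have h2 := hr1 t v ⟨by linarith, by linarith⟩
    have h3 := g.mono h
    linarith
  rcases le_or_gt t v with h' | h'
  · refine ⟨t, ⟨h, h'⟩, fun y hy => ?_, ?_⟩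
    · have h2 := hr2 t u ⟨by linarith, h⟩
      have h3 := g.mono.le_leftLim hy.2
      linarith
    · rcases h'.eq_or_lt with rfl | h'
      · simpa using hε.le
      · exact hr1 t v ⟨h', by linarith⟩
  · refine oscLE_of_sub_le g.mono huv hε.le ?_
    have h2 := hr2 t u ⟨by linarith, h⟩
    have h3 := g.mono.le_leftLim h'
    linarith

theorem exists_mesh_osc (g : StieltjesFunction ℝ) (T : ℝ) {ε : ℝ} (hε : 0 < ε) : ∃ δ > 0,
    ∀ {s t : ℝ} (P : TimePartition s t), 0 ≤ s → t ≤ T → P.MeshLT δ → P.Osc g ε := by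
  obtain ⟨δ, hδ, h⟩ := exists_oscLE g T hε
  refine ⟨δ, hδ, fun P hs ht hP i hi => h _ _ ?_ (P.lt_succ i hi) (hP i hi)⟩
  have := P.pt_mem hi.le
  exact ⟨hs.trans this.1, this.2.trans ht⟩

theorem exists_osc (g : StieltjesFunction ℝ) {s t ε : ℝ} (hs : 0 ≤ s) (hst : s ≤ t) (hε : 0 < ε) :
    ∃ P : TimePartition s t, P.Osc g ε := by
  obtain ⟨δ, hδ, h⟩ := exists_mesh_osc g t hε
  obtain ⟨P, hP⟩ := TimePartition.exists_meshLT hst hδ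
  exact ⟨P, h P hs le_rfl hP⟩

end RoughIto

namespace RoughIto

/-! ### Stochastic sewing with jumps -/

/-! ### Trading small increments for powers of ε -/

section RealBounds

variable {p x y w W ε : ℝ}

theorem mul_rpow_le_add_rpow (hp : 2 ≤ p) (hx : 0 ≤ x) (hy : 0 ≤ y) :
    (x * y) ^ (1 / p) ≤ (x + y) ^ (2 / p) := by
  have h : x * y ≤ (x + y) ^ 2 := by nlinarith
  calc (x * y) ^ (1 / p) ≤ ((x + y) ^ 2) ^ (1 / p) := by gcongr
    _ = (x + y) ^ (2 / p) := by
      rw [← Real.rpow_natCast, ← Real.rpow_mul (by positivity)]; congr 1; push_cast; ring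

theorem rpow_mul_rpow_le_add (hp : 2 ≤ p) (hx : 0 ≤ x) (hy : 0 ≤ y) :
    x ^ (1 / p) * y ^ (2 / p) + x ^ (2 / p) * y ^ (1 / p) ≤ 2 * (x + y) ^ (3 / p) := by
  have e : (x + y) ^ (3 / p) = (x + y) ^ (1 / p) * (x + y) ^ (2 / p) := by
    rw [← Real.rpow_add_of_nonneg (by positivity) (by positivity) (by positivity)]
    congr 1; ring
  have h1 : x ^ (1 / p) * y ^ (2 / p) ≤ (x + y) ^ (1 / p) * (x + y) ^ (2 / p) := by
    gcongr <;> linarith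
  have h2 : x ^ (2 / p) * y ^ (1 / p) ≤ (x + y) ^ (2 / p) * (x + y) ^ (1 / p) := by
    gcongr <;> linarith
  rw [e]
  linarith

/-- Since x ≤ w, part of the power of x may be handed over to w. This keeps on x only the exponent
that is converted into a gain in ε. -/
theorem rpow_split_le {b c d : ℝ} (hw : 0 ≤ w) (hx : 0 ≤ x) (hxw : x ≤ w) (hc : 0 ≤ c)
    (hcb : c ≤ b) (hd : 0 ≤ d) : x ^ b * w ^ d ≤ x ^ c * w ^ (b + d - c) := by
  have e1 : x ^ b = x ^ c * x ^ (b - c) := by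
    rw [← Real.rpow_add_of_nonneg hx hc (by linarith)]; congr 1; ring
  have e2 : w ^ (b + d - c) = w ^ (b - c) * w ^ d := by
    rw [← Real.rpow_add_of_nonneg hw (by linarith) hd]; congr 1; ring
  rw [e1, e2, mul_assoc]
  have : x ^ (b - c) ≤ w ^ (b - c) := Real.rpow_le_rpow hx hxw (by linarith)
  gcongr

/-- The exponent θ = 3/p - 1 is the excess of 3/p over 1. It is positive because p < 3, and p ≥ 2
makes it at most 1/p, so that it can be split off any factor that is small. -/
theorem theta_facts (hp : 2 ≤ p) (hp' : p < 3) : 0 < 3 / p - 1 ∧ 3 / p - 1 ≤ 1 / p := by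
  have hp0 : 0 < p := by linarith
  constructor
  · rw [sub_pos, lt_div_iff₀ hp0]; linarith
  · have : 3 / p - 1 / p ≤ 1 := by rw [← sub_div, div_le_one hp0]; linarith
    linarith

/-- If m is the one of x, y known to be at most ε, then xy ≤ m(x + y). After squaring, m^{2/p} is
lowered to m^θ, and one full power of x + y remains with a surplus 1/p, bounded through W. -/
theorem mul_rpow_le_sqrt (hp : 2 ≤ p) (hp' : p < 3) (hx : 0 ≤ x) (hy : 0 ≤ y) (hW : x + y ≤ W)
    (hε : x ≤ ε ∨ y ≤ ε) (hε0 : 0 ≤ ε) :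
    (x * y) ^ (1 / p) ≤ W ^ (1 / (2 * p)) * √(ε ^ (3 / p - 1) * (x + y)) := by
  obtain ⟨h0, h1⟩ := theta_facts hp hp'
  have hp0 : 0 < p := by linarith
  have hW0 : 0 ≤ W := by linarith
  have hw : 0 ≤ x + y := by linarith
  obtain ⟨m, hm0, hmε, hmw, hxy⟩ : ∃ m, 0 ≤ m ∧ m ≤ ε ∧ m ≤ x + y ∧ x * y ≤ m * (x + y) := by
    rcases le_total x ε with h | h
    · exact ⟨x, hx, h, by linarith, by nlinarith⟩
    · rcases hε with h' | h'
      · exact ⟨x, hx, h', by linarith, by nlinarith⟩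
      · exact ⟨y, hy, h', by linarith, by nlinarith⟩
  rw [← abs_of_nonneg (show 0 ≤ (x * y) ^ (1 / p) by positivity)]
  refine abs_le_of_sq_le_sq ?_ (by positivity)
  rw [mul_pow, Real.sq_sqrt (by positivity), ← Real.rpow_natCast, ← Real.rpow_natCast,
    ← Real.rpow_mul (by positivity), ← Real.rpow_mul hW0]
  calc (x * y) ^ (1 / p * (2 : ℕ)) ≤ (m * (x + y)) ^ (1 / p * (2 : ℕ)) := by gcongr
    _ = m ^ (2 / p) * (x + y) ^ (2 / p) := by
      rw [Real.mul_rpow hm0 hw]; congr 2 <;> push_cast <;> ring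
    _ ≤ m ^ (3 / p - 1) * (x + y) ^ (2 / p + 2 / p - (3 / p - 1)) :=
      rpow_split_le hw hm0 hmw h0.le (by
        have : 1 / p ≤ 2 / p := by gcongr; norm_num
        linarith) (by positivity)
    _ = m ^ (3 / p - 1) * ((x + y) ^ (1 / p) * (x + y)) := by
      rw [← Real.rpow_add_one' hw (by positivity)]; congr 2; ring
    _ ≤ ε ^ (3 / p - 1) * (W ^ (1 / p) * (x + y)) := by gcongr
    _ = W ^ (1 / (2 * p) * (2 : ℕ)) * (ε ^ (3 / p - 1) * (x + y)) := by
      have : 1 / (2 * p) * ((2 : ℕ) : ℝ) = 1 / p := by push_cast; field_simp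
      rw [this]; ring

/-- The smaller variable is at most ε and appears at least to the power 1/p ≥ θ. Extracting θ leaves
exactly one power of the larger variable. -/
theorem rpow_mul_rpow_le (hp : 2 ≤ p) (hp' : p < 3) (hx : 0 ≤ x) (hy : 0 ≤ y)
    (hε : x ≤ ε ∨ y ≤ ε) (hε0 : 0 ≤ ε) :
    x ^ (1 / p) * y ^ (2 / p) + x ^ (2 / p) * y ^ (1 / p) ≤ 2 * (ε ^ (3 / p - 1) * (x + y)) := by
  obtain ⟨h0, h1⟩ := theta_facts hp hp'
  have hp0 : 0 < p := by linarith
  have key : ∀ m M : ℝ, 0 ≤ m → m ≤ M → m ≤ ε → M ≤ x + y →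
      m ^ (1 / p) * M ^ (2 / p) + m ^ (2 / p) * M ^ (1 / p) ≤ 2 * (ε ^ (3 / p - 1) * (x + y)) := by
    intro m M hm hmM hmε hM
    have hM0 : 0 ≤ M := hm.trans hmM
    have e1 : m ^ (2 / p) * M ^ (1 / p) ≤ m ^ (1 / p) * M ^ (2 / p) := by
      have := rpow_split_le (b := 2 / p) (c := 1 / p) (d := 1 / p) hM0 hm hmM (by positivity)
        (by gcongr; norm_num) (by positivity)
      refine this.trans_eq ?_
      congr 2; ring
    have e2 := rpow_split_le (b := 1 / p) (c := 3 / p - 1) (d := 2 / p) hM0 hm hmM h0.le h1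
      (by positivity)
    rw [show 1 / p + 2 / p - (3 / p - 1) = 1 by ring, Real.rpow_one] at e2
    have e3 : m ^ (3 / p - 1) * M ≤ ε ^ (3 / p - 1) * (x + y) := by gcongr
    linarith
  rcases le_total x y with h | h
  · refine key x y hx h ?_ (by linarith)
    rcases hε with h' | h'
    exacts [h', h.trans h']
  · have := key y x hy h (by rcases hε with h' | h'; exacts [h.trans h', h']) (by linarith)
    rw [mul_comm (x ^ (1 / p)), mul_comm (x ^ (2 / p)), add_comm]
    exact this

theorem rpow_three_le (hp : 2 ≤ p) (hp' : p < 3) (hx : 0 ≤ x) (hxε : x ≤ ε) (hxw : x ≤ w) :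
    x ^ (3 / p) ≤ ε ^ (3 / p - 1) * w := by
  obtain ⟨h0, -⟩ := theta_facts hp hp'
  have e : x ^ (3 / p) = x ^ (3 / p - 1) * x := by
    rw [← Real.rpow_add_one' hx (by linarith)]; congr 1; ring
  have hε : 0 ≤ ε := hx.trans hxε
  rw [e]
  gcongr

theorem rpow_two_le_sqrt (hp : 2 ≤ p) (hp' : p < 3) (hx : 0 ≤ x) (hxε : x ≤ ε) (hxw : x ≤ w)
    (hW : w ≤ W) : x ^ (2 / p) ≤ W ^ (1 / (2 * p)) * √(ε ^ (3 / p - 1) * w) := by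
  have h := mul_rpow_le_sqrt (p := p) hp hp' hx hx (W := 2 * W) (by linarith) (Or.inl hxε)
    (hx.trans hxε)
  obtain ⟨h0, h1⟩ := theta_facts hp hp'
  have hp0 : 0 < p := by linarith
  have hW0 : 0 ≤ W := by linarith
  have hw0 : 0 ≤ w := by linarith
  have hε0 : 0 ≤ ε := by linarith
  rw [← abs_of_nonneg (show 0 ≤ x ^ (2 / p) by positivity)]
  refine abs_le_of_sq_le_sq ?_ (by positivity)
  rw [mul_pow, Real.sq_sqrt (by positivity), ← Real.rpow_natCast, ← Real.rpow_natCast,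
    ← Real.rpow_mul hx, ← Real.rpow_mul hW0]
  have e1 : x ^ (2 / p * (2 : ℕ)) = x ^ (3 / p - 1) * (x ^ (1 / p) * x) := by
    rw [← Real.rpow_add_one' hx (by positivity),
      ← Real.rpow_add_of_nonneg hx h0.le (by positivity)]
    congr 1; push_cast; ring
  have e2 : 1 / (2 * p) * ((2 : ℕ) : ℝ) = 1 / p := by push_cast; field_simp
  rw [e1, e2]
  calc x ^ (3 / p - 1) * (x ^ (1 / p) * x) ≤ ε ^ (3 / p - 1) * (W ^ (1 / p) * w) := by
        gcongr; linarith
    _ = _ := by ring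

end RealBounds

/-! ### Remainder estimates for sewable germs -/

section Sewing

variable {Ω : Type*} {m0 : MeasurableSpace Ω} {μ : Measure Ω}
variable {G : Type*} [NormedAddCommGroup G] [NormedSpace ℝ G]

/-- The hypotheses of the stochastic sewing lemma on the germ `Ξ`, with respect to the increments
of the right-continuous increasing function `g`. -/
structure IsSewable (μ : Measure Ω) (ℱ : Filtration ℝ m0) (T a p : ℝ) (g : StieltjesFunction ℝ)
    (C : ℝ) (Ξ : ℝ → ℝ → Ω → G) : Prop where
  nonneg : 0 ≤ C
  adapted : ∀ s t, 0 ≤ s → s ≤ t → t ≤ T → StronglyMeasurable[ℱ t] (Ξ s t)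
  memLp : ∀ s t, 0 ≤ s → s ≤ t → t ≤ T → MemLp (Ξ s t) (ENNReal.ofReal a) μ
  bound : ∀ s u t, 0 ≤ s → s ≤ u → u ≤ t → t ≤ T → LpBound μ a (Ξ s t - Ξ s u - Ξ u t)
    (C * ((g u - g s) * (g t - g u)) ^ (1 / p))
  condBound : ∀ s u t, 0 ≤ s → s ≤ u → u ≤ t → t ≤ T →
    LpBound μ a (μ[Ξ s t - Ξ s u - Ξ u t | ℱ s])
      (C * ((g u - g s) ^ (1 / p) * (g t - g u) ^ (2 / p) +
        (g u - g s) ^ (2 / p) * (g t - g u) ^ (1 / p)))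

/-- The difference between the sum of `Ξ` over consecutive points of `x` and `Ξ (x i) (x j)`. -/
def sewRem (Ξ : ℝ → ℝ → Ω → G) (x : ℕ → ℝ) (i j : ℕ) : Ω → G :=
  ∑ k ∈ Finset.Ico i j, Ξ (x k) (x (k + 1)) - Ξ (x i) (x j)

theorem exists_crossing {x : ℕ → ℝ} {i j : ℕ} {τ : ℝ} (hi : x i < τ) (hj : τ ≤ x j) (hij : i ≤ j) :
    ∃ k, i ≤ k ∧ k < j ∧ x k < τ ∧ τ ≤ x (k + 1) := by
  by_contra! h
  have : ∀ k, i ≤ k → k ≤ j → x k < τ := by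
    intro k hik
    induction k, hik using Nat.le_induction with
    | base => intro _; exact hi
    | succ k hik ih => intro hk; exact h k hik (by omega) (ih (by omega))
  exact absurd (this j hij le_rfl) (not_lt.2 hj)

variable {ℱ : Filtration ℝ m0} {T a p C : ℝ} {g : StieltjesFunction ℝ} {Ξ : ℝ → ℝ → Ω → G}

namespace IsSewable

theorem sewRem_stronglyMeasurable (h : IsSewable μ ℱ T a p g C Ξ) {x : ℕ → ℝ} (hx : Monotone x)
    (hx' : ∀ i, x i ∈ Icc 0 T) {i j : ℕ} (hij : i ≤ j) :
    StronglyMeasurable[ℱ (x j)] (sewRem Ξ x i j) := by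
  refine (Finset.stronglyMeasurable_sum _ fun k hk => ?_).sub
    (h.adapted _ _ (hx' i).1 (hx hij) (hx' j).2)
  have := (Finset.mem_Ico.1 hk).2
  exact (h.adapted _ _ (hx' k).1 (hx k.le_succ) (hx' _).2).mono (ℱ.mono (hx this))

variable [FiniteDimensional ℝ G] [IsProbabilityMeasure μ]

/-- The remainder bound of the sewing lemma on any sequence of points. -/
theorem exists_sewRem_bound (h : IsSewable μ ℱ T a p g C Ξ) (ha : 2 ≤ a) (hp : 2 ≤ p)
    (hp' : p < 3) : ∃ C' : ℝ, 0 ≤ C' ∧ ∀ x : ℕ → ℝ, Monotone x → (∀ i, x i ∈ Icc 0 T) →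
      ∀ i j, i ≤ j →
        LpBound μ a (sewRem Ξ x i j)
          (C' * ((g (x j) - g (x i)) ^ (2 / p) + (g (x j) - g (x i)) ^ (3 / p))) ∧
        LpBound μ a (μ[sewRem Ξ x i j | ℱ (x i)]) (C' * (g (x j) - g (x i)) ^ (3 / p)) := by
  have hp0 : 0 < p := by linarith
  have hC := h.nonneg
  have ha1 : ENNReal.ofReal 1 ≤ ENNReal.ofReal a := ENNReal.ofReal_le_ofReal (by linarith)
  -- The conditions α > 1/2 and β > 1 read p < 4 and p < 3.
  obtain ⟨C', hC', H⟩ := discrete_sewing μ G (a := a) (α := 2 / p) (β := 3 / p) (C := 2 * C) ha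
    (by rw [div_lt_div_iff₀ (by norm_num) hp0]; linarith) (by rw [one_lt_div hp0]; exact hp')
    (by positivity)
  refine ⟨C', hC', fun x hx hx' i j hij => ?_⟩
  refine H (fun i => ℱ (x i)) (fun i j => Ξ (x i) (x j)) (fun i => g (x i))
    (fun i j hij => ℱ.mono (hx hij)) (fun i => ℱ.le _) (fun i j hij => g.mono (hx hij))
    (fun i j hij => h.adapted _ _ (hx' i).1 (hx hij) (hx' j).2) (fun i j k hij hjk => ?_)
    (fun i j k hij hjk => ?_) (fun i j hij => ?_) i j hij
  · refine (h.bound _ _ _ (hx' i).1 (hx hij) (hx hjk) (hx' k).2).mono ?_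
    have h1 := mul_rpow_le_add_rpow hp (sub_nonneg.2 (g.mono (hx hij)))
      (sub_nonneg.2 (g.mono (hx hjk)))
    rw [show g (x j) - g (x i) + (g (x k) - g (x j)) = g (x k) - g (x i) by ring] at h1
    have h2 : 0 ≤ (g (x k) - g (x i)) ^ (2 / p) :=
      Real.rpow_nonneg (sub_nonneg.2 (g.mono (hx (hij.trans hjk)))) _
    nlinarith
  · refine (h.condBound _ _ _ (hx' i).1 (hx hij) (hx hjk) (hx' k).2).mono ?_
    have h1 := rpow_mul_rpow_le_add hp (sub_nonneg.2 (g.mono (hx hij)))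
      (sub_nonneg.2 (g.mono (hx hjk)))
    rw [show g (x j) - g (x i) + (g (x k) - g (x j)) = g (x k) - g (x i) by ring] at h1
    nlinarith
  · have := (h.memLp _ _ (hx' i).1 (hx hij) (hx' j).2).mono_exponent ha1
    rw [ENNReal.ofReal_one] at this
    exact this.integrable le_rfl

/-- The remainder is small on intervals where `g` is almost constant up to one jump. -/
theorem exists_sewRem_bound_of_osc (h : IsSewable μ ℱ T a p g C Ξ) (ha : 2 ≤ a) (hp : 2 ≤ p)
    (hp' : p < 3) : ∃ C' : ℝ, 0 ≤ C' ∧ ∀ x : ℕ → ℝ, Monotone x → (∀ i, x i ∈ Icc 0 T) →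
      ∀ i j ε, i ≤ j → 0 < ε → OscLE g ε (x i) (x j) →
        LpBound μ a (sewRem Ξ x i j) (C' * √(ε ^ (3 / p - 1) * (g (x j) - g (x i)))) ∧
        LpBound μ a (μ[sewRem Ξ x i j | ℱ (x i)])
          (C' * (ε ^ (3 / p - 1) * (g (x j) - g (x i)))) := by
  obtain ⟨C₁, hC₁, H⟩ := h.exists_sewRem_bound ha hp hp'
  have : CompleteSpace G := FiniteDimensional.complete ℝ G
  have hC := h.nonneg
  have ha1 : 1 ≤ a := by linarith
  set W := max (g T - g 0) 0 with hWdef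
  have hW0 : 0 ≤ W := le_max_right _ _
  set K := W ^ (1 / (2 * p)) with hK
  have hK0 : 0 ≤ K := by positivity
  set Θ := 3 / p - 1 with hΘ
  have hΘ0 : 0 < Θ := (theta_facts hp hp').1
  -- The L^a bound of the discrete lemma also contains the drift w^{3/p}; half of its exponent is
  -- bounded through W to give it the same square-root form.
  set K' := W ^ ((3 / p) / 2) with hK'
  have hK'0 : 0 ≤ K' := by positivity
  refine ⟨2 * C₁ * K + 2 * C₁ * K' + 2 * C₁ + 2 * C * K + 4 * C, by positivity,
    fun x hx hx' i j ε hij hε ⟨τ, hτ, hτ1, hτ2⟩ => ?_⟩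
  -- The cell from x k to x (k+1) contains the exceptional time τ. On both sides of it g varies by
  -- at most ε, so the block is treated as left part, cell, right part.
  obtain ⟨k, hik, hkj, hk1, hk2⟩ := exists_crossing hτ.1 hτ.2 hij
  have gm : ∀ {a b : ℕ}, a ≤ b → g (x a) ≤ g (x b) := fun hab => g.mono (hx hab)
  have hgi : ∀ l, g 0 ≤ g (x l) ∧ g (x l) ≤ g T := fun l => ⟨g.mono (hx' l).1, g.mono (hx' l).2⟩
  have h1 : g (x k) - g (x i) ≤ ε := hτ1 _ ⟨hx hik, hk1⟩
  have h2 : g (x j) - g (x (k + 1)) ≤ ε := (sub_le_sub_left (g.mono hk2) _).trans hτ2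
  set w := g (x j) - g (x i) with hw
  have hw0 : 0 ≤ w := sub_nonneg.2 (gm hij)
  have hwW : w ≤ W := le_max_of_le_left (by linarith [hgi i, hgi j])
  have gik := gm hik
  have gkk := gm k.le_succ
  have gkj := gm (show k + 1 ≤ j from hkj)
  have A : ∀ i' j', i ≤ i' → i' ≤ j' → j' ≤ j → g (x j') - g (x i') ≤ ε →
      LpBound μ a (sewRem Ξ x i' j') (C₁ * K * √(ε ^ Θ * w) + C₁ * K' * √(ε ^ Θ * w)) ∧
      LpBound μ a (μ[sewRem Ξ x i' j' | ℱ (x i)]) (C₁ * (ε ^ Θ * w)) := by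
    intro i' j' hi hij' hj hε'
    obtain ⟨b1, b2⟩ := H x hx hx' i' j' hij'
    have hw' : 0 ≤ g (x j') - g (x i') := sub_nonneg.2 (gm hij')
    have hww : g (x j') - g (x i') ≤ w := by
      have := gm hi
      have := gm hj
      linarith
    have e1 : (g (x j') - g (x i')) ^ (2 / p) ≤ K * √(ε ^ Θ * w) :=
      rpow_two_le_sqrt hp hp' hw' hε' hww hwW
    have e2 : (g (x j') - g (x i')) ^ (3 / p) ≤ ε ^ Θ * w := rpow_three_le hp hp' hw' hε' hww
    have e3 : (g (x j') - g (x i')) ^ (3 / p) ≤ K' * √(ε ^ Θ * w) := by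
      have hp0 : 0 < p := by linarith
      have : (g (x j') - g (x i')) ^ (3 / p) = (g (x j') - g (x i')) ^ ((3 / p) / 2) *
          √((g (x j') - g (x i')) ^ (3 / p)) := by
        rw [Real.sqrt_eq_rpow, ← Real.rpow_mul hw', ← Real.rpow_add_of_nonneg hw' (by positivity)
          (by positivity)]
        congr 1; ring
      have hK'' : (g (x j') - g (x i')) ^ ((3 / p) / 2) ≤ K' :=
        Real.rpow_le_rpow hw' (hww.trans hwW) (by positivity)
      rw [this]
      gcongr
    refine ⟨b1.mono ?_, ?_⟩
    · nlinarith
    · refine ((b2.condExp ha1 (ℱ (x i))).congr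
        (condExp_condExp_of_le (ℱ.mono (hx hi)) (ℱ.le _))).mono ?_
      gcongr
  obtain ⟨a1, a2⟩ := A i k le_rfl hik hkj.le h1
  obtain ⟨a3, a4⟩ := A (k + 1) j (by omega) hkj le_rfl h2
  -- The defects created by cutting out the exceptional cell may straddle a large jump, but one of
  -- their two increments is always at most ε; the product bounds then suffice.
  have B : ∀ i' l j', i ≤ i' → i' ≤ l → l ≤ j' → j' ≤ j →
      (g (x l) - g (x i') ≤ ε ∨ g (x j') - g (x l) ≤ ε) →
      LpBound μ a (Ξ (x i') (x j') - Ξ (x i') (x l) - Ξ (x l) (x j')) (C * K * √(ε ^ Θ * w)) ∧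
      LpBound μ a (μ[Ξ (x i') (x j') - Ξ (x i') (x l) - Ξ (x l) (x j') | ℱ (x i)])
        (2 * C * (ε ^ Θ * w)) := by
    intro i' l j' hi hil hlj hj hε'
    have x1 : 0 ≤ g (x l) - g (x i') := sub_nonneg.2 (gm hil)
    have x2 : 0 ≤ g (x j') - g (x l) := sub_nonneg.2 (gm hlj)
    have x3 : g (x l) - g (x i') + (g (x j') - g (x l)) ≤ w := by
      have := gm hi
      have := gm hj
      linarith
    have e1 := mul_rpow_le_sqrt hp hp' x1 x2 (x3.trans hwW) hε' hε.le
    have e2 := rpow_mul_rpow_le hp hp' x1 x2 hε' hε.le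
    have e3 : √(ε ^ Θ * (g (x l) - g (x i') + (g (x j') - g (x l)))) ≤ √(ε ^ Θ * w) := by gcongr
    have e4 : ε ^ Θ * (g (x l) - g (x i') + (g (x j') - g (x l))) ≤ ε ^ Θ * w := by gcongr
    constructor
    · refine (h.bound _ _ _ (hx' _).1 (hx hil) (hx hlj) (hx' _).2).mono ?_
      rw [mul_assoc]
      gcongr
      exact e1.trans (by gcongr)
    · have b := h.condBound _ _ _ (hx' _).1 (hx hil) (hx hlj) (hx' _).2
      refine ((b.condExp ha1 (ℱ (x i))).congr
        (condExp_condExp_of_le (ℱ.mono (hx hi)) (ℱ.le _))).mono ?_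
      rw [mul_comm 2 C, mul_assoc]
      gcongr
      exact e2.trans (by gcongr)
  obtain ⟨b1, b2⟩ := B i (k + 1) j le_rfl (by omega) hkj le_rfl (Or.inr h2)
  obtain ⟨b3, b4⟩ := B i k (k + 1) le_rfl hik k.le_succ hkj (Or.inl h1)
  -- Both defects enter with a minus sign: Ξ over the whole block is first cut at k + 1, and the
  -- left piece then at k.
  have e : sewRem Ξ x i k + sewRem Ξ x (k + 1) j -
      (Ξ (x i) (x j) - Ξ (x i) (x (k + 1)) - Ξ (x (k + 1)) (x j)) -
      (Ξ (x i) (x (k + 1)) - Ξ (x i) (x k) - Ξ (x k) (x (k + 1))) = sewRem Ξ x i j := by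
    have hsum : ∑ l ∈ Finset.Ico i j, Ξ (x l) (x (l + 1)) =
        ∑ l ∈ Finset.Ico i k, Ξ (x l) (x (l + 1)) +
        (Ξ (x k) (x (k + 1)) + ∑ l ∈ Finset.Ico (k + 1) j, Ξ (x l) (x (l + 1))) := by
      rw [← Finset.sum_eq_sum_Ico_succ_bot hkj (fun l => Ξ (x l) (x (l + 1))),
        Finset.sum_Ico_consecutive _ hik hkj.le]
    simp only [sewRem]
    rw [hsum]
    abel
  rw [← e]
  have hs : 0 ≤ √(ε ^ Θ * w) := Real.sqrt_nonneg _
  have hs' : 0 ≤ ε ^ Θ * w := by positivity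
  constructor
  · refine ((((a1.add ha1 a3).sub ha1 b1).sub ha1 b3)).mono ?_
    have : 0 ≤ (2 * C₁ + 4 * C) * √(ε ^ Θ * w) := by positivity
    nlinarith
  · have i1 := a1.integrable ha1
    have i2 := a3.integrable ha1
    have i3 := b1.integrable ha1
    have i4 := b3.integrable ha1
    refine ((((a2.add ha1 a4).sub ha1 b2).sub ha1 b4)).mono ?_ |>.congr ?_
    · have : 0 ≤ (2 * C₁ * K + 2 * C₁ * K' + 2 * C * K) * (ε ^ Θ * w) := by positivity
      nlinarith
    · refine EventuallyEq.symm ((condExp_sub ((i1.add i2).sub i3) i4 _).trans ?_)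
      refine EventuallyEq.sub ((condExp_sub (i1.add i2) i3 _).trans ?_) (EventuallyEq.refl _ _)
      exact EventuallyEq.sub (condExp_add i1 i2 _) (EventuallyEq.refl _ _)

end IsSewable

end Sewing

end RoughIto

namespace RoughIto

/-! ### Convergence of Riemann sums and the sewn integral -/

section SewingLimit

variable {Ω : Type*} {m0 : MeasurableSpace Ω} {μ : Measure Ω} [IsProbabilityMeasure μ]
variable {G : Type*} [NormedAddCommGroup G] [NormedSpace ℝ G] [FiniteDimensional ℝ G]

/-- Sums over a partition of increments with small conditional means and sizes. -/
theorem exists_lpBound_partition_sum (μ : Measure Ω) [IsProbabilityMeasure μ] (G : Type*)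
    [NormedAddCommGroup G] [NormedSpace ℝ G] [FiniteDimensional ℝ G] {a : ℝ} (ha : 2 ≤ a)
    (g : StieltjesFunction ℝ) (T : ℝ) : ∃ K : ℝ, 0 ≤ K ∧ ∀ {s t : ℝ} (P : TimePartition s t)
      (ℱ : Filtration ℝ m0) (Z : ℕ → Ω → G) (c η : ℝ), 0 ≤ s → t ≤ T → 0 ≤ c → 0 ≤ η →
      (∀ i, StronglyMeasurable[ℱ (P.seq (i + 1))] (Z i)) →
      (∀ i < P.n, LpBound μ a (Z i) (c * √(η * (g (P.seq (i + 1)) - g (P.seq i))))) →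
      (∀ i < P.n, LpBound μ a (μ[Z i | ℱ (P.seq i)])
        (c * (η * (g (P.seq (i + 1)) - g (P.seq i))))) →
      LpBound μ a (∑ i ∈ Finset.range P.n, Z i) (K * c * (√η + η)) := by
  obtain ⟨C, hC, H⟩ := exists_lpBound_sum μ G ha
  set W := max (g T - g 0) 0
  have hW0 : 0 ≤ W := le_max_right _ _
  refine ⟨C * (√W + W), by positivity, fun {s t} P ℱ Z c η hs ht hc hη hm hd he => ?_⟩
  refine (H (fun i => ℱ (P.seq i)) Z _ _ P.n (fun i j hij => ℱ.mono (P.seq_mono hij))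
    (fun i => ℱ.le _) hm hd he).mono ?_
  have hw : ∀ i, 0 ≤ g (P.seq (i + 1)) - g (P.seq i) := fun i =>
    sub_nonneg.2 (g.mono (P.seq_mono i.le_succ))
  have hsum : ∑ i ∈ Finset.range P.n, (g (P.seq (i + 1)) - g (P.seq i)) ≤ W := by
    rw [Finset.sum_range_sub (fun i => g (P.seq i))]
    have h1 := P.seq_mem P.n
    have h2 := P.seq_mem 0
    have h3 := g.mono (h1.2.trans ht)
    have h4 := g.mono (hs.trans h2.1)
    exact le_max_of_le_left (by linarith)
  -- The sizes are square roots of increments of g, so their squares telescope just as the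
  -- conditional means do.
  have e1 : ∑ i ∈ Finset.range P.n, (c * √(η * (g (P.seq (i + 1)) - g (P.seq i)))) ^ 2 ≤
      c ^ 2 * (η * W) := by
    calc ∑ i ∈ Finset.range P.n, (c * √(η * (g (P.seq (i + 1)) - g (P.seq i)))) ^ 2
        = c ^ 2 * (η * ∑ i ∈ Finset.range P.n, (g (P.seq (i + 1)) - g (P.seq i))) := by
          rw [Finset.mul_sum, Finset.mul_sum]
          refine Finset.sum_congr rfl fun i _ => ?_
          rw [mul_pow, Real.sq_sqrt (mul_nonneg hη (hw i))]
      _ ≤ _ := by gcongr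
  have e2 : ∑ i ∈ Finset.range P.n, c * (η * (g (P.seq (i + 1)) - g (P.seq i))) ≤ c * (η * W) := by
    rw [← Finset.mul_sum, ← Finset.mul_sum]
    gcongr
  have e3 : √(c ^ 2 * (η * W)) = c * (√η * √W) := by
    rw [Real.sqrt_mul (by positivity), Real.sqrt_sq hc, Real.sqrt_mul hη]
  have e4 := (Real.sqrt_le_sqrt e1).trans_eq e3
  calc C * (√(∑ i ∈ Finset.range P.n, (c * √(η * (g (P.seq (i + 1)) - g (P.seq i)))) ^ 2) +
        ∑ i ∈ Finset.range P.n, c * (η * (g (P.seq (i + 1)) - g (P.seq i))))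
      ≤ C * (c * (√η * √W) + c * (η * W)) := by gcongr
    _ ≤ C * (√W + W) * c * (√η + η) := by
      have : 0 ≤ C * c * (√W * η + W * √η) := by positivity
      nlinarith

/-- The rate of convergence of Riemann sums over partitions with oscillation `ε`. -/
noncomputable def sewRate (p ε : ℝ) : ℝ := √(ε ^ (3 / p - 1)) + ε ^ (3 / p - 1)

theorem sewRate_nonneg {p ε : ℝ} (hε : 0 ≤ ε) : 0 ≤ sewRate p ε := by
  unfold sewRate; positivity

theorem exists_sewRate_le {p : ℝ} (hp : 2 ≤ p) (hp' : p < 3) {K η : ℝ} (hη : 0 < η) :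
    ∃ ε > 0, K * sewRate p ε ≤ η := by
  have hΘ := (theta_facts hp hp').1
  have h1 : Tendsto (fun ε : ℝ => K * sewRate p ε) (𝓝[>] 0) (𝓝 0) := by
    have h2 : Tendsto (fun ε : ℝ => ε ^ (3 / p - 1)) (𝓝[>] 0) (𝓝 0) := by
      have := (Real.continuousAt_rpow_const 0 (3 / p - 1) (Or.inr hΘ.le)).tendsto
      rw [Real.zero_rpow hΘ.ne'] at this
      exact this.mono_left nhdsWithin_le_nhds
    have h3 := ((h2.sqrt).add h2).const_mul K
    simpa [sewRate] using h3
  obtain ⟨ε, h, h'⟩ := ((h1.eventually (gt_mem_nhds hη)).and self_mem_nhdsWithin).exists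
  exact ⟨ε, h', h.le⟩

variable {ℱ : Filtration ℝ m0} {T a p C : ℝ} {g : StieltjesFunction ℝ} {Ξ : ℝ → ℝ → Ω → G}

namespace IsSewable

theorem sum_memLp (h : IsSewable μ ℱ T a p g C Ξ) {s t : ℝ} (hs : 0 ≤ s) (ht : t ≤ T)
    (P : TimePartition s t) :
    MemLp (P.sum Ξ) (ENNReal.ofReal a) μ ∧ StronglyMeasurable[ℱ t] (P.sum Ξ) := by
  rw [P.sum_eq_seq]
  have h1 := fun i => P.seq_mem i
  have h2 := fun i : ℕ => P.seq_mono i.le_succ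
  constructor
  · exact memLp_finsetSum' _ fun i _ =>
      h.memLp _ _ (hs.trans (h1 i).1) (h2 i) ((h1 _).2.trans ht)
  · exact Finset.stronglyMeasurable_sum _ fun i _ =>
      (h.adapted _ _ (hs.trans (h1 i).1) (h2 i) ((h1 _).2.trans ht)).mono (ℱ.mono (h1 _).2)

/-- Each sum is compared with the one over the common refinement. The difference is a sum of
remainders over cells, each measurable at the right end of its cell, small in L^a and smaller still
after conditioning, so `exists_lpBound_partition_sum` applies. Only the oscillation of g over cells
matters. -/
theorem exists_sum_sub_sum_bound (h : IsSewable μ ℱ T a p g C Ξ) (ha : 2 ≤ a) (hp : 2 ≤ p)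
    (hp' : p < 3) : ∃ K : ℝ, 0 ≤ K ∧ ∀ {s t : ℝ} (P Q : TimePartition s t) (ε ε' : ℝ), 0 ≤ s →
      t ≤ T → 0 < ε → 0 < ε' → P.Osc g ε → Q.Osc g ε' →
      LpBound μ a (P.sum Ξ - Q.sum Ξ) (K * sewRate p ε + K * sewRate p ε') := by
  obtain ⟨C₁, hC₁, H₁⟩ := h.exists_sewRem_bound_of_osc ha hp hp'
  obtain ⟨C₂, hC₂, H₂⟩ := exists_lpBound_partition_sum μ G ha g T
  have ha1 : 1 ≤ a := by linarith
  have hΘ := (theta_facts hp hp').1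
  refine ⟨C₂ * C₁, by positivity, fun {s t} P Q ε ε' hs ht hε hε' hP hQ => ?_⟩
  obtain ⟨x, N, hx, hx', ⟨k, hk, hk0, hkn, hkP⟩, ⟨l, hl, hl0, hln, hlQ⟩⟩ :=
    P.exists_common_refinement Q
  have hxT : ∀ i, x i ∈ Icc 0 T := fun i => ⟨hs.trans (hx' i).1, (hx' i).2.trans ht⟩
  have key : ∀ (R : TimePartition s t) (k : ℕ → ℕ) (ε : ℝ), Monotone k → k 0 = 0 → k R.n = N →
      (∀ i, x (k i) = R.seq i) → 0 < ε → R.Osc g ε →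
      LpBound μ a (∑ i ∈ Finset.Ico 0 N, Ξ (x i) (x (i + 1)) - R.sum Ξ)
        (C₂ * C₁ * sewRate p ε) := by
    intro R k ε hk hk0 hkn hkR hε hR
    have e : ∑ i ∈ Finset.Ico 0 N, Ξ (x i) (x (i + 1)) - R.sum Ξ =
        ∑ i ∈ Finset.range R.n, sewRem Ξ x (k i) (k (i + 1)) := by
      simp only [sewRem, Finset.sum_sub_distrib, R.sum_eq_seq, hkR]
      congr 1
      rw [← hkn, ← hk0]
      generalize R.n = m
      induction m with
      | zero => simp
      | succ m ih =>
        rw [Finset.sum_range_succ, ← ih, Finset.sum_Ico_consecutive _ (hk zero_le) (hk m.le_succ)]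
    rw [e]
    have hosc : ∀ i < R.n, OscLE g ε (x (k i)) (x (k (i + 1))) := fun i hi => by
      rw [hkR, hkR, R.seq_eq hi.le, R.seq_eq hi]; exact hR i hi
    refine H₂ R ℱ _ C₁ (ε ^ (3 / p - 1)) hs ht hC₁ (by positivity) (fun i => ?_) (fun i hi => ?_)
      (fun i hi => ?_)
    · rw [← hkR]
      exact h.sewRem_stronglyMeasurable hx hxT (hk i.le_succ)
    · have := (H₁ x hx hxT (k i) (k (i + 1)) ε (hk i.le_succ) hε (hosc i hi)).1
      rwa [hkR, hkR] at this
    · have := (H₁ x hx hxT (k i) (k (i + 1)) ε (hk i.le_succ) hε (hosc i hi)).2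
      rwa [hkR, hkR] at this
  have h1 := (key Q l ε' hl hl0 hln hlQ hε' hQ).sub ha1 (key P k ε hk hk0 hkn hkP hε hP)
  rw [sub_sub_sub_cancel_left] at h1
  exact h1.mono (by rw [add_comm])

/-- Sums over partitions with rapidly decreasing oscillation form a Cauchy sequence, and comparison
with an arbitrary partition gives the rate. -/
theorem exists_limit (h : IsSewable μ ℱ T a p g C Ξ) (ha : 2 ≤ a) (hp : 2 ≤ p) (hp' : p < 3) :
    ∃ K : ℝ, 0 ≤ K ∧ ∀ t, 0 ≤ t → t ≤ T → ∃ L : Ω → G, StronglyMeasurable[ℱ t] L ∧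
      ∀ (P : TimePartition 0 t) (ε : ℝ), 0 < ε → P.Osc g ε →
        LpBound μ a (L - P.sum Ξ) (K * sewRate p ε) := by
  obtain ⟨K, hK, H⟩ := h.exists_sum_sub_sum_bound ha hp hp'
  have ha1 : 1 ≤ a := by linarith
  have : CompleteSpace G := FiniteDimensional.complete ℝ G
  refine ⟨K, hK, fun t ht htT => ?_⟩
  choose ε hε hεr using fun n : ℕ => exists_sewRate_le hp hp' (K := K)
    (show (0 : ℝ) < (1 / 2) ^ n / 4 by positivity)
  choose P hP using fun n => exists_osc g le_rfl ht (hε n)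
  have hL := fun n => h.sum_memLp le_rfl htT (P n)
  obtain ⟨L, hLm, hLt⟩ := Lp.cauchy_complete_eLpNorm (p := ENNReal.ofReal a) (μ := μ)
    (by simpa using ha1) (fun n => (hL n).1) (B := fun n => ENNReal.ofReal ((1 / 2) ^ n))
    (by
      rw [← ENNReal.ofReal_tsum_of_nonneg (fun n => by positivity) summable_geometric_two]
      exact ENNReal.ofReal_ne_top)
    (fun N n m hn hm => by
      have h1 := H (P n) (P m) (ε n) (ε m) le_rfl htT (hε n) (hε m) (hP n) (hP m)
      refine h1.le.trans_lt ?_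
      have h2 : ∀ k, N ≤ k → K * sewRate p (ε k) ≤ (1 / 2) ^ N / 4 := fun k hk =>
        (hεr k).trans (by
          gcongr ?_ / 4
          exact pow_le_pow_of_le_one (by norm_num) (by norm_num) hk)
      have h3 : (0 : ℝ) < (1 / 2) ^ N := by positivity
      exact (ENNReal.ofReal_lt_ofReal_iff h3).2 (by linarith [h2 n hn, h2 m hm]))
  -- The filtration need not be complete, so the L^a limit has to be replaced by an ℱ_t-measurable
  -- version. Conditioning does this and contracts distances to the adapted sums.
  refine ⟨μ[L | ℱ t], stronglyMeasurable_condExp, fun Q δ hδ hQ => ?_⟩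
  have hb : ∀ n, LpBound μ a (μ[L | ℱ t] - Q.sum Ξ)
      ((eLpNorm ((P n).sum Ξ - L) (ENNReal.ofReal a) μ).toReal +
        (K * sewRate p (ε n) + K * sewRate p δ)) := by
    intro n
    have b1 := (((hL n).1.sub hLm).lpBound.neg.condExp ha1 (ℱ t))
    have hi1 : Integrable L μ := hLm.integrable (by simpa using ha1)
    have hi2 : Integrable ((P n).sum Ξ) μ := (hL n).1.integrable (by simpa using ha1)
    have b2 : LpBound μ a (μ[L | ℱ t] - (P n).sum Ξ)
        (eLpNorm ((P n).sum Ξ - L) (ENNReal.ofReal a) μ).toReal := by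
      refine b1.congr ?_
      rw [neg_sub]
      refine (condExp_sub hi1 hi2 _).trans ?_
      rw [condExp_of_stronglyMeasurable (ℱ.le t) (hL n).2 hi2]
    have b3 := b2.add ha1 (H (P n) Q (ε n) δ le_rfl htT (hε n) hδ (hP n) hQ)
    rwa [sub_add_sub_cancel] at b3
  refine LpBound.of_forall_pos (mul_nonneg hK (sewRate_nonneg hδ.le)) fun η hη => ?_
  have h1 : Tendsto (fun n => (eLpNorm ((P n).sum Ξ - L) (ENNReal.ofReal a) μ).toReal +
      (1 / 2 : ℝ) ^ n / 4) atTop (𝓝 0) := by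
    have h2 := (ENNReal.tendsto_toReal ENNReal.zero_ne_top).comp hLt
    have h3 := (tendsto_pow_atTop_nhds_zero_of_lt_one (r := (1 / 2 : ℝ)) (by norm_num)
      (by norm_num)).div_const 4
    simpa using h2.add h3
  obtain ⟨n, hn⟩ := (h1.eventually (gt_mem_nhds hη)).exists
  exact (hb n).mono (by linarith [hεr n])

/-- **Stochastic sewing lemma** for right-continuous controls: a sewable germ has an integral,
which is the limit of the Riemann sums as the mesh size tends to zero. -/
theorem exists_integral (h : IsSewable μ ℱ T a p g C Ξ) (ha : 2 ≤ a) (hp : 2 ≤ p) (hp' : p < 3) :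
    ∃ (I : ℝ → Ω → G) (K : ℝ), 0 ≤ K ∧ (0 ≤ T → I 0 =ᵐ[μ] 0) ∧
      (∀ t ∈ Icc 0 T, StronglyMeasurable[ℱ t] (I t)) ∧
      (∀ {s t : ℝ} (P : TimePartition s t) (ε : ℝ), 0 ≤ s → t ≤ T → 0 < ε → P.Osc g ε →
        LpBound μ a (I t - I s - P.sum Ξ) (K * sewRate p ε)) ∧
      (∀ s t ε : ℝ, 0 ≤ s → s < t → t ≤ T → 0 < ε → OscLE g ε s t →
        LpBound μ a (I t - I s - Ξ s t) (K * √(ε ^ (3 / p - 1) * (g t - g s))) ∧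
        LpBound μ a (μ[I t - I s - Ξ s t | ℱ s]) (K * (ε ^ (3 / p - 1) * (g t - g s)))) ∧
      (∀ s t : ℝ, 0 ≤ s → s ≤ t → t ≤ T →
        LpBound μ a (I t - I s - Ξ s t) (K * (g t - g s) ^ (2 / p))) := by
  obtain ⟨K, hK, H⟩ := h.exists_limit ha hp hp'
  obtain ⟨K₁, hK₁, H₁⟩ := h.exists_sewRem_bound ha hp hp'
  obtain ⟨K₂, hK₂, H₂⟩ := h.exists_sewRem_bound_of_osc ha hp hp'
  have ha1 : 1 ≤ a := by linarith
  have hp0 : 0 < p := by linarith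
  have : CompleteSpace G := FiniteDimensional.complete ℝ G
  have H' : ∀ t : ℝ, ∃ L : Ω → G, 0 ≤ t → t ≤ T → StronglyMeasurable[ℱ t] L ∧
      ∀ (P : TimePartition 0 t) (ε : ℝ), 0 < ε → P.Osc g ε →
        LpBound μ a (L - P.sum Ξ) (K * sewRate p ε) := fun t => by
    by_cases ht : 0 ≤ t ∧ t ≤ T
    · obtain ⟨L, hL⟩ := H t ht.1 ht.2
      exact ⟨L, fun _ _ => hL⟩
    · exact ⟨0, fun h1 h2 => absurd ⟨h1, h2⟩ ht⟩
  choose I hI using H'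
  have hconv : ∀ {s t : ℝ} (P : TimePartition s t) (ε : ℝ), 0 ≤ s → t ≤ T → 0 < ε → P.Osc g ε →
      LpBound μ a (I t - I s - P.sum Ξ) (2 * K * sewRate p ε) := by
    intro s t P ε hs ht hε hP
    obtain ⟨Q, hQ⟩ := exists_osc g le_rfl hs hε
    -- I t and I s are approximated along partitions sharing the same piece Q of [0, s]. Its
    -- contribution cancels, which gives additivity of the integral.
    have b1 := (hI t (hs.trans P.le) ht).2 (Q.append P) ε hε (hQ.append hP)
    have b2 := (hI s hs (P.le.trans ht)).2 Q ε hε hQ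
    have b3 := b1.sub ha1 b2
    rw [TimePartition.sum_append] at b3
    refine (b3.mono (by linarith)).congr (.of_forall fun ω => ?_)
    simp only [Pi.sub_apply, Pi.add_apply]
    abel
  have happrox : ∀ {s t η : ℝ}, 0 ≤ s → s ≤ t → t ≤ T → 0 < η → ∃ P : TimePartition s t,
      LpBound μ a (I t - I s - P.sum Ξ) η := by
    intro s t η hs hst ht hη
    obtain ⟨ε, hε, hεη⟩ := exists_sewRate_le hp hp' (K := 2 * K) hη
    obtain ⟨P, hP⟩ := exists_osc g hs hst hε
    exact ⟨P, (hconv P ε hs ht hε hP).mono hεη⟩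
  have hrem : ∀ {s t : ℝ} (P : TimePartition s t), sewRem Ξ P.seq 0 P.n = P.sum Ξ - Ξ s t := by
    intro s t P
    rw [sewRem, P.sum_eq_seq, P.seq_eq zero_le, P.seq_eq le_rfl, P.first, P.last,
      Finset.range_eq_Ico]
  have hseq0 : ∀ {s t : ℝ} (P : TimePartition s t), P.seq 0 = s ∧ P.seq P.n = t :=
    fun P => ⟨by rw [P.seq_eq zero_le, P.first], by rw [P.seq_eq le_rfl, P.last]⟩
  set W := max (g T - g 0) 0
  have hW0 : 0 ≤ W := le_max_right _ _
  refine ⟨I, 2 * K + K₂ + K₁ * (1 + W ^ (1 / p)), by positivity, fun hT => ?_,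
    fun t ht => (hI t ht.1 ht.2).1, fun P ε hs ht hε hP => ?_, fun s t ε hs hst ht hε hosc => ?_,
    fun s t hs hst ht => ?_⟩
  · have h0 : LpBound μ a (I 0) 0 := by
      refine LpBound.of_forall_pos le_rfl fun η hη => ?_
      obtain ⟨ε, hε, hεη⟩ := exists_sewRate_le hp hp' (K := K) hη
      have b := (hI 0 le_rfl hT).2 (TimePartition.trivial 0) ε hε
        (fun i hi => by simp [TimePartition.trivial] at hi)
      rw [TimePartition.sum_trivial, sub_zero] at b
      exact b.mono (by linarith)
    exact h0.ae_eq_zero ha1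
  · refine (hconv P ε hs ht hε hP).mono ?_
    gcongr
    · exact sewRate_nonneg hε.le
    · have : 0 ≤ K₁ * (1 + W ^ (1 / p)) := by positivity
      linarith
  · have hw : 0 ≤ g t - g s := sub_nonneg.2 (g.mono hst.le)
    -- These remainder bounds do not depend on P, so they pass to the limit of the Riemann sums, up
    -- to an arbitrary η.
    have key : ∀ P : TimePartition s t,
        LpBound μ a (P.sum Ξ - Ξ s t) (K₂ * √(ε ^ (3 / p - 1) * (g t - g s))) ∧
        LpBound μ a (μ[P.sum Ξ - Ξ s t | ℱ s]) (K₂ * (ε ^ (3 / p - 1) * (g t - g s))) := by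
      intro P
      have := H₂ P.seq P.seq_mono (fun i => ⟨hs.trans (P.seq_mem i).1, (P.seq_mem i).2.trans ht⟩)
        0 P.n ε zero_le hε (by rw [(hseq0 P).1, (hseq0 P).2]; exact hosc)
      rwa [hrem, (hseq0 P).1, (hseq0 P).2] at this
    have hle : K₂ ≤ 2 * K + K₂ + K₁ * (1 + W ^ (1 / p)) := by
      have : 0 ≤ K₁ * (1 + W ^ (1 / p)) := by positivity
      linarith
    constructor
    · refine LpBound.mono ?_ (mul_le_mul_of_nonneg_right hle (by positivity))
      refine LpBound.of_forall_pos (by positivity) fun η hη => ?_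
      obtain ⟨P, hP⟩ := happrox hs hst.le ht hη
      have b := hP.add ha1 (key P).1
      rw [sub_add_sub_cancel] at b
      exact b.mono (by linarith)
    · refine LpBound.mono ?_ (mul_le_mul_of_nonneg_right hle (by positivity))
      refine LpBound.of_forall_pos (by positivity) fun η hη => ?_
      obtain ⟨P, hP⟩ := happrox hs hst.le ht hη
      have b := (hP.condExp ha1 (ℱ s)).add ha1 (key P).2
      refine (b.mono (by linarith)).congr ?_
      refine (condExp_add (hP.integrable ha1) ((key P).1.integrable ha1) _).symm.trans ?_
      rw [sub_add_sub_cancel]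
  · have hw : 0 ≤ g t - g s := sub_nonneg.2 (g.mono hst)
    have hwW : g t - g s ≤ W :=
      le_max_of_le_left (sub_le_sub (g.mono ht) (g.mono hs))
    have e : (g t - g s) ^ (2 / p) + (g t - g s) ^ (3 / p) ≤
        (1 + W ^ (1 / p)) * (g t - g s) ^ (2 / p) := by
      have e1 : (g t - g s) ^ (3 / p) = (g t - g s) ^ (1 / p) * (g t - g s) ^ (2 / p) := by
        rw [← Real.rpow_add_of_nonneg hw (by positivity) (by positivity)]; congr 1; ring
      have e2 : (g t - g s) ^ (1 / p) ≤ W ^ (1 / p) := by gcongr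
      have e3 : 0 ≤ (g t - g s) ^ (2 / p) := by positivity
      rw [e1]
      nlinarith
    have hle : K₁ * ((g t - g s) ^ (2 / p) + (g t - g s) ^ (3 / p)) ≤
        (2 * K + K₂ + K₁ * (1 + W ^ (1 / p))) * (g t - g s) ^ (2 / p) := by
      have e3 : 0 ≤ (2 * K + K₂) * (g t - g s) ^ (2 / p) := by positivity
      nlinarith
    refine LpBound.mono ?_ hle
    refine LpBound.of_forall_pos (by positivity) fun η hη => ?_
    obtain ⟨P, hP⟩ := happrox hs hst ht hη
    have b1 := (H₁ P.seq P.seq_mono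
      (fun i => ⟨hs.trans (P.seq_mem i).1, (P.seq_mem i).2.trans ht⟩) 0 P.n zero_le).1
    rw [hrem, (hseq0 P).1, (hseq0 P).2] at b1
    have b := hP.add ha1 b1
    rw [sub_add_sub_cancel] at b
    exact b.mono (by linarith)

end IsSewable

end SewingLimit

end RoughIto

namespace RoughIto

/-! ### Controls -/

section Control

/-- Any partition of [r, s] can be extended by the single interval [s, t]. This superadditivity
makes the running variation a control. -/
theorem pVarPow_add_rpow_le (p : ℝ) (N : ℝ → ℝ → ℝ≥0∞) {r s t : ℝ} (hrs : r ≤ s) (hst : s < t) :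
    pVarPow p N r s + N s t ^ p ≤ pVarPow p N r t := by
  have : Nonempty (TimePartition r s) := by
    rcases hrs.eq_or_lt with rfl | h
    · exact ⟨TimePartition.trivial r⟩
    · exact ⟨TimePartition.single h⟩
  rw [pVarPow, ENNReal.iSup_add]
  refine iSup_le fun P => ?_
  refine le_trans (le_of_eq ?_) (le_iSup _ (P.append (TimePartition.single hst)))
  rw [TimePartition.sum_append, TimePartition.sum_single]

theorem pVarPow_mono (p : ℝ) (N : ℝ → ℝ → ℝ≥0∞) {r s t : ℝ} (hrs : r ≤ s) (hst : s ≤ t) :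
    pVarPow p N r s ≤ pVarPow p N r t := by
  rcases hst.eq_or_lt with rfl | h
  · exact le_rfl
  · exact le_self_add.trans (pVarPow_add_rpow_le p N hrs h)

/-- A family of sizes of finite `p`-variation is controlled by a Stieltjes function. -/
theorem exists_control {p T : ℝ} (hp : 0 < p) (hT : 0 ≤ T) {N : ℝ → ℝ → ℝ≥0∞}
    (hN : pVar p N 0 T < ∞) : ∃ g : StieltjesFunction ℝ, ∀ s s' t, 0 ≤ s → s < s' → s' < t →
      t ≤ T → N s' t ≤ ENNReal.ofReal ((g t - g s) ^ (1 / p)) := by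
  have hfin : pVarPow p N 0 T ≠ ∞ := fun h => by simp [pVar, h, hp] at hN
  have hclamp : ∀ t : ℝ, 0 ≤ max 0 (min t T) ∧ max 0 (min t T) ≤ T := fun t =>
    ⟨le_max_left _ _, max_le hT (min_le_right _ _)⟩
  have hfin' : ∀ t, 0 ≤ t → t ≤ T → pVarPow p N 0 t ≠ ∞ := fun t h0 h1 =>
    ((pVarPow_mono p N h0 h1).trans_lt hfin.lt_top).ne
  set G : ℝ → ℝ := fun t => (pVarPow p N 0 (max 0 (min t T))).toReal with hG
  have hmono : Monotone G := fun s t hst => by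
    refine ENNReal.toReal_mono (hfin' _ (hclamp t).1 (hclamp t).2)
      (pVarPow_mono p N (hclamp s).1 ?_)
    gcongr
  refine ⟨hmono.stieltjesFunction, fun s s' t hs hss' hst ht => ?_⟩
  have e : ∀ u, 0 ≤ u → u ≤ T → max 0 (min u T) = u := fun u h0 h1 => by simp [h0, h1]
  have h1 : G s' + (N s' t ^ p).toReal ≤ G t ∧ N s' t ^ p ≠ ∞ := by
    have h := pVarPow_add_rpow_le p N (hs.trans hss'.le) hst
    have hf := hfin' t (by linarith) ht
    have h3 : N s' t ^ p ≠ ∞ := ((le_add_self.trans h).trans_lt hf.lt_top).ne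
    refine ⟨?_, h3⟩
    rw [hG]
    simp only
    rw [e s' (by linarith) (by linarith), e t (by linarith) ht,
      ← ENNReal.toReal_add (hfin' s' (by linarith) (by linarith)) h3]
    exact ENNReal.toReal_mono hf h
  -- The running variation G need not be right-continuous, and its right limit at s is bounded by G
  -- only at later times. This is why the conclusion compares N s' t with the increment from an
  -- earlier s; right-continuity of the processes removes the gap afterwards.
  have h2 : hmono.stieltjesFunction s ≤ G s' := hmono.rightLim_le hss'
  have h3 : G t ≤ hmono.stieltjesFunction t := hmono.le_rightLim le_rfl
  have h4 : N s' t ^ p ≤ ENNReal.ofReal (hmono.stieltjesFunction t - hmono.stieltjesFunction s) := by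
    rw [← ENNReal.ofReal_toReal h1.2]
    exact ENNReal.ofReal_le_ofReal (by linarith)
  have h5 := ENNReal.rpow_le_rpow h4 (z := 1 / p) (by positivity)
  rwa [← ENNReal.rpow_mul, mul_one_div_cancel hp.ne', ENNReal.rpow_one,
    ENNReal.ofReal_rpow_of_nonneg (sub_nonneg.2 (hmono.stieltjesFunction.mono
      (hss'.trans hst).le)) (by positivity)] at h5

end Control

/-! ### Mixed norms -/

section CondNorm

variable {Ω : Type*} {m m0 : MeasurableSpace Ω} {μ : Measure Ω}
variable {G : Type*} [NormedAddCommGroup G]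

theorem memLp_of_condNorm_le {q : ℝ} {r : ℝ≥0∞} {Z : Ω → G} {c : ℝ}
    (h : condNorm μ m q r Z ≤ ENNReal.ofReal c) : MemLp Z (ENNReal.ofReal q) μ := by
  by_contra hZ
  rw [condNorm, if_neg hZ] at h
  exact absurd h (by simp)

variable [IsProbabilityMeasure μ]

/-- The measures with densities f and its conditional expectation agree on m, hence integrate
m-measurable weights equally. No integrability of the weight ξ is required, and it may take the
value ∞. -/
theorem lintegral_mul_ofReal_condExp (hm : m ≤ m0) {f : Ω → ℝ} (hf : Integrable f μ) (hf0 : 0 ≤ f)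
    {ξ : Ω → ℝ≥0∞} (hξ : Measurable[m] ξ) :
    ∫⁻ ω, ξ ω * ENNReal.ofReal (μ[f | m] ω) ∂μ = ∫⁻ ω, ξ ω * ENNReal.ofReal (f ω) ∂μ := by
  have h1 : ∀ s, MeasurableSet[m] s →
      ∫⁻ ω in s, ENNReal.ofReal (μ[f | m] ω) ∂μ = ∫⁻ ω in s, ENNReal.ofReal (f ω) ∂μ := by
    intro s hs
    rw [← ofReal_integral_eq_lintegral_ofReal integrable_condExp.integrableOn
      (ae_restrict_of_ae (condExp_nonneg (.of_forall hf0))),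
      ← ofReal_integral_eq_lintegral_ofReal hf.integrableOn (.of_forall hf0),
      setIntegral_condExp hm hf hs]
  have h2 : (μ.withDensity fun ω => ENNReal.ofReal (μ[f | m] ω)).trim hm =
      (μ.withDensity fun ω => ENNReal.ofReal (f ω)).trim hm := by
    refine @Measure.ext _ m _ _ fun s hs => ?_
    rw [trim_measurableSet_eq hm hs, trim_measurableSet_eq hm hs, withDensity_apply _ (hm s hs),
      withDensity_apply _ (hm s hs), h1 s hs]
  have h3 : ∀ k : Ω → ℝ, AEMeasurable k μ → ∫⁻ ω, ξ ω * ENNReal.ofReal (k ω) ∂μ =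
      ∫⁻ ω, ξ ω ∂(μ.withDensity fun ω => ENNReal.ofReal (k ω)).trim hm := by
    intro k hk
    rw [lintegral_trim hm hξ, lintegral_withDensity_eq_lintegral_mul₀ hk.ennreal_ofReal
      (hξ.mono hm le_rfl).aemeasurable]
    exact lintegral_congr fun ω => mul_comm _ _
  rw [h3 _ integrable_condExp.aestronglyMeasurable.aemeasurable,
    h3 _ hf.aestronglyMeasurable.aemeasurable, h2]

/-- Weighted squares of random variables with a bound in a mixed norm. -/
theorem lpBound_mul_sq_of_condNorm_le (hm : m ≤ m0) {a : ℝ} (ha : 1 ≤ a) {r : ℝ≥0∞} (hr : 2 ≤ r)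
    {Z : Ω → G} {c : ℝ} (hc : 0 ≤ c) (h : condNorm μ m (2 * a) r Z ≤ ENNReal.ofReal c)
    {ζ : Ω → ℝ} (hζ : StronglyMeasurable[m] ζ) {d : ℝ} (hd : LpBound μ (2 * a) ζ d) :
    LpBound μ a (fun ω => ζ ω * ‖Z ω‖ ^ 2) (d * c ^ 2) := by
  have hZ := memLp_of_condNorm_le h
  have ha0 : 0 < a := by linarith
  have hq0 : ENNReal.ofReal (2 * a) ≠ 0 := by simp; linarith
  have hqr : (ENNReal.ofReal (2 * a)).toReal = 2 * a := ENNReal.toReal_ofReal (by linarith)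
  have har : (ENNReal.ofReal a).toReal = a := ENNReal.toReal_ofReal ha0.le
  have hint : Integrable (fun ω => ‖Z ω‖ ^ (2 * a)) μ := by
    have := hZ.integrable_norm_rpow hq0 ENNReal.ofReal_ne_top
    rwa [hqr] at this
  set f : Ω → ℝ := fun ω => ‖Z ω‖ ^ (2 * a) with hf
  have hf0 : 0 ≤ f := fun ω => by simp only [hf, Pi.zero_apply]; positivity
  rw [condNorm, if_pos hZ] at h
  -- Here r ≥ 2 enters: on a probability space the L^r norm of the conditional moment controls its
  -- L^2 norm.
  have hW : eLpNorm (μ[f | m]) 2 μ ≤ ENNReal.ofReal c ^ (2 * a) := by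
    have h1 := ENNReal.rpow_le_rpow h (z := 2 * a) (by linarith)
    rw [← ENNReal.rpow_mul, one_div_mul_cancel (by linarith), ENNReal.rpow_one] at h1
    exact (eLpNorm_le_eLpNorm_of_exponent_le hr
      integrable_condExp.aestronglyMeasurable).trans h1
  have hWn : (∫⁻ ω, ENNReal.ofReal (μ[f | m] ω) ^ (2 : ℝ) ∂μ) ^ (1 / (2 : ℝ)) ≤
      ENNReal.ofReal c ^ (2 * a) := by
    refine le_trans ?_ hW
    rw [eLpNorm_eq_lintegral_rpow_enorm_toReal (by simp) (by simp), ENNReal.toReal_ofNat]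
    gcongr
    rw [← ofReal_norm]
    exact ENNReal.ofReal_le_ofReal (le_abs_self _)
  have hζn : (∫⁻ ω, (‖ζ ω‖ₑ ^ a) ^ (2 : ℝ) ∂μ) ^ (1 / (2 : ℝ)) ≤ ENNReal.ofReal d ^ a := by
    have h1 := hd.le
    rw [eLpNorm_eq_lintegral_rpow_enorm_toReal hq0 ENNReal.ofReal_ne_top, hqr] at h1
    have h2 := ENNReal.rpow_le_rpow h1 (z := a) ha0.le
    rw [← ENNReal.rpow_mul, show 1 / (2 * a) * a = 1 / 2 by field_simp] at h2
    refine le_trans (le_of_eq ?_) h2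
    congr 1
    refine lintegral_congr fun ω => ?_
    rw [← ENNReal.rpow_mul, mul_comm]
  have hmeasζ : Measurable[m] fun ω => ‖ζ ω‖ₑ ^ a := hζ.enorm.pow_const a
  -- Replace |Z|^{2a} by its conditional expectation, which is allowed since ζ is m-measurable, and
  -- apply the Cauchy–Schwarz inequality. Only 2a moments of ζ and of Z itself are used.
  have key : ∫⁻ ω, ‖ζ ω * ‖Z ω‖ ^ 2‖ₑ ^ a ∂μ ≤ ENNReal.ofReal (d * c ^ 2) ^ a := by
    calc ∫⁻ ω, ‖ζ ω * ‖Z ω‖ ^ 2‖ₑ ^ a ∂μ = ∫⁻ ω, ‖ζ ω‖ₑ ^ a * ENNReal.ofReal (f ω) ∂μ := by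
          refine lintegral_congr fun ω => ?_
          rw [enorm_mul, ENNReal.mul_rpow_of_nonneg _ _ ha0.le, hf]
          simp only
          rw [← ENNReal.ofReal_rpow_of_nonneg (norm_nonneg _) (by linarith), ofReal_norm,
            enorm_pow, enorm_norm, ← ENNReal.rpow_natCast, ← ENNReal.rpow_mul]
          norm_num
      _ = ∫⁻ ω, ‖ζ ω‖ₑ ^ a * ENNReal.ofReal (μ[f | m] ω) ∂μ :=
          (lintegral_mul_ofReal_condExp hm hint hf0 hmeasζ).symm
      _ ≤ (∫⁻ ω, (‖ζ ω‖ₑ ^ a) ^ (2 : ℝ) ∂μ) ^ (1 / (2 : ℝ)) *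
          (∫⁻ ω, ENNReal.ofReal (μ[f | m] ω) ^ (2 : ℝ) ∂μ) ^ (1 / (2 : ℝ)) :=
          ENNReal.lintegral_mul_le_Lp_mul_Lq μ (by constructor <;> norm_num)
            (hmeasζ.mono hm le_rfl).aemeasurable
            integrable_condExp.aestronglyMeasurable.aemeasurable.ennreal_ofReal
      _ ≤ ENNReal.ofReal d ^ a * ENNReal.ofReal c ^ (2 * a) := mul_le_mul' hζn hWn
      _ = ENNReal.ofReal (d * c ^ 2) ^ a := by
          rw [ENNReal.ofReal_mul hd.nonneg, ENNReal.mul_rpow_of_nonneg _ _ ha0.le,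
            ENNReal.ofReal_pow hc, ENNReal.rpow_mul]
          norm_num
  refine ⟨hd.meas.mul (hZ.1.norm.pow 2), mul_nonneg hd.nonneg (by positivity), ?_⟩
  rw [eLpNorm_eq_lintegral_rpow_enorm_toReal (by simpa using ha0) (by simp), har]
  have := ENNReal.rpow_le_rpow key (z := 1 / a) (by positivity)
  rwa [← ENNReal.rpow_mul, mul_one_div_cancel ha0.ne', ENNReal.rpow_one] at this

/-- The weight ζ = 1 in the previous lemma bounds ‖Z‖² in L^a. -/
theorem lpBound_of_condNorm_le (hm : m ≤ m0) {a : ℝ} (ha : 1 ≤ a) {r : ℝ≥0∞} (hr : 2 ≤ r)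
    {Z : Ω → G} {c : ℝ} (hc : 0 ≤ c) (h : condNorm μ m (2 * a) r Z ≤ ENNReal.ofReal c) :
    LpBound μ (2 * a) Z c := by
  have hZ := memLp_of_condNorm_le h
  have h1 := lpBound_mul_sq_of_condNorm_le hm ha hr hc h (ζ := fun _ => 1)
    stronglyMeasurable_const (LpBound.of_bound (by fun_prop) zero_le_one (by simp))
  refine ⟨hZ.1, hc, ?_⟩
  have h2 := h1.le
  simp only [one_mul] at h2
  rw [eLpNorm_eq_lintegral_rpow_enorm_toReal (by simp; linarith) ENNReal.ofReal_ne_top,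
    ENNReal.toReal_ofReal (by linarith)] at h2 ⊢
  have h3 := ENNReal.rpow_le_rpow h2 (z := 1 / 2) (by norm_num)
  rw [← ENNReal.rpow_mul, ENNReal.ofReal_pow hc, ← ENNReal.rpow_natCast, ← ENNReal.rpow_mul] at h3
  norm_num at h3
  refine le_trans (le_of_eq ?_) h3
  rw [show a⁻¹ * (1 / 2) = 1 / (2 * a) by field_simp]
  congr 1
  refine lintegral_congr fun ω => ?_
  rw [ENNReal.rpow_mul]
  norm_num

end CondNorm

end RoughIto

namespace RoughIto

/-! ### Removing the gap in the control by right-continuity -/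

section ControlledBounds

variable {Ω : Type*} {m0 : MeasurableSpace Ω} {μ : Measure Ω}
variable {V E G : Type*} [NormedAddCommGroup V] [NormedSpace ℝ V] [FiniteDimensional ℝ V]
  [NormedAddCommGroup E] [NormedSpace ℝ E] [FiniteDimensional ℝ E]

/-- The quantitative information on a controlled path used below, with all regularity expressed
by the control `g` and with `q = 2 * a`. -/
structure ControlledBounds (μ : Measure Ω) (ℱ : Filtration ℝ m0) (T a p M : ℝ)
    (g : StieltjesFunction ℝ) (X : ℝ → V) (XX : ℝ → ℝ → V ⊗[ℝ] V) (Y : ℝ → Ω → E)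
    (Y' : ℝ → Ω → V →L[ℝ] E) : Prop where
  X_le : ∀ s t, 0 ≤ s → s ≤ t → t ≤ T → ‖X t - X s‖ ≤ (g t - g s) ^ (1 / p)
  XX_le : ∀ s t, 0 ≤ s → s ≤ t → t ≤ T → ‖XX s t‖ ≤ (g t - g s) ^ (2 / p)
  chen : ∀ s u t : ℝ, 0 ≤ s → s ≤ u → u ≤ t → t ≤ T →
    XX s t = XX s u + XX u t + (X u - X s) ⊗ₜ[ℝ] (X t - X u)
  adapted : IsAdaptedOn ℱ T Y
  adapted' : IsAdaptedOn ℱ T Y'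
  Y_memLp : ∀ t, 0 ≤ t → t ≤ T → MemLp (Y t) (ENNReal.ofReal (2 * a)) μ
  Y_le : ∀ s t, 0 ≤ s → s ≤ t → t ≤ T → LpBound μ (2 * a) (Y t - Y s) ((g t - g s) ^ (1 / p))
  Y'_le : ∀ s t, 0 ≤ s → s ≤ t → t ≤ T → LpBound μ (2 * a) (Y' t - Y' s) ((g t - g s) ^ (1 / p))
  Y_sq : ∀ s t, 0 ≤ s → s ≤ t → t ≤ T → ∀ (ζ : Ω → ℝ) (d : ℝ), StronglyMeasurable[ℱ s] ζ →
    LpBound μ (2 * a) ζ d →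
    LpBound μ a (fun ω => ζ ω * ‖(Y t - Y s) ω‖ ^ 2) (d * (g t - g s) ^ (2 / p))
  Y'_bound : ∀ s, 0 ≤ s → s ≤ T → LpBound μ (2 * (2 * a)) (Y' s) M
  R_le : ∀ s t, 0 ≤ s → s ≤ t → t ≤ T →
    LpBound μ (2 * (2 * a)) (μ[remainder X Y Y' s t | ℱ s]) ((g t - g s) ^ (2 / p))

theorem tendsto_stieltjes_sub_rpow (g : StieltjesFunction ℝ) (s : ℝ) {e : ℝ} (he : 0 < e) :
    Tendsto (fun s' => (g s' - g s) ^ e) (𝓝[>] s) (𝓝 0) := by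
  have h1 : Tendsto (fun s' => g s' - g s) (𝓝[>] s) (𝓝 0) := by
    have h := (g.right_continuous s).mono_left (nhdsWithin_mono _ Ioi_subset_Ici_self)
    simpa using h.sub_const (g s)
  have := (Real.continuousAt_rpow_const 0 e (Or.inr he.le)).tendsto.comp h1
  rwa [Real.zero_rpow he.ne'] at this

/-- A process which is right-continuous in probability converges almost surely along a sequence. -/
theorem IsRightContInProb.exists_seq [NormedAddCommGroup G] {T : ℝ} {Z : ℝ → Ω → G}
    (h : IsRightContInProb μ T Z) {s t : ℝ} (hs : 0 ≤ s) (hst : s < t) (ht : t ≤ T) :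
    ∃ w : ℕ → ℝ, (∀ n, w n ∈ Ioo s t) ∧ Tendsto w atTop (𝓝[>] s) ∧
      ∀ᵐ ω ∂μ, Tendsto (fun n => Z (w n) ω) atTop (𝓝 (Z s ω)) := by
  obtain ⟨w, hw, hw'⟩ := (h s ⟨hs, hst.trans_le ht⟩).exists_seq_tendsto_ae'
  obtain ⟨N, hN⟩ := eventually_atTop.1 (hw.eventually (Ioo_mem_nhdsGT hst))
  refine ⟨fun n => w (n + N), fun n => hN _ (by omega), hw.comp (tendsto_add_atTop_nat N), ?_⟩
  filter_upwards [hw'] with ω hω using hω.comp (tendsto_add_atTop_nat N)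

variable [IsProbabilityMeasure μ] [NormedAddCommGroup G]

/-- The control bounds increments only from times s' > s. A sequence of such times decreasing to s
along which Z converges almost surely, combined with Fatou's lemma, gives the bound at s itself; a
weight known at s is also known at s'. -/
theorem InVpLqr.lpBound_sq {ℱ : Filtration ℝ m0} {T a p : ℝ} (ha : 1 ≤ a) {r : ℝ≥0∞}
    (hr : 2 ≤ r) {Z : ℝ → Ω → G} (h : IsRightContInProb μ T Z)
    (hm : ∀ t ∈ Icc 0 T, AEStronglyMeasurable (Z t) μ) {g : StieltjesFunction ℝ}
    (hg : ∀ s s' t, 0 ≤ s → s < s' → s' < t → t ≤ T →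
      condNorm μ (ℱ s') (2 * a) r (Z t - Z s') ≤ ENNReal.ofReal ((g t - g s) ^ (1 / p)))
    (s t : ℝ) (hs : 0 ≤ s) (hst : s ≤ t) (ht : t ≤ T) (ζ : Ω → ℝ) (d : ℝ)
    (hζ : StronglyMeasurable[ℱ s] ζ) (hd : LpBound μ (2 * a) ζ d) :
    LpBound μ a (fun ω => ζ ω * ‖(Z t - Z s) ω‖ ^ 2) (d * (g t - g s) ^ (2 / p)) := by
  have hgp : ∀ {s}, s ≤ t → 0 ≤ g t - g s := fun h => sub_nonneg.2 (g.mono h)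
  rcases hst.eq_or_lt with rfl | hst'
  · have := LpBound.zero (μ := μ) (a := a) (G := ℝ) (mul_nonneg hd.nonneg
      (Real.rpow_nonneg (hgp le_rfl) (2 / p)))
    convert this using 1
    ext ω; simp
  obtain ⟨w, hw, hws, hwt⟩ := h.exists_seq hs hst' ht
  have hb : ∀ n, LpBound μ a (fun ω => ζ ω * ‖(Z t - Z (w n)) ω‖ ^ 2)
      (d * (g t - g s) ^ (2 / p)) := by
    intro n
    have := lpBound_mul_sq_of_condNorm_le (ℱ.le (w n)) ha hr (Real.rpow_nonneg (hgp hst) _)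
      (hg s (w n) t hs (hw n).1 (hw n).2 ht) (hζ.mono (ℱ.mono (hw n).1.le)) hd
    rwa [← Real.rpow_mul_natCast (hgp hst), show 1 / p * (2 : ℕ) = 2 / p by push_cast; ring] at this
  refine ⟨hd.meas.mul (((hm t ⟨hs.trans hst, ht⟩).sub (hm s ⟨hs, hst.trans ht⟩)).norm.pow 2),
    (hb 0).nonneg, ?_⟩
  refine Lp.eLpNorm_le_of_ae_tendsto (u := atTop) (.of_forall fun n => (hb n).le)
      (fun n => (hb n).meas) ?_
  filter_upwards [hwt] with ω hω
  exact ((hω.const_sub _).norm.pow 2).const_mul _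

theorem InVpLqr.lpBound {ℱ : Filtration ℝ m0} {T a p : ℝ} (ha : 1 ≤ a) {r : ℝ≥0∞}
    (hr : 2 ≤ r) {Z : ℝ → Ω → G} (h : IsRightContInProb μ T Z) {g : StieltjesFunction ℝ}
    (hg : ∀ s s' t, 0 ≤ s → s < s' → s' < t → t ≤ T →
      condNorm μ (ℱ s') (2 * a) r (Z t - Z s') ≤ ENNReal.ofReal ((g t - g s) ^ (1 / p)))
    (s t : ℝ) (hs : 0 ≤ s) (hst : s ≤ t) (ht : t ≤ T) :
    LpBound μ (2 * a) (Z t - Z s) ((g t - g s) ^ (1 / p)) := by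
  have hgp : 0 ≤ g t - g s := sub_nonneg.2 (g.mono hst)
  rcases hst.eq_or_lt with rfl | hst'
  · rw [sub_self]
    exact LpBound.zero (Real.rpow_nonneg hgp _)
  obtain ⟨w, hw, hws, hwt⟩ := h.exists_seq hs hst' ht
  have hb : ∀ n, LpBound μ (2 * a) (Z t - Z (w n)) ((g t - g s) ^ (1 / p)) := fun n =>
    lpBound_of_condNorm_le (ℱ.le (w n)) ha hr (Real.rpow_nonneg hgp _)
      (hg s (w n) t hs (hw n).1 (hw n).2 ht)
  have hlim : ∀ᵐ ω ∂μ, Tendsto (fun n => (Z t - Z (w n)) ω) atTop (𝓝 ((Z t - Z s) ω)) := by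
    filter_upwards [hwt] with ω hω using hω.const_sub _
  exact ⟨aestronglyMeasurable_of_tendsto_ae atTop (fun n => (hb n).meas) hlim, (hb 0).nonneg,
    Lp.eLpNorm_le_of_ae_tendsto (u := atTop) (.of_forall fun n => (hb n).le)
      (fun n => (hb n).meas) hlim⟩

end ControlledBounds

/-! ### One control for all the data -/

section ExistsBounds

variable {Ω : Type*} {m0 : MeasurableSpace Ω} {μ : Measure Ω} [IsProbabilityMeasure μ]
variable {V E : Type*} [NormedAddCommGroup V] [NormedSpace ℝ V] [FiniteDimensional ℝ V]
  [NormedAddCommGroup E] [NormedSpace ℝ E] [FiniteDimensional ℝ E]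

theorem norm_le_of_control {U : Type*} [NormedAddCommGroup U] {T p : ℝ} {x : ℝ → ℝ → U}
    {g : StieltjesFunction ℝ} (hg : ∀ s s' t, 0 ≤ s → s < s' → s' < t → t ≤ T →
      ‖x s' t‖ₑ ≤ ENNReal.ofReal ((g t - g s) ^ (1 / p)))
    {s t : ℝ} (hs : 0 ≤ s) (hst : s < t) (ht : t ≤ T)
    (hx : Tendsto (fun s' => x s' t) (𝓝[>] s) (𝓝 (x s t))) :
    ‖x s t‖ ≤ (g t - g s) ^ (1 / p) := by
  have hgp : 0 ≤ (g t - g s) ^ (1 / p) := Real.rpow_nonneg (sub_nonneg.2 (g.mono hst.le)) _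
  refine le_of_tendsto hx.norm ?_
  filter_upwards [Ioo_mem_nhdsGT hst] with s' hs'
  have := hg s s' t hs hs'.1 hs'.2 ht
  rwa [← ofReal_norm, ENNReal.ofReal_le_ofReal_iff hgp] at this

/-- The five controls of X, 𝕏, Y, Y' and the conditional remainder are added. Each bound is then
pushed to the left endpoint by right-continuity; for the remainder this is done after conditioning
on the fixed σ-algebra ℱ_s. -/
theorem exists_controlledBounds {T : ℝ} (hT : 0 ≤ T) {ℱ : Filtration ℝ m0} {p a : ℝ} {r : ℝ≥0∞}
    (hp : 2 ≤ p) (ha : 2 ≤ a) (hr : 2 ≤ r) {X : ℝ → V} {XX : ℝ → ℝ → V ⊗[ℝ] V}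
    (hX : IsRoughPath T p X XX) {Y : ℝ → Ω → E} {Y' : ℝ → Ω → V →L[ℝ] E}
    (hY : IsControlledPath μ ℱ T p (2 * a) r X Y Y') :
    ∃ (g : StieltjesFunction ℝ) (M : ℝ), ControlledBounds μ ℱ T a p M g X XX Y Y' := by
  have hp0 : 0 < p := by linarith
  have ha1 : 1 ≤ a := by linarith
  obtain ⟨g₁, h₁⟩ := exists_control hp0 hT hX.pVar_lt
  obtain ⟨g₂, h₂⟩ := exists_control (by linarith) hT hX.pVar_lt'
  obtain ⟨g₃, h₃⟩ := exists_control hp0 hT hY.inVpLqr.pVar_lt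
  obtain ⟨g₄, h₄⟩ := exists_control hp0 hT hY.inVpLqr'.pVar_lt
  obtain ⟨g₅, h₅⟩ := exists_control (by linarith) hT hY.remainder_lt
  set g := g₁ + g₂ + g₃ + g₄ + g₅ with hg
  have hle : ∀ {s t : ℝ}, s ≤ t → (g₁ t - g₁ s ≤ g t - g s) ∧ (g₂ t - g₂ s ≤ g t - g s) ∧
      (g₃ t - g₃ s ≤ g t - g s) ∧ (g₄ t - g₄ s ≤ g t - g s) ∧ (g₅ t - g₅ s ≤ g t - g s) := by
    intro s t hst
    have := g₁.mono hst
    have := g₂.mono hst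
    have := g₃.mono hst
    have := g₄.mono hst
    have := g₅.mono hst
    simp only [hg, StieltjesFunction.add_apply]
    refine ⟨?_, ?_, ?_, ?_, ?_⟩ <;> linarith
  have hmon : ∀ (k : StieltjesFunction ℝ) {s t e : ℝ}, s ≤ t → 0 ≤ e → k t - k s ≤ g t - g s →
      (k t - k s) ^ e ≤ (g t - g s) ^ e := fun k s t e hst he h =>
    Real.rpow_le_rpow (sub_nonneg.2 (k.mono hst)) h he
  have hgn : ∀ {s t e : ℝ}, s ≤ t → 0 ≤ (g t - g s) ^ e := fun h =>
    Real.rpow_nonneg (sub_nonneg.2 (g.mono h)) _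
  have hpp : 1 / (p / 2) = 2 / p := by field_simp
  have he1 : 0 ≤ 1 / p := by positivity
  have he2 : 0 ≤ 2 / p := by positivity
  have hXX0 : ∀ s, 0 ≤ s → s ≤ T → XX s s = 0 := fun s hs hsT => by
    have := hX.chen s s s hs le_rfl le_rfl hsT
    simpa using this
  have Xle : ∀ s t, 0 ≤ s → s ≤ t → t ≤ T → ‖X t - X s‖ ≤ (g t - g s) ^ (1 / p) := by
    intro s t hs hst ht
    rcases hst.eq_or_lt with rfl | hst'
    · rw [sub_self, norm_zero]
      exact hgn le_rfl
    · exact (norm_le_of_control (x := fun s t => X t - X s) h₁ hs hst' ht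
        ((hX.cadlag.1 s ⟨hs, hst'.trans_le ht⟩).const_sub _)).trans (hmon g₁ hst he1 (hle hst).1)
  have hmY : ∀ t ∈ Icc 0 T, AEStronglyMeasurable (Y t) μ := hY.inVpLqr.meas
  have Yle : ∀ s t, 0 ≤ s → s ≤ t → t ≤ T →
      LpBound μ (2 * a) (Y t - Y s) ((g t - g s) ^ (1 / p)) := fun s t hs hst ht =>
    (InVpLqr.lpBound ha1 hr hY.inVpLqr.rightCont h₃ s t hs hst ht).mono
      (hmon g₃ hst he1 (hle hst).2.2.1)
  have Yle' : ∀ s t, 0 ≤ s → s ≤ t → t ≤ T →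
      LpBound μ (2 * a) (Y' t - Y' s) ((g t - g s) ^ (1 / p)) := fun s t hs hst ht =>
    (InVpLqr.lpBound ha1 hr hY.inVpLqr'.rightCont h₄ s t hs hst ht).mono
      (hmon g₄ hst he1 (hle hst).2.2.2.1)
  -- Since r ≥ 2, the L^{qr} bounds on Y' and on the conditional remainder are at least L^{4a}
  -- bounds.
  have hexp : ENNReal.ofReal (2 * (2 * a)) ≤ ENNReal.ofReal (2 * a) * r := by
    rw [ENNReal.ofReal_mul (by norm_num), mul_comm]
    gcongr
    simpa using hr
  set M := (⨆ s ∈ Icc 0 T, eLpNorm (Y' s) (ENNReal.ofReal (2 * a) * r) μ).toReal with hM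
  have Ybd' : ∀ s, 0 ≤ s → s ≤ T → LpBound μ (2 * (2 * a)) (Y' s) M := by
    intro s hs hsT
    have hm := hY.inVpLqr'.meas s ⟨hs, hsT⟩
    refine ⟨hm, ENNReal.toReal_nonneg, (eLpNorm_le_eLpNorm_of_exponent_le hexp hm).trans ?_⟩
    rw [hM, ENNReal.ofReal_toReal hY.bounded'.ne]
    exact le_iSup₂ (f := fun s (_ : s ∈ Icc 0 T) =>
      eLpNorm (Y' s) (ENNReal.ofReal (2 * a) * r) μ) s ⟨hs, hsT⟩
  have Ymem : ∀ t, 0 ≤ t → t ≤ T → MemLp (Y t) (ENNReal.ofReal (2 * a)) μ := by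
    intro t ht htT
    have := (Yle 0 t le_rfl ht htT).memLp.add hY.inVpLqr.init
    rwa [sub_add_cancel] at this
  refine ⟨g, M, Xle, fun s t hs hst ht => ?_, hX.chen, hY.adapted, hY.adapted', Ymem, Yle, Yle',
    fun s t hs hst ht ζ d hζ hd => ?_, Ybd', fun s t hs hst ht => ?_⟩
  · rcases hst.eq_or_lt with rfl | hst'
    · rw [hXX0 s hs ht, norm_zero]
      exact hgn le_rfl
    · have := norm_le_of_control (x := XX) h₂ hs hst' ht
        ((hX.cadlag_left t ⟨hs.trans hst, ht⟩).1 s ⟨hs, hst'⟩)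
      rw [hpp] at this
      exact this.trans (hmon g₂ hst he2 (hle hst).2.1)
  · exact (InVpLqr.lpBound_sq ha1 hr hY.inVpLqr.rightCont hmY h₃ s t hs hst ht ζ d hζ hd).mono
      (mul_le_mul_of_nonneg_left (hmon g₃ hst he2 (hle hst).2.2.1) hd.nonneg)
  · rcases hst.eq_or_lt with rfl | hst'
    · have : remainder X Y Y' s s = 0 := by ext ω; simp [remainder]
      rw [this, condExp_zero]
      exact LpBound.zero (hgn le_rfl)
    have hc2 : (2 : ℝ) * (2 * a) ≥ 1 := by linarith
    have ha2 : 1 ≤ 2 * a := by linarith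
    have hRi : ∀ s', 0 ≤ s' → s' ≤ t → LpBound μ (2 * a) (remainder X Y Y' s' t)
        ((g t - g s') ^ (1 / p) + ‖X t - X s'‖ * M) := by
      intro s' hs' hst'
      refine (Yle s' t hs' hst' ht).sub ha2 ?_
      refine ((Ybd' s' hs' (hst'.trans ht)).exponent_mono (by linarith)).of_norm_le_mul
        (((ContinuousLinearMap.apply ℝ E (X t - X s')).continuous.comp_aestronglyMeasurable
          (Ybd' s' hs' (hst'.trans ht)).meas)) (norm_nonneg _) (.of_forall fun ω => ?_)
      rw [mul_comm]
      exact (Y' s' ω).le_opNorm _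
    -- R_{s,t} - R_{s',t} = δY_{s,s'} + δY'_{s,s'} δX_{s',t} - Y'_s δX_{s,s'}, and every term tends
    -- to zero as s' decreases to s.
    have hdiff : ∀ s' ∈ Ioo s t, LpBound μ (2 * a)
        (remainder X Y Y' s t - remainder X Y Y' s' t) ((g s' - g s) ^ (1 / p) +
          ((g s' - g s) ^ (1 / p) * ‖X t - X s'‖ + (g s' - g s) ^ (1 / p) * M)) := by
      intro s' hs'
      have b1 := Yle s s' hs hs'.1.le (hs'.2.le.trans ht)
      have b2 : LpBound μ (2 * a) (fun ω => (Y' s' - Y' s) ω (X t - X s'))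
          ((g s' - g s) ^ (1 / p) * ‖X t - X s'‖) := by
        have b := Yle' s s' hs hs'.1.le (hs'.2.le.trans ht)
        rw [mul_comm (_ ^ _)]
        refine b.of_norm_le_mul (((ContinuousLinearMap.apply ℝ E
          (X t - X s')).continuous.comp_aestronglyMeasurable b.meas)) (norm_nonneg _)
          (.of_forall fun ω => ?_)
        rw [mul_comm]
        exact ((Y' s' - Y' s) ω).le_opNorm _
      have b3 : LpBound μ (2 * a) (fun ω => Y' s ω (X s' - X s)) ((g s' - g s) ^ (1 / p) * M) := by
        have b := (Ybd' s hs (hst.trans ht)).exponent_mono (b := 2 * a) (by linarith)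
        refine b.of_norm_le_mul (((ContinuousLinearMap.apply ℝ E
          (X s' - X s)).continuous.comp_aestronglyMeasurable b.meas)) (hgn hs'.1.le)
          (.of_forall fun ω => ?_)
        rw [mul_comm]
        refine ((Y' s ω).le_opNorm _).trans ?_
        gcongr
        exact Xle s s' hs hs'.1.le (hs'.2.le.trans ht)
      refine (b1.add ha2 (b2.sub ha2 b3)).congr (.of_forall fun ω => ?_)
      simp only [remainder, Pi.add_apply, Pi.sub_apply, sub_apply, map_sub]
      abel
    -- The tower property transfers the bound at ℱ_{s'} to ℱ_s. Convergence holds only in L^{2a},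
    -- but Fatou's lemma preserves the L^{4a} bound.
    have hb : ∀ᶠ s' in 𝓝[>] s, LpBound μ (2 * (2 * a)) (μ[remainder X Y Y' s' t | ℱ s])
        ((g t - g s) ^ (2 / p)) := by
      filter_upwards [Ioo_mem_nhdsGT hst'] with s' hs'
      have h := h₅ s s' t hs hs'.1 hs'.2 ht
      rw [hpp] at h
      have b : LpBound μ (2 * (2 * a)) (μ[remainder X Y Y' s' t | ℱ s']) ((g t - g s) ^ (2 / p)) :=
        ⟨integrable_condExp.aestronglyMeasurable, hgn hst,
          ((eLpNorm_le_eLpNorm_of_exponent_le hexp integrable_condExp.aestronglyMeasurable).trans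
            h).trans (ENNReal.ofReal_le_ofReal (hmon g₅ hst he2 (hle hst).2.2.2.2))⟩
      exact (b.condExp hc2 (ℱ s)).congr (condExp_condExp_of_le (ℱ.mono hs'.1.le) (ℱ.le _))
    have hlim : TendstoInMeasure μ (fun s' => μ[remainder X Y Y' s' t | ℱ s]) (𝓝[>] s)
        (μ[remainder X Y Y' s t | ℱ s]) := by
      refine LpBound.tendstoInMeasure ha2 (fun _ => integrable_condExp.aestronglyMeasurable)
        integrable_condExp.aestronglyMeasurable (c := fun s' => (g s' - g s) ^ (1 / p) +
          ((g s' - g s) ^ (1 / p) * ‖X t - X s'‖ + (g s' - g s) ^ (1 / p) * M)) ?_ ?_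
      · filter_upwards [Ioo_mem_nhdsGT hst'] with s' hs'
        have b := ((hdiff s' hs').condExp ha2 (ℱ s)).neg
        refine b.congr ?_
        have e := condExp_sub ((hRi s hs hst).integrable ha2)
          ((hRi s' (hs.trans hs'.1.le) hs'.2.le).integrable ha2) (ℱ s)
        filter_upwards [e] with ω hω
        simp [hω]
      · have t1 := tendsto_stieltjes_sub_rpow g s (e := 1 / p) (by positivity)
        have t2 := ((hX.cadlag.1 s ⟨hs, hst'.trans_le ht⟩).const_sub (X t)).norm
        have := t1.add ((t1.mul t2).add (t1.mul_const M))
        simpa using this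
    exact LpBound.of_tendstoInMeasure hb hlim

end ExistsBounds

end RoughIto

namespace RoughIto

/-! ### Tensor estimates -/

section TensorBounds

variable {U W U' W' G : Type*} [NormedAddCommGroup U] [NormedSpace ℝ U] [FiniteDimensional ℝ U]
  [NormedAddCommGroup W] [NormedSpace ℝ W] [FiniteDimensional ℝ W]
  [NormedAddCommGroup U'] [NormedSpace ℝ U'] [FiniteDimensional ℝ U']
  [NormedAddCommGroup W'] [NormedSpace ℝ W'] [FiniteDimensional ℝ W']
  [NormedAddCommGroup G] [NormedSpace ℝ G]

@[simp]
theorem contract_tmul (B : U →L[ℝ] W →L[ℝ] G) (u : U) (w : W) :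
    contract B (u ⊗ₜ[ℝ] w) = B u w := by
  simp [contract]

theorem contract_add (B C : U →L[ℝ] W →L[ℝ] G) (τ : U ⊗[ℝ] W) :
    contract (B + C) τ = contract B τ + contract C τ := by
  induction τ with
  | zero => simp
  | tmul u w => simp
  | add σ τ hσ hτ => simp only [map_add, hσ, hτ]; abel

theorem contract_smul (c : ℝ) (B : U →L[ℝ] W →L[ℝ] G) (τ : U ⊗[ℝ] W) :
    contract (c • B) τ = c • contract B τ := by
  induction τ with
  | zero => simp
  | tmul u w => simp
  | add σ τ hσ hτ => simp only [map_add, hσ, hτ, smul_add]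

/-- The tensor norm is defined by scalar forms only. A norming functional ℓ of the value reduces the
general case to the scalar form ℓ ∘ B, whose norm is at most ‖B‖. -/
theorem norm_contract_le (B : U →L[ℝ] W →L[ℝ] G) (τ : U ⊗[ℝ] W) :
    ‖contract B τ‖ ≤ ‖B‖ * ‖τ‖ := by
  obtain ⟨ℓ, hℓ, hℓ'⟩ := exists_dual_vector'' ℝ (contract B τ)
  have h : ∀ σ : U ⊗[ℝ] W, ℓ (contract B σ) =
      contract ((ContinuousLinearMap.compL ℝ W G ℝ ℓ).comp B) σ := fun σ => by
    induction σ with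
    | zero => simp
    | tmul u w => simp
    | add σ τ hσ hτ => simp only [map_add, hσ, hτ]
  have h1 : ℓ (contract B τ) = tensorDual U W τ ((ContinuousLinearMap.compL ℝ W G ℝ ℓ).comp B) :=
    h τ
  have h2 : ‖contract B τ‖ = tensorDual U W τ ((ContinuousLinearMap.compL ℝ W G ℝ ℓ).comp B) := by
    rw [← h1, hℓ']; rfl
  rw [h2]
  calc tensorDual U W τ ((ContinuousLinearMap.compL ℝ W G ℝ ℓ).comp B)
      ≤ ‖tensorDual U W τ‖ * ‖(ContinuousLinearMap.compL ℝ W G ℝ ℓ).comp B‖ :=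
        (le_abs_self _).trans ((tensorDual U W τ).le_opNorm _)
    _ ≤ ‖τ‖ * (1 * ‖B‖) := by
        refine mul_le_mul_of_nonneg_left ?_ (norm_nonneg _)
        refine ContinuousLinearMap.opNorm_le_bound _ (by positivity) fun u => ?_
        refine ((ContinuousLinearMap.opNorm_comp_le ℓ (B u))).trans ?_
        rw [mul_assoc]
        exact mul_le_mul hℓ (B.le_opNorm u) (norm_nonneg _) zero_le_one
    _ = ‖B‖ * ‖τ‖ := by ring

theorem norm_tensor_le {τ : U ⊗[ℝ] W} {c : ℝ} (hc : 0 ≤ c)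
    (h : ∀ B : U →L[ℝ] W →L[ℝ] ℝ, ‖contract B τ‖ ≤ c * ‖B‖) : ‖τ‖ ≤ c :=
  ContinuousLinearMap.opNorm_le_bound (tensorDual U W τ) hc h

theorem norm_tmul_le (u : U) (w : W) : ‖u ⊗ₜ[ℝ] w‖ ≤ ‖u‖ * ‖w‖ :=
  norm_tensor_le (by positivity) fun B => by
    rw [contract_tmul]
    exact (B.le_opNorm₂ u w).trans_eq (by ring)

theorem contract_map (B : U' →L[ℝ] W' →L[ℝ] G) (f : U →L[ℝ] U') (k : W →L[ℝ] W')
    (τ : U ⊗[ℝ] W) : contract B (TensorProduct.map f.toLinearMap k.toLinearMap τ) =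
      contract (B.bilinearComp f k) τ := by
  induction τ with
  | zero => simp
  | tmul u w => simp
  | add σ τ hσ hτ => simp only [map_add, hσ, hτ]

theorem contract_comm (B : U →L[ℝ] W →L[ℝ] G) (τ : W ⊗[ℝ] U) :
    contract B (TensorProduct.comm ℝ W U τ) = contract B.flip τ := by
  induction τ with
  | zero => simp
  | tmul u w => simp
  | add σ τ hσ hτ => simp only [map_add, hσ, hτ]

theorem norm_bilinearComp_le (B : U' →L[ℝ] W' →L[ℝ] G) (f : U →L[ℝ] U') (k : W →L[ℝ] W') :
    ‖B.bilinearComp f k‖ ≤ ‖B‖ * (‖f‖ * ‖k‖) :=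
  ContinuousLinearMap.opNorm_le_bound₂ _ (by positivity) fun u w => by
    rw [ContinuousLinearMap.bilinearComp_apply]
    refine (B.le_opNorm₂ _ _).trans ?_
    calc ‖B‖ * ‖f u‖ * ‖k w‖ ≤ ‖B‖ * (‖f‖ * ‖u‖) * (‖k‖ * ‖w‖) := by
          gcongr
          · exact f.le_opNorm u
          · exact k.le_opNorm w
      _ = _ := by ring

theorem norm_map_le (f : U →L[ℝ] U') (k : W →L[ℝ] W') (τ : U ⊗[ℝ] W) :
    ‖TensorProduct.map f.toLinearMap k.toLinearMap τ‖ ≤ ‖f‖ * ‖k‖ * ‖τ‖ :=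
  norm_tensor_le (by positivity) fun B => by
    rw [contract_map]
    refine (norm_contract_le _ _).trans ?_
    refine (mul_le_mul_of_nonneg_right (norm_bilinearComp_le B f k) (norm_nonneg _)).trans_eq ?_
    ring

theorem norm_comm_le (τ : U ⊗[ℝ] W) : ‖TensorProduct.comm ℝ U W τ‖ ≤ ‖τ‖ :=
  norm_tensor_le (norm_nonneg _) fun B => by
    rw [contract_comm]
    refine (norm_contract_le _ _).trans_eq ?_
    rw [ContinuousLinearMap.opNorm_flip, mul_comm]

theorem norm_symPart_le (τ : U ⊗[ℝ] U) : ‖symPart τ‖ ≤ ‖τ‖ := by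
  rw [symPart, norm_smul]
  have h1 := norm_add_le τ (TensorProduct.comm ℝ U U τ)
  have h2 := norm_comm_le τ
  have h3 : ‖(1 / 2 : ℝ)‖ = 1 / 2 := by norm_num
  rw [h3]
  linarith

/-- `contract` as a continuous bilinear map. -/
noncomputable def contractL (U W G : Type*) [NormedAddCommGroup U] [NormedSpace ℝ U]
    [FiniteDimensional ℝ U] [NormedAddCommGroup W] [NormedSpace ℝ W] [FiniteDimensional ℝ W]
    [NormedAddCommGroup G] [NormedSpace ℝ G] :
    (U →L[ℝ] W →L[ℝ] G) →L[ℝ] U ⊗[ℝ] W →L[ℝ] G :=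
  LinearMap.mkContinuous₂ (LinearMap.mk₂ ℝ (fun B τ => contract B τ) contract_add contract_smul
    (fun B τ σ => map_add _ _ _) (fun c B τ => map_smul _ _ _)) 1
    fun B τ => by rw [one_mul]; exact norm_contract_le B τ

@[simp]
theorem contractL_apply (B : U →L[ℝ] W →L[ℝ] G) (τ : U ⊗[ℝ] W) :
    contractL U W G B τ = contract B τ := rfl

/-- The tensor product as a continuous bilinear map. -/
noncomputable def tmulL (U W : Type*) [NormedAddCommGroup U] [NormedSpace ℝ U]
    [FiniteDimensional ℝ U] [NormedAddCommGroup W] [NormedSpace ℝ W] [FiniteDimensional ℝ W] :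
    U →L[ℝ] W →L[ℝ] U ⊗[ℝ] W :=
  LinearMap.mkContinuous₂ (TensorProduct.mk ℝ U W) 1
    fun u w => by rw [one_mul]; exact norm_tmul_le u w

@[simp]
theorem tmulL_apply (u : U) (w : W) : tmulL U W u w = u ⊗ₜ[ℝ] w := rfl

theorem norm_tmulL_le : ‖tmulL U W‖ ≤ 1 := LinearMap.mkContinuous₂_norm_le _ zero_le_one _

/-- The swap of the tensor factors as a continuous linear map. -/
noncomputable def commL (U W : Type*) [NormedAddCommGroup U] [NormedSpace ℝ U]
    [FiniteDimensional ℝ U] [NormedAddCommGroup W] [NormedSpace ℝ W] [FiniteDimensional ℝ W] :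
    U ⊗[ℝ] W →L[ℝ] W ⊗[ℝ] U :=
  LinearMap.mkContinuous (TensorProduct.comm ℝ U W).toLinearMap 1
    fun τ => by rw [one_mul]; exact norm_comm_le τ

@[simp]
theorem commL_apply (τ : U ⊗[ℝ] W) : commL U W τ = TensorProduct.comm ℝ U W τ := rfl

theorem norm_commL_le : ‖commL U W‖ ≤ 1 := LinearMap.mkContinuous_norm_le _ zero_le_one _

theorem contract_tmulL (τ : U ⊗[ℝ] W) : contract (tmulL U W) τ = τ := by
  induction τ with
  | zero => simp
  | tmul u w => simp
  | add σ τ hσ hτ => simp only [map_add, hσ, hτ]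

end TensorBounds

end RoughIto

namespace RoughIto

/-! ### Germs -/

/-- The bounds on the increments of a germ over adjacent intervals that are required for sewing. -/
structure DeltaBound {Ω G : Type*} {m0 : MeasurableSpace Ω} [NormedAddCommGroup G]
    [NormedSpace ℝ G] [CompleteSpace G] (μ : Measure Ω) (m : MeasurableSpace Ω) (a p x y : ℝ)
    (Z : Ω → G) (C : ℝ) : Prop where
  size : LpBound μ a Z (C * (x * y) ^ (1 / p))
  cond : LpBound μ a (μ[Z | m]) (C * (x ^ (1 / p) * y ^ (2 / p) + x ^ (2 / p) * y ^ (1 / p)))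

namespace DeltaBound

variable {Ω : Type*} {m m' m0 : MeasurableSpace Ω} {μ : Measure Ω} [IsProbabilityMeasure μ]
variable {G G' E : Type*} [NormedAddCommGroup G] [NormedSpace ℝ G] [FiniteDimensional ℝ G]
  [CompleteSpace G] [NormedAddCommGroup G'] [NormedSpace ℝ G'] [CompleteSpace G']
  [NormedAddCommGroup E] [NormedSpace ℝ E] [CompleteSpace E]
variable {a p x y C D : ℝ} {Z Z' : Ω → G}

theorem congr (h : DeltaBound μ m a p x y Z C) (hZ : Z =ᵐ[μ] Z') : DeltaBound μ m a p x y Z' C :=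
  ⟨h.size.congr hZ, h.cond.congr (condExp_congr_ae hZ)⟩

theorem add (ha : 1 ≤ a) (h : DeltaBound μ m a p x y Z C) (h' : DeltaBound μ m a p x y Z' D) :
    DeltaBound μ m a p x y (Z + Z') (C + D) := by
  refine ⟨(h.size.add ha h'.size).mono (by rw [add_mul]), ?_⟩
  exact ((h.cond.add ha h'.cond).mono (by rw [add_mul])).congr
    (condExp_add (h.size.integrable ha) (h'.size.integrable ha) m).symm

theorem neg (h : DeltaBound μ m a p x y Z C) : DeltaBound μ m a p x y (-Z) C :=
  ⟨h.size.neg, h.cond.neg.congr (condExp_neg _ _).symm⟩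

theorem sub (ha : 1 ≤ a) (h : DeltaBound μ m a p x y Z C) (h' : DeltaBound μ m a p x y Z' D) :
    DeltaBound μ m a p x y (Z - Z') (C + D) := by
  rw [sub_eq_add_neg]
  exact h.add ha h'.neg

theorem clm_comp_le_one (ha : 1 ≤ a) (h : DeltaBound μ m a p x y Z C) (ℓ : G →L[ℝ] G')
    (hℓ : ‖ℓ‖ ≤ 1) : DeltaBound μ m a p x y (fun ω => ℓ (Z ω)) C :=
  ⟨h.size.clm_comp_le_one ℓ hℓ, (h.cond.clm_comp_le_one ℓ hℓ).congr
    (condExp_clm_comp (h.size.integrable ha) ℓ m).symm⟩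

/-- Terms which are small enough without taking conditional expectations. -/
theorem of_lpBound (ha : 1 ≤ a) (hp : 0 < p) {w : ℝ} (hx : 0 ≤ x) (hy : 0 ≤ y) (hxw : x ≤ w)
    (hyw : y ≤ w) (hC : 0 ≤ C)
    (h : LpBound μ a Z (C * (x ^ (1 / p) * y ^ (2 / p) + x ^ (2 / p) * y ^ (1 / p)))) :
    DeltaBound μ m a p x y Z (C * (1 + 2 * w ^ (1 / p))) := by
  have hw : 0 ≤ w := hx.trans hxw
  have e : ∀ z : ℝ, 0 ≤ z → z ^ (2 / p) = z ^ (1 / p) * z ^ (1 / p) := fun z hz => by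
    rw [← Real.rpow_add_of_nonneg hz (by positivity) (by positivity)]; congr 1; ring
  have hx' : x ^ (1 / p) ≤ w ^ (1 / p) := by gcongr
  have hy' : y ^ (1 / p) ≤ w ^ (1 / p) := by gcongr
  have hx0 : 0 ≤ x ^ (1 / p) := by positivity
  have hy0 : 0 ≤ y ^ (1 / p) := by positivity
  have hw0 : 0 ≤ w ^ (1 / p) := by positivity
  rw [e x hx, e y hy] at h
  constructor
  · refine h.mono ?_
    rw [Real.mul_rpow hx hy, mul_assoc C (1 + 2 * w ^ (1 / p))]
    refine mul_le_mul_of_nonneg_left ?_ hC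
    have h1 : x ^ (1 / p) * y ^ (1 / p) * y ^ (1 / p) ≤ x ^ (1 / p) * y ^ (1 / p) * w ^ (1 / p) := by
      gcongr
    have h2 : x ^ (1 / p) * y ^ (1 / p) * x ^ (1 / p) ≤ x ^ (1 / p) * y ^ (1 / p) * w ^ (1 / p) := by
      gcongr
    nlinarith [mul_nonneg hx0 hy0]
  · rw [e x hx, e y hy]
    refine (h.condExp ha m).mono ?_
    refine mul_le_mul_of_nonneg_right ?_ (by positivity)
    nlinarith [mul_nonneg hC hw0]

/-- Bounds on products with a factor known at the intermediate time. -/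
theorem lpBound_apply (ha : 1 ≤ a) (hm : m ≤ m') (hm' : m' ≤ m0) {A : Ω → E →L[ℝ] G} {R : Ω → E}
    {α ρ ρ' : ℝ} (hAm : StronglyMeasurable[m'] A) (hA : LpBound μ (2 * a) A α)
    (hR : LpBound μ (2 * a) R ρ) (hR' : LpBound μ (2 * a) (μ[R | m']) ρ') :
    LpBound μ a (fun ω => A ω (R ω)) (α * ρ) ∧
      LpBound μ a (μ[fun ω => A ω (R ω) | m]) (α * ρ') := by
  have key : ∀ {R : Ω → E} {ρ : ℝ}, LpBound μ (2 * a) R ρ →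
      LpBound μ a (fun ω => A ω (R ω)) (α * ρ) := fun {R ρ} hR => by
    have := hA.of_norm_le_mul_mul hR (Z := fun ω => A ω (R ω)) (K := 1)
      ((ContinuousLinearMap.id ℝ (E →L[ℝ] G)).aestronglyMeasurable_comp₂ hA.meas hR.meas)
      zero_le_one (.of_forall fun ω => by rw [one_mul]; exact (A ω).le_opNorm _)
    rwa [one_mul] at this
  refine ⟨key hR, ?_⟩
  have h1 : μ[fun ω => A ω (R ω) | m'] =ᵐ[μ] fun ω => A ω (μ[R | m'] ω) :=
    condExp_bilin_of_stronglyMeasurable_left (ContinuousLinearMap.id ℝ (E →L[ℝ] G)) hAm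
      ((key hR).integrable ha) (hR.integrable (by linarith))
  exact (((key hR').congr h1.symm).condExp ha m).congr (condExp_condExp_of_le hm hm')

end DeltaBound

/-- The hypotheses on the integrand `φ` in a controlled integral of `φ(Y)`. -/
structure IsC2Bounded {E G : Type*} [NormedAddCommGroup E] [NormedSpace ℝ E]
    [NormedAddCommGroup G] [NormedSpace ℝ G] (K : ℝ) (φ : E → G) : Prop where
  nonneg : 0 ≤ K
  diff : Differentiable ℝ φ
  bound : ∀ y, ‖fderiv ℝ φ y‖ ≤ K
  lip : ∀ y z, ‖fderiv ℝ φ y - fderiv ℝ φ z‖ ≤ K * ‖y - z‖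

namespace IsC2Bounded

variable {E G : Type*} [NormedAddCommGroup E] [NormedSpace ℝ E]
    [NormedAddCommGroup G] [NormedSpace ℝ G] {K : ℝ} {φ : E → G}

theorem continuous_fderiv (h : IsC2Bounded K φ) : Continuous (fderiv ℝ φ) :=
  (LipschitzWith.of_dist_le_mul (K := ⟨K, h.nonneg⟩) fun y z => by
    rw [dist_eq_norm, dist_eq_norm]; exact h.lip y z).continuous

theorem norm_sub_le (h : IsC2Bounded K φ) (y z : E) : ‖φ z - φ y‖ ≤ K * ‖z - y‖ :=
  convex_univ.norm_image_sub_le_of_norm_fderiv_le (fun x _ => h.diff x) (fun x _ => h.bound x)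
    (mem_univ y) (mem_univ z)

theorem norm_le (h : IsC2Bounded K φ) (y : E) : ‖φ y‖ ≤ ‖φ 0‖ + K * ‖y‖ := by
  have h1 := h.norm_sub_le 0 y
  have h2 := norm_add_le (φ 0) (φ y - φ 0)
  rw [add_sub_cancel] at h2
  rw [sub_zero] at h1
  linarith

theorem taylor (h : IsC2Bounded K φ) (y z : E) :
    ‖φ z - φ y - fderiv ℝ φ y (z - y)‖ ≤ K * ‖z - y‖ ^ 2 := by
  have h1 : ∀ x ∈ segment ℝ y z, ‖fderiv ℝ φ x - fderiv ℝ φ y‖ ≤ K * ‖z - y‖ := fun x hx => by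
    refine (h.lip x y).trans (mul_le_mul_of_nonneg_left ?_ h.nonneg)
    exact norm_sub_le_of_mem_segment hx
  refine ((convex_segment y z).norm_image_sub_le_of_norm_hasFDerivWithin_le'
    (fun x _ => (h.diff x).hasFDerivAt.hasFDerivWithinAt) h1 (left_mem_segment ℝ y z)
    (right_mem_segment ℝ y z)).trans_eq ?_
  ring

end IsC2Bounded

end RoughIto

namespace RoughIto

/-! ### The germ of the integral of φ(Y) against Y -/

section Germs

variable {Ω : Type*} {m0 : MeasurableSpace Ω} {μ : Measure Ω} [IsProbabilityMeasure μ]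
variable {V E G : Type*} [NormedAddCommGroup V] [NormedSpace ℝ V] [FiniteDimensional ℝ V]
  [NormedAddCommGroup E] [NormedSpace ℝ E] [FiniteDimensional ℝ E]
  [NormedAddCommGroup G] [NormedSpace ℝ G] [FiniteDimensional ℝ G]

/-- The bilinear form `(v, w) ↦ D (y v) (y w)`. -/
noncomputable def pullBilin (D : E →L[ℝ] E →L[ℝ] G) (y : V →L[ℝ] E) : V →L[ℝ] V →L[ℝ] G :=
  (D.comp y).bilinearComp (ContinuousLinearMap.id ℝ V) y

theorem pullBilin_apply (D : E →L[ℝ] E →L[ℝ] G) (y : V →L[ℝ] E) (v w : V) :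
    pullBilin D y v w = D (y v) (y w) := by
  simp [pullBilin]

theorem pullBilin_eq (D : E →L[ℝ] E →L[ℝ] G) (y : V →L[ℝ] E) :
    pullBilin D y = D.bilinearComp y y := by
  ext v w; simp [pullBilin]

theorem norm_pullBilin_le (D : E →L[ℝ] E →L[ℝ] G) (y : V →L[ℝ] E) :
    ‖pullBilin D y‖ ≤ ‖D‖ * (‖y‖ * ‖y‖) := by
  rw [pullBilin_eq]
  exact norm_bilinearComp_le D y y

/-- Flipping and composing twice displays the map as a composition of continuous operations. -/
theorem continuous_pullBilin :
    Continuous fun P : (E →L[ℝ] E →L[ℝ] G) × (V →L[ℝ] E) => pullBilin P.1 P.2 := by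
  have h : (fun P : (E →L[ℝ] E →L[ℝ] G) × (V →L[ℝ] E) => pullBilin P.1 P.2) = fun P =>
      ((P.1.comp P.2).flip.comp P.2).flip := by
    ext P v w
    simp [pullBilin]
  rw [h]
  have h1 : Continuous fun P : (E →L[ℝ] E →L[ℝ] G) × (V →L[ℝ] E) => P.1.comp P.2 :=
    continuous_fst.clm_comp continuous_snd
  have h2 : Continuous fun P : (E →L[ℝ] E →L[ℝ] G) × (V →L[ℝ] E) => (P.1.comp P.2).flip :=
    (ContinuousLinearMap.flipₗᵢ ℝ V E G).continuous.comp h1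
  have h3 : Continuous fun P : (E →L[ℝ] E →L[ℝ] G) × (V →L[ℝ] E) =>
      (P.1.comp P.2).flip.comp P.2 := h2.clm_comp continuous_snd
  exact (ContinuousLinearMap.flipₗᵢ ℝ V V G).continuous.comp h3

theorem norm_pullBilin_sub_le (D D' : E →L[ℝ] E →L[ℝ] G) (y y' : V →L[ℝ] E) :
    ‖pullBilin D y - pullBilin D' y'‖ ≤
      ‖D - D'‖ * (‖y‖ * ‖y‖) + ‖D'‖ * (‖y - y'‖ * (‖y‖ + ‖y'‖)) := by
  have e : pullBilin D y - pullBilin D' y' =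
      (D - D').bilinearComp y y + (D'.bilinearComp (y - y') y + D'.bilinearComp y' (y - y')) := by
    ext v w; simp [pullBilin]
  rw [e]
  refine (norm_add_le _ _).trans (add_le_add (norm_bilinearComp_le _ _ _)
    ((norm_add_le _ _).trans ((add_le_add (norm_bilinearComp_le _ _ _)
      (norm_bilinearComp_le _ _ _)).trans_eq ?_)))
  ring

theorem norm_pullBilin_fderiv_sub_le {K : ℝ} {φ : E → E →L[ℝ] G} (hφ : IsC2Bounded K φ) (y z : E)
    (A B : V →L[ℝ] E) : ‖pullBilin (fderiv ℝ φ y) A - pullBilin (fderiv ℝ φ z) B‖ ≤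
      K * (‖z - y‖ * (‖A‖ * ‖A‖)) + K * (‖B - A‖ * (‖A‖ + ‖B‖)) := by
  refine (norm_pullBilin_sub_le _ _ _ _).trans ?_
  have e1 := hφ.lip y z
  rw [norm_sub_rev y] at e1
  rw [norm_sub_rev A, ← mul_assoc K]
  exact add_le_add (mul_le_mul_of_nonneg_right e1 (by positivity))
    (mul_le_mul_of_nonneg_right (hφ.bound z) (by positivity))

theorem aestronglyMeasurable_pullBilin {K : ℝ} {φ : E → E →L[ℝ] G} (hφ : IsC2Bounded K φ)
    {y : Ω → E} {A : Ω → V →L[ℝ] E} (hy : AEStronglyMeasurable y μ)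
    (hA : AEStronglyMeasurable A μ) :
    AEStronglyMeasurable (fun ω => pullBilin (fderiv ℝ φ (y ω)) (A ω)) μ := by
  have h1 : AEStronglyMeasurable (fun ω => (fderiv ℝ φ (y ω), A ω)) μ :=
    (hφ.continuous_fderiv.comp_aestronglyMeasurable hy).prodMk hA
  have h2 := (continuous_pullBilin (V := V) (E := E) (G := G)).comp_aestronglyMeasurable h1
  simpa only [Function.comp_def] using h2

theorem stronglyMeasurable_pullBilin {m : MeasurableSpace Ω} {K : ℝ} {φ : E → E →L[ℝ] G}
    (hφ : IsC2Bounded K φ) {y : Ω → E} {A : Ω → V →L[ℝ] E} (hy : StronglyMeasurable[m] y)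
    (hA : StronglyMeasurable[m] A) :
    StronglyMeasurable[m] (fun ω => pullBilin (fderiv ℝ φ (y ω)) (A ω)) := by
  have h1 : StronglyMeasurable[m] (fun ω => (fderiv ℝ φ (y ω), A ω)) :=
    (hφ.continuous_fderiv.comp_stronglyMeasurable hy).prodMk hA
  have h2 := (continuous_pullBilin (V := V) (E := E) (G := G)).comp_stronglyMeasurable h1
  simpa only [Function.comp_def] using h2

theorem _root_.MeasureTheory.StronglyMeasurable.clm_apply' {m : MeasurableSpace Ω}
    {A : Ω → E →L[ℝ] G} {Z : Ω → E} (hA : StronglyMeasurable[m] A) (hZ : StronglyMeasurable[m] Z) :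
    StronglyMeasurable[m] fun ω => A ω (Z ω) :=
  isBoundedBilinearMap_apply.continuous.comp_stronglyMeasurable (hA.prodMk hZ)

namespace ControlledBounds

variable {ℱ : Filtration ℝ m0} {T a p M K : ℝ} {g : StieltjesFunction ℝ} {X : ℝ → V}
  {XX : ℝ → ℝ → V ⊗[ℝ] V} {Y : ℝ → Ω → E} {Y' : ℝ → Ω → V →L[ℝ] E}

theorem M_nonneg (h : ControlledBounds μ ℱ T a p M g X XX Y Y') (hT : 0 ≤ T) : 0 ≤ M :=
  (h.Y'_bound 0 le_rfl hT).nonneg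

theorem remainder_le (h : ControlledBounds μ ℱ T a p M g X XX Y Y') (ha : 2 ≤ a) {s t : ℝ}
    (hs : 0 ≤ s) (hst : s ≤ t) (ht : t ≤ T) :
    LpBound μ (2 * a) (remainder X Y Y' s t) ((1 + M) * (g t - g s) ^ (1 / p)) := by
  have b := h.Y'_bound s hs (hst.trans ht)
  refine ((h.Y_le s t hs hst ht).sub (by linarith) ((b.exponent_mono (by linarith)).of_norm_le_mul
    (Z := fun ω => Y' s ω (X t - X s)) ((ContinuousLinearMap.apply ℝ E
      (X t - X s)).continuous.comp_aestronglyMeasurable b.meas)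
    (Real.rpow_nonneg (sub_nonneg.2 (g.mono hst)) (1 / p)) (.of_forall fun ω => ?_))).mono
      (by linarith)
  rw [mul_comm]
  exact ((Y' s ω).le_opNorm _).trans (by gcongr; exact h.X_le s t hs hst ht)

theorem remainder_cond_le (h : ControlledBounds μ ℱ T a p M g X XX Y Y') (ha : 2 ≤ a) {s t : ℝ}
    (hs : 0 ≤ s) (hst : s ≤ t) (ht : t ≤ T) :
    LpBound μ (2 * a) (μ[remainder X Y Y' s t | ℱ s]) ((g t - g s) ^ (2 / p)) :=
  (h.R_le s t hs hst ht).exponent_mono (by linarith)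

theorem comp_sub_le (h : ControlledBounds μ ℱ T a p M g X XX Y Y') {φ : E → G}
    (hφ : IsC2Bounded K φ) {s t : ℝ} (hs : 0 ≤ s) (hst : s ≤ t) (ht : t ≤ T) :
    LpBound μ (2 * a) (fun ω => φ (Y t ω) - φ (Y s ω)) (K * (g t - g s) ^ (1 / p)) :=
  (h.Y_le s t hs hst ht).of_norm_le_mul
    ((hφ.diff.continuous.comp_aestronglyMeasurable (h.Y_memLp t (hs.trans hst) ht).1).sub
      (hφ.diff.continuous.comp_aestronglyMeasurable (h.Y_memLp s hs (hst.trans ht)).1))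
    hφ.nonneg (.of_forall fun _ => hφ.norm_sub_le _ _)

theorem comp_memLp (h : ControlledBounds μ ℱ T a p M g X XX Y Y') {φ : E → G}
    (hφ : IsC2Bounded K φ) {t : ℝ} (ht : 0 ≤ t) (htT : t ≤ T) :
    MemLp (fun ω => φ (Y t ω)) (ENNReal.ofReal (2 * a)) μ := by
  refine ((memLp_const ‖φ 0‖).add ((h.Y_memLp t ht htT).norm.const_mul K)).mono
    (hφ.diff.continuous.comp_aestronglyMeasurable (h.Y_memLp t ht htT).1) (.of_forall fun ω => ?_)
  exact (hφ.norm_le _).trans (le_abs_self _)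

theorem Y'_sq (h : ControlledBounds μ ℱ T a p M g X XX Y Y') {s : ℝ} (hs : 0 ≤ s) (hsT : s ≤ T) :
    LpBound μ (2 * a) (fun ω => ‖Y' s ω‖ * ‖Y' s ω‖) (M * M) := by
  have b := h.Y'_bound s hs hsT
  simpa using b.of_norm_le_mul_mul b (Z := fun ω => ‖Y' s ω‖ * ‖Y' s ω‖) (K := 1)
    (b.meas.norm.mul b.meas.norm) zero_le_one (.of_forall fun ω => by simp)

/-- The increment is at most |δY||Y'|² + |δY'||Y'| up to constants. The fourfold exponent of Y'
places |Y'|² in L^{2a}, so Hölder's inequality lands in L^a. -/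
theorem pullBilin_sub_le (h : ControlledBounds μ ℱ T a p M g X XX Y Y') (ha : 2 ≤ a)
    {φ : E → E →L[ℝ] G} (hφ : IsC2Bounded K φ) {s t : ℝ} (hs : 0 ≤ s) (hst : s ≤ t) (ht : t ≤ T) :
    LpBound μ a (fun ω => pullBilin (fderiv ℝ φ (Y s ω)) (Y' s ω) -
        pullBilin (fderiv ℝ φ (Y t ω)) (Y' t ω)) (K * (M * M + 2 * M) * (g t - g s) ^ (1 / p)) := by
  have ha1 : 1 ≤ a := by linarith
  have c1 := h.Y'_bound s hs (hst.trans ht)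
  have c2 := h.Y'_bound t (hs.trans hst) ht
  have bY := h.Y_le s t hs hst ht
  have bY' := h.Y'_le s t hs hst ht
  have hK := hφ.nonneg
  have hm := (aestronglyMeasurable_pullBilin hφ (h.Y_memLp s hs (hst.trans ht)).1 c1.meas).sub
    (aestronglyMeasurable_pullBilin hφ (h.Y_memLp t (hs.trans hst) ht).1 c2.meas)
  have d1 : LpBound μ a (fun ω => K * (‖Y t ω - Y s ω‖ * (‖Y' s ω‖ * ‖Y' s ω‖)))
      (K * ((g t - g s) ^ (1 / p) * (M * M))) := by
    refine bY.of_norm_le_mul_mul (h.Y'_sq hs (hst.trans ht))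
      ((bY.meas.norm.mul (c1.meas.norm.mul c1.meas.norm)).const_mul K) hK (.of_forall fun ω => ?_)
    change ‖K * (‖Y t ω - Y s ω‖ * (‖Y' s ω‖ * ‖Y' s ω‖))‖ ≤ _
    rw [Real.norm_of_nonneg (by positivity), Real.norm_of_nonneg (by positivity), Pi.sub_apply]
  have hsum : LpBound μ (2 * a) (fun ω => ‖Y' s ω‖ + ‖Y' t ω‖) (M + M) :=
    (((c1.exponent_mono (by linarith)).of_norm_le c1.meas.norm
      (.of_forall fun ω => (norm_norm _).le)).add (by linarith)
      ((c2.exponent_mono (by linarith)).of_norm_le c2.meas.norm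
        (.of_forall fun ω => (norm_norm _).le)))
  have d2 : LpBound μ a (fun ω => K * (‖Y' t ω - Y' s ω‖ * (‖Y' s ω‖ + ‖Y' t ω‖)))
      (K * ((g t - g s) ^ (1 / p) * (M + M))) := by
    refine bY'.of_norm_le_mul_mul hsum
      ((bY'.meas.norm.mul (c1.meas.norm.add c2.meas.norm)).const_mul K) hK (.of_forall fun ω => ?_)
    change ‖K * (‖Y' t ω - Y' s ω‖ * (‖Y' s ω‖ + ‖Y' t ω‖))‖ ≤ _
    rw [Real.norm_of_nonneg (by positivity),
      Real.norm_of_nonneg (by positivity : 0 ≤ ‖Y' s ω‖ + ‖Y' t ω‖), Pi.sub_apply]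
  refine ((d1.add ha1 d2).of_norm_le hm (.of_forall fun ω => ?_)).mono (le_of_eq (by ring))
  exact (norm_pullBilin_fderiv_sub_le hφ _ _ _ _).trans (le_abs_self _)

theorem integralGerm_memLp (h : ControlledBounds μ ℱ T a p M g X XX Y Y') (ha : 2 ≤ a)
    {φ : E → E →L[ℝ] G} (hφ : IsC2Bounded K φ) {s t : ℝ} (hs : 0 ≤ s) (hst : s ≤ t) (ht : t ≤ T) :
    MemLp (fun ω => φ (Y s ω) (Y t ω - Y s ω)) (ENNReal.ofReal a) μ ∧
    LpBound μ a (fun ω => contract (pullBilin (fderiv ℝ φ (Y s ω)) (Y' s ω)) (XX s t))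
      (K * (M * M) * (g t - g s) ^ (2 / p)) := by
  have b1 := (h.comp_memLp hφ hs (hst.trans ht)).lpBound.of_norm_le_mul_mul (h.Y_le s t hs hst ht)
    (Z := fun ω => φ (Y s ω) (Y t ω - Y s ω)) (K := 1)
    ((ContinuousLinearMap.id ℝ (E →L[ℝ] G)).aestronglyMeasurable_comp₂
      (h.comp_memLp hφ hs (hst.trans ht)).1 (h.Y_le s t hs hst ht).meas) zero_le_one
    (.of_forall fun ω => by rw [one_mul]; exact (φ (Y s ω)).le_opNorm _)
  refine ⟨b1.memLp, ?_⟩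
  have hn : 0 ≤ (g t - g s) ^ (2 / p) := Real.rpow_nonneg (sub_nonneg.2 (g.mono hst)) _
  have b2 := ((h.Y'_sq hs (hst.trans ht)).exponent_mono (b := a) (by linarith)).of_norm_le_mul
    (Z := fun ω => contract (pullBilin (fderiv ℝ φ (Y s ω)) (Y' s ω)) (XX s t))
    (K := K * (g t - g s) ^ (2 / p)) ?_ (mul_nonneg hφ.nonneg hn) (.of_forall fun ω => ?_)
  · exact b2.mono (le_of_eq (by ring))
  · have e := aestronglyMeasurable_pullBilin hφ (h.Y_memLp s hs (hst.trans ht)).1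
      (h.Y'_bound s hs (hst.trans ht)).meas
    exact ((contractL V V G).flip (XX s t)).continuous.comp_aestronglyMeasurable e
  · refine (norm_contract_le _ _).trans ?_
    rw [Real.norm_of_nonneg (by positivity : 0 ≤ ‖Y' s ω‖ * ‖Y' s ω‖)]
    calc _ ≤ K * (‖Y' s ω‖ * ‖Y' s ω‖) * (g t - g s) ^ (2 / p) :=
          mul_le_mul ((norm_pullBilin_le _ _).trans (by gcongr; exact hφ.bound _))
            (h.XX_le s t hs hst ht) (norm_nonneg _) (mul_nonneg hφ.nonneg (by positivity))
      _ = _ := by ring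

/-- The germ `φ(Y_u) δY_{u,v} + Dφ(Y_u) (Y'_u ⊗ Y'_u) 𝕏_{u,v}`. -/
noncomputable def _root_.RoughIto.compGerm (XX : ℝ → ℝ → V ⊗[ℝ] V) (φ : E → E →L[ℝ] G)
    (Y : ℝ → Ω → E) (Y' : ℝ → Ω → V →L[ℝ] E) : ℝ → ℝ → Ω → G :=
  integralGerm XX (fun s ω => φ (Y s ω)) (fun s ω => (fderiv ℝ φ (Y s ω)).comp (Y' s ω)) Y Y'

theorem _root_.RoughIto.compGerm_apply (φ : E → E →L[ℝ] G) (s t : ℝ) (ω : Ω) :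
    compGerm XX φ Y Y' s t ω = φ (Y s ω) (Y t ω - Y s ω) +
      contract (pullBilin (fderiv ℝ φ (Y s ω)) (Y' s ω)) (XX s t) := rfl

theorem compGerm_stronglyMeasurable (h : ControlledBounds μ ℱ T a p M g X XX Y Y')
    {φ : E → E →L[ℝ] G} (hφ : IsC2Bounded K φ) {s t : ℝ} (hs : 0 ≤ s) (hst : s ≤ t) (ht : t ≤ T) :
    StronglyMeasurable[ℱ t] (compGerm XX φ Y Y' s t) := by
  have h1 := (h.adapted s ⟨hs, hst.trans ht⟩).mono (ℱ.mono hst)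
  have h2 := h.adapted t ⟨hs.trans hst, ht⟩
  have h3 := (h.adapted' s ⟨hs, hst.trans ht⟩).mono (ℱ.mono hst)
  refine ((hφ.diff.continuous.comp_stronglyMeasurable h1).clm_apply' (h2.sub h1)).add ?_
  exact ((contractL V V G).flip (XX s t)).continuous.comp_stronglyMeasurable
    (stronglyMeasurable_pullBilin hφ h1 h3)

/-- Chen's relation cancels the second-order terms of the defect. The first three remaining terms
have total order 3/p without conditioning. The last two are linear in a remainder, which is only of
order 1/p in norm but of order 2/p in conditional mean. -/
theorem compGerm_delta (h : ControlledBounds μ ℱ T a p M g X XX Y Y') (φ : E → E →L[ℝ] G)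
    {s u t : ℝ} (hs : 0 ≤ s) (hsu : s ≤ u) (hut : u ≤ t) (ht : t ≤ T) :
    compGerm XX φ Y Y' s t - compGerm XX φ Y Y' s u - compGerm XX φ Y Y' u t =
      (fun ω => contract (pullBilin (fderiv ℝ φ (Y s ω)) (Y' s ω) -
          pullBilin (fderiv ℝ φ (Y u ω)) (Y' u ω)) (XX u t)) -
      (fun ω => (φ (Y u ω) - φ (Y s ω) - fderiv ℝ φ (Y s ω) (Y u ω - Y s ω))
          (Y' s ω (X t - X u))) -
      (fun ω => (φ (Y u ω) - φ (Y s ω)) ((Y' u ω - Y' s ω) (X t - X u))) -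
      (fun ω => (fderiv ℝ φ (Y s ω)).flip (Y' s ω (X t - X u)) (remainder X Y Y' s u ω)) -
      (fun ω => (φ (Y u ω) - φ (Y s ω)) (remainder X Y Y' u t ω)) := by
  ext ω
  have hsub : ∀ (B C : V →L[ℝ] V →L[ℝ] G) τ, contract (B - C) τ = contract B τ - contract C τ := by
    intro B C τ
    exact congrArg (fun L : V ⊗[ℝ] V →L[ℝ] G => L τ) ((contractL V V G).map_sub B C)
  simp only [Pi.sub_apply, compGerm_apply, h.chen s u t hs hsu hut ht, map_add, contract_tmul,
    pullBilin_apply, hsub, remainder, map_sub, sub_apply, ContinuousLinearMap.flip_apply]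
  abel

theorem lpBound_pullBilin_sub (h : ControlledBounds μ ℱ T a p M g X XX Y Y') (ha : 2 ≤ a)
    {φ : E → E →L[ℝ] G} (hφ : IsC2Bounded K φ) {s u t : ℝ} (hs : 0 ≤ s) (hsu : s ≤ u) (hut : u ≤ t)
    (ht : t ≤ T) : LpBound μ a (fun ω => contract (pullBilin (fderiv ℝ φ (Y s ω)) (Y' s ω) -
        pullBilin (fderiv ℝ φ (Y u ω)) (Y' u ω)) (XX u t))
      (K * (M * M + 2 * M) * ((g u - g s) ^ (1 / p) * (g t - g u) ^ (2 / p))) := by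
  have b := h.pullBilin_sub_le ha hφ hs hsu (hut.trans ht)
  have hy : 0 ≤ (g t - g u) ^ (2 / p) := Real.rpow_nonneg (sub_nonneg.2 (g.mono hut)) _
  refine (b.of_norm_le_mul (((contractL V V G).flip (XX u t)).continuous.comp_aestronglyMeasurable
    b.meas) hy (.of_forall fun ω => ?_)).mono (le_of_eq (by ring))
  refine (norm_contract_le _ _).trans ?_
  rw [mul_comm]
  exact mul_le_mul_of_nonneg_right (h.XX_le u t (hs.trans hsu) hut ht) (norm_nonneg _)

/-- The term is of order |δY|²|Y'_s||δX|, and Hölder's inequality would fall short of L^a. Since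
Y'_s is known at s, the weighted square bound `Y_sq` applies with weight |Y'_s|. -/
theorem lpBound_taylor (h : ControlledBounds μ ℱ T a p M g X XX Y Y') (ha : 2 ≤ a)
    {φ : E → E →L[ℝ] G} (hφ : IsC2Bounded K φ) {s u t : ℝ} (hs : 0 ≤ s) (hsu : s ≤ u) (hut : u ≤ t)
    (ht : t ≤ T) : LpBound μ a
      (fun ω => (φ (Y u ω) - φ (Y s ω) - fderiv ℝ φ (Y s ω) (Y u ω - Y s ω))
          (Y' s ω (X t - X u)))
      (K * M * ((g u - g s) ^ (2 / p) * (g t - g u) ^ (1 / p))) := by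
  have hu : u ≤ T := hut.trans ht
  have hu0 : 0 ≤ u := hs.trans hsu
  have hXut := h.X_le u t hu0 hut ht
  have bYs' := h.Y'_bound s hs (hsu.trans hu)
  have mYs := (h.Y_memLp s hs (hsu.trans hu)).1
  have mYu := (h.Y_memLp u hu0 hu).1
  have mφ := hφ.diff.continuous
  have hK := hφ.nonneg
  have hy : 0 ≤ (g t - g u) ^ (1 / p) := Real.rpow_nonneg (sub_nonneg.2 (g.mono hut)) _
  have b := h.Y_sq s u hs hsu hu (fun ω => ‖Y' s ω‖) M (h.adapted' s ⟨hs, hsu.trans hu⟩).norm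
    ((bYs'.exponent_mono (by linarith)).of_norm_le bYs'.meas.norm
      (.of_forall fun ω => (norm_norm _).le))
  have m1 : AEStronglyMeasurable (fun ω => fderiv ℝ φ (Y s ω) (Y u ω - Y s ω)) μ :=
    (ContinuousLinearMap.id ℝ (E →L[ℝ] E →L[ℝ] G)).aestronglyMeasurable_comp₂
      (hφ.continuous_fderiv.comp_aestronglyMeasurable mYs) (mYu.sub mYs)
  have m2 := (ContinuousLinearMap.apply ℝ E
    (X t - X u)).continuous.comp_aestronglyMeasurable bYs'.meas
  refine (b.of_norm_le_mul ((ContinuousLinearMap.id ℝ (E →L[ℝ] G)).aestronglyMeasurable_comp₂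
    (((mφ.comp_aestronglyMeasurable mYu).sub (mφ.comp_aestronglyMeasurable mYs)).sub m1) m2)
    (K := K * (g t - g u) ^ (1 / p)) (by positivity)
    (.of_forall fun ω => ?_)).mono (le_of_eq (by ring))
  refine (ContinuousLinearMap.le_opNorm _ _).trans ?_
  rw [Real.norm_of_nonneg (by positivity)]
  calc _ ≤ K * ‖Y u ω - Y s ω‖ ^ 2 * (‖Y' s ω‖ * (g t - g u) ^ (1 / p)) := by
        refine mul_le_mul (hφ.taylor _ _) (((Y' s ω).le_opNorm _).trans ?_) (norm_nonneg _)
          (by positivity)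
        exact mul_le_mul_of_nonneg_left hXut (norm_nonneg _)
    _ = _ := by simp only [Pi.sub_apply]; ring

theorem lpBound_comp_sub_mul (h : ControlledBounds μ ℱ T a p M g X XX Y Y')
    {φ : E → E →L[ℝ] G} (hφ : IsC2Bounded K φ) {s u t : ℝ} (hs : 0 ≤ s) (hsu : s ≤ u) (hut : u ≤ t)
    (ht : t ≤ T) : LpBound μ a
      (fun ω => (φ (Y u ω) - φ (Y s ω)) ((Y' u ω - Y' s ω) (X t - X u)))
      (K * ((g u - g s) ^ (1 / p) * (g u - g s) ^ (1 / p) * (g t - g u) ^ (1 / p))) := by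
  have hu : u ≤ T := hut.trans ht
  have hu0 : 0 ≤ u := hs.trans hsu
  have hXut := h.X_le u t hu0 hut ht
  have bY := h.Y_le s u hs hsu hu
  have bY' := h.Y'_le s u hs hsu hu
  have mYs := (h.Y_memLp s hs (hsu.trans hu)).1
  have mYu := (h.Y_memLp u hu0 hu).1
  have mφ := hφ.diff.continuous
  have hK := hφ.nonneg
  have hy : 0 ≤ (g t - g u) ^ (1 / p) := Real.rpow_nonneg (sub_nonneg.2 (g.mono hut)) _
  have m2 := (ContinuousLinearMap.apply ℝ E
    (X t - X u)).continuous.comp_aestronglyMeasurable bY'.meas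
  refine (bY.of_norm_le_mul_mul bY'
    ((ContinuousLinearMap.id ℝ (E →L[ℝ] G)).aestronglyMeasurable_comp₂
    ((mφ.comp_aestronglyMeasurable mYu).sub (mφ.comp_aestronglyMeasurable mYs)) m2)
    (K := K * (g t - g u) ^ (1 / p)) (by positivity)
    (.of_forall fun ω => ?_)).mono (le_of_eq (by ring))
  refine (ContinuousLinearMap.le_opNorm _ _).trans ?_
  calc _ ≤ K * ‖Y u ω - Y s ω‖ * (‖Y' u ω - Y' s ω‖ * (g t - g u) ^ (1 / p)) := by
        refine mul_le_mul (hφ.norm_sub_le _ _) (((Y' u ω - Y' s ω).le_opNorm _).trans ?_)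
          (norm_nonneg _) (by positivity)
        exact mul_le_mul_of_nonneg_left hXut (norm_nonneg _)
    _ = _ := by simp only [Pi.sub_apply]; ring

/-- The factor in front of R_{s,u} is known at s and can be pulled out of the conditional
expectation, which then sees only the conditional mean of R_{s,u}. -/
theorem lpBound_fderiv_remainder (h : ControlledBounds μ ℱ T a p M g X XX Y Y') (ha : 2 ≤ a)
    {φ : E → E →L[ℝ] G} (hφ : IsC2Bounded K φ) {s u t : ℝ} (hs : 0 ≤ s) (hsu : s ≤ u) (hut : u ≤ t)
    (ht : t ≤ T) :
    LpBound μ a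
      (fun ω => (fderiv ℝ φ (Y s ω)).flip (Y' s ω (X t - X u)) (remainder X Y Y' s u ω))
      (K * (g t - g u) ^ (1 / p) * M * ((1 + M) * (g u - g s) ^ (1 / p))) ∧
    LpBound μ a
      (μ[fun ω => (fderiv ℝ φ (Y s ω)).flip (Y' s ω (X t - X u)) (remainder X Y Y' s u ω) | ℱ s])
      (K * (g t - g u) ^ (1 / p) * M * (g u - g s) ^ (2 / p)) := by
  have ha1 : 1 ≤ a := by linarith
  have hu : u ≤ T := hut.trans ht
  have hu0 : 0 ≤ u := hs.trans hsu
  have hXut := h.X_le u t hu0 hut ht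
  have bYs' := h.Y'_bound s hs (hsu.trans hu)
  have hK := hφ.nonneg
  have hy : 0 ≤ (g t - g u) ^ (1 / p) := Real.rpow_nonneg (sub_nonneg.2 (g.mono hut)) _
  have aA : StronglyMeasurable[ℱ s]
      (fun ω => (fderiv ℝ φ (Y s ω)).flip (Y' s ω (X t - X u))) :=
    ((ContinuousLinearMap.flipₗᵢ ℝ E E G).continuous.comp_stronglyMeasurable
      (hφ.continuous_fderiv.comp_stronglyMeasurable (h.adapted s ⟨hs, hsu.trans hu⟩))).clm_apply'
      ((ContinuousLinearMap.apply ℝ E (X t - X u)).continuous.comp_stronglyMeasurable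
        (h.adapted' s ⟨hs, hsu.trans hu⟩))
  have bA : LpBound μ (2 * a) (fun ω => (fderiv ℝ φ (Y s ω)).flip (Y' s ω (X t - X u)))
      (K * (g t - g u) ^ (1 / p) * M) := by
    refine (bYs'.exponent_mono (by linarith)).of_norm_le_mul
      (aA.mono (ℱ.le s)).aestronglyMeasurable (by positivity) (.of_forall fun ω => ?_)
    refine (ContinuousLinearMap.le_opNorm _ _).trans ?_
    rw [ContinuousLinearMap.opNorm_flip, mul_assoc, mul_comm ((g t - g u) ^ (1 / p))]
    refine mul_le_mul (hφ.bound _) (((Y' s ω).le_opNorm _).trans ?_) (norm_nonneg _) hK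
    exact mul_le_mul_of_nonneg_left hXut (norm_nonneg _)
  exact DeltaBound.lpBound_apply ha1 le_rfl (ℱ.le s) aA bA
    (h.remainder_le ha hs hsu hu) (h.remainder_cond_le ha hs hsu hu)

/-- The factor δφ(Y)_{s,u} is known only at u: condition first on ℱ_u, where R_{u,t} has small mean,
and then on ℱ_s. -/
theorem lpBound_sub_remainder (h : ControlledBounds μ ℱ T a p M g X XX Y Y') (ha : 2 ≤ a)
    {φ : E → E →L[ℝ] G} (hφ : IsC2Bounded K φ) {s u t : ℝ} (hs : 0 ≤ s) (hsu : s ≤ u) (hut : u ≤ t)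
    (ht : t ≤ T) :
    LpBound μ a (fun ω => (φ (Y u ω) - φ (Y s ω)) (remainder X Y Y' u t ω))
      (K * (g u - g s) ^ (1 / p) * ((1 + M) * (g t - g u) ^ (1 / p))) ∧
    LpBound μ a (μ[fun ω => (φ (Y u ω) - φ (Y s ω)) (remainder X Y Y' u t ω) | ℱ s])
      (K * (g u - g s) ^ (1 / p) * (g t - g u) ^ (2 / p)) := by
  have hu : u ≤ T := hut.trans ht
  have hu0 : 0 ≤ u := hs.trans hsu
  have mφ := hφ.diff.continuous
  exact DeltaBound.lpBound_apply (by linarith) (ℱ.mono hsu) (ℱ.le u)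
    ((mφ.comp_stronglyMeasurable (h.adapted u ⟨hu0, hu⟩)).sub
      ((mφ.comp_stronglyMeasurable (h.adapted s ⟨hs, hsu.trans hu⟩)).mono (ℱ.mono hsu)))
    (h.comp_sub_le hφ hs hsu hu) (h.remainder_le ha hu0 hut ht) (h.remainder_cond_le ha hu0 hut ht)

theorem exists_deltaBound_compGerm (h : ControlledBounds μ ℱ T a p M g X XX Y Y') (hT : 0 ≤ T)
    (ha : 2 ≤ a) (hp : 0 < p) {φ : E → E →L[ℝ] G} (hφ : IsC2Bounded K φ) :
    ∃ C : ℝ, 0 ≤ C ∧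
      ∀ s u t, 0 ≤ s → s ≤ u → u ≤ t → t ≤ T → DeltaBound μ (ℱ s) a p (g u - g s) (g t - g u)
        (compGerm XX φ Y Y' s t - compGerm XX φ Y Y' s u - compGerm XX φ Y Y' u t) C := by
  have ha1 : 1 ≤ a := by linarith
  have hM := h.M_nonneg hT
  have hK := hφ.nonneg
  set w := g T - g 0 with hw
  have hw0 : 0 ≤ w := sub_nonneg.2 (g.mono hT)
  -- One summand per term of `compGerm_delta`. The factors 1 + 2w^{1/p} come from
  -- `DeltaBound.of_lpBound`, used for the three terms that need no conditioning.
  refine ⟨K * (M * M + 2 * M) * (1 + 2 * w ^ (1 / p)) + K * M * (1 + 2 * w ^ (1 / p)) +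
    K * (1 + 2 * w ^ (1 / p)) + K * M * (1 + M) + K * (1 + M), by positivity,
    fun s u t hs hsu hut ht => ?_⟩
  have hu : u ≤ T := hut.trans ht
  have hu0 : 0 ≤ u := hs.trans hsu
  have hx : 0 ≤ g u - g s := sub_nonneg.2 (g.mono hsu)
  have hy : 0 ≤ g t - g u := sub_nonneg.2 (g.mono hut)
  have hxw : g u - g s ≤ w := sub_le_sub (g.mono hu) (g.mono hs)
  have hyw : g t - g u ≤ w := sub_le_sub (g.mono ht) (g.mono hu0)
  have b1 := h.lpBound_pullBilin_sub ha hφ hs hsu hut ht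
  have b2 := h.lpBound_taylor ha hφ hs hsu hut ht
  have b3 := h.lpBound_comp_sub_mul hφ hs hsu hut ht
  have b4 := h.lpBound_fderiv_remainder ha hφ hs hsu hut ht
  have b5 := h.lpBound_sub_remainder ha hφ hs hsu hut ht
  rw [h.compGerm_delta φ hs hsu hut ht]
  generalize g u - g s = x at *
  generalize g t - g u = y at *
  have ex : x ^ (2 / p) = x ^ (1 / p) * x ^ (1 / p) := by
    rw [← Real.rpow_add_of_nonneg hx (by positivity) (by positivity)]; congr 1; ring
  have hx12 : 0 ≤ x ^ (1 / p) * y ^ (2 / p) := by positivity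
  have hx21 : 0 ≤ x ^ (2 / p) * y ^ (1 / p) := by positivity
  refine (((DeltaBound.sub ha1 (.sub ha1 ?_ ?_) ?_).sub ha1 ?_).sub ha1 ?_)
  · refine .of_lpBound ha1 hp hx hy hxw hyw (by positivity) (b1.mono ?_)
    exact mul_le_mul_of_nonneg_left (by linarith) (by positivity)
  · refine .of_lpBound ha1 hp hx hy hxw hyw (by positivity) (b2.mono ?_)
    exact mul_le_mul_of_nonneg_left (by linarith) (by positivity)
  · refine .of_lpBound ha1 hp hx hy hxw hyw (by positivity) (b3.mono ?_)
    rw [← ex]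
    exact mul_le_mul_of_nonneg_left (by linarith) (by positivity)
  · refine ⟨b4.1.mono ?_, b4.2.mono ?_⟩
    · rw [Real.mul_rpow hx hy]
      exact le_of_eq (by ring)
    · have : 0 ≤ K * M * (x ^ (1 / p) * y ^ (2 / p)) +
        K * M * M * (x ^ (1 / p) * y ^ (2 / p) + x ^ (2 / p) * y ^ (1 / p)) := by positivity
      linarith
  · refine ⟨b5.1.mono ?_, b5.2.mono ?_⟩
    · rw [Real.mul_rpow hx hy]
      exact le_of_eq (by ring)
    · have : 0 ≤ K * M * (x ^ (1 / p) * y ^ (2 / p)) +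
        K * (1 + M) * (x ^ (2 / p) * y ^ (1 / p)) := by positivity
      linarith

theorem exists_isSewable_compGerm (h : ControlledBounds μ ℱ T a p M g X XX Y Y') (hT : 0 ≤ T)
    (ha : 2 ≤ a) (hp : 0 < p) {φ : E → E →L[ℝ] G} (hφ : IsC2Bounded K φ) :
    ∃ C : ℝ, IsSewable μ ℱ T a p g C (compGerm XX φ Y Y') := by
  obtain ⟨C, hC, H⟩ := h.exists_deltaBound_compGerm hT ha hp hφ
  refine ⟨C, hC, fun s t hs hst ht => h.compGerm_stronglyMeasurable hφ hs hst ht,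
    fun s t hs hst ht => ?_, fun s u t hs hsu hut ht => (H s u t hs hsu hut ht).size,
    fun s u t hs hsu hut ht => (H s u t hs hsu hut ht).cond⟩
  have e := h.integralGerm_memLp ha hφ hs hst ht
  exact e.1.add e.2.memLp

end ControlledBounds

end Germs

end RoughIto

namespace RoughIto

/-! ### The bracket germ and its contraction with D²f(Y) -/

section BracketGerm

variable {Ω : Type*} {m0 : MeasurableSpace Ω} {μ : Measure Ω} [IsProbabilityMeasure μ]
variable {V E F : Type*} [NormedAddCommGroup V] [NormedSpace ℝ V] [FiniteDimensional ℝ V]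
  [NormedAddCommGroup E] [NormedSpace ℝ E] [FiniteDimensional ℝ E]
  [NormedAddCommGroup F] [NormedSpace ℝ F] [FiniteDimensional ℝ F]

/-- This makes ∫ Y ⊗ dY a case of the general germ. The integrand is unbounded, which is why
`IsC2Bounded` constrains only the derivative of φ. -/
theorem isC2Bounded_tmulL : IsC2Bounded 1 (fun y : E => tmulL E E y) where
  nonneg := zero_le_one
  diff := (tmulL E E).differentiable
  bound y := by
    rw [(tmulL E E).hasFDerivAt.fderiv]
    exact norm_tmulL_le
  lip y z := by
    rw [(tmulL E E).hasFDerivAt.fderiv, (tmulL E E).hasFDerivAt.fderiv, sub_self, norm_zero]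
    positivity

theorem DeltaBound.bounded_apply {G G' : Type*} [NormedAddCommGroup G] [NormedSpace ℝ G]
    [CompleteSpace G] [NormedAddCommGroup G'] [NormedSpace ℝ G'] [CompleteSpace G']
    {m : MeasurableSpace Ω} (hm : m ≤ m0) {a p x y C K : ℝ} (ha : 1 ≤ a) {Z : Ω → G}
    (h : DeltaBound μ m a p x y Z C) {A : Ω → G →L[ℝ] G'} (hA : StronglyMeasurable[m] A)
    (hK : 0 ≤ K) (hAK : ∀ ω, ‖A ω‖ ≤ K) : DeltaBound μ m a p x y (fun ω => A ω (Z ω)) (K * C) := by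
  have key : ∀ {Z : Ω → G} {c : ℝ}, LpBound μ a Z c → LpBound μ a (fun ω => A ω (Z ω)) (K * c) := by
    intro Z c hZ
    exact hZ.of_norm_le_mul ((ContinuousLinearMap.id ℝ (G →L[ℝ] G')).aestronglyMeasurable_comp₂
      (hA.mono hm).aestronglyMeasurable hZ.meas) hK
      (.of_forall fun ω => ((A ω).le_opNorm _).trans (by gcongr; exact hAK ω))
  refine ⟨(key h.size).mono (by rw [mul_assoc]), ((key h.cond).mono (by rw [mul_assoc])).congr ?_⟩
  exact (condExp_bilin_of_stronglyMeasurable_left (ContinuousLinearMap.id ℝ (G →L[ℝ] G')) hA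
      ((key h.size).integrable ha) (h.size.integrable ha)).symm

variable {ℱ : Filtration ℝ m0} {T a p M K : ℝ} {g : StieltjesFunction ℝ} {X : ℝ → V}
  {XX : ℝ → ℝ → V ⊗[ℝ] V} {Y : ℝ → Ω → E} {Y' : ℝ → Ω → V →L[ℝ] E}

/-- Integration by parts: δY ⊗ δY = δ(Y⊗Y) - Y_u ⊗ δY - δY ⊗ Y_u. The correction 2 Sym(𝕏) is shared
between the germ of ∫ Y ⊗ dY and its transpose. The exact increment has no defect, so sewability is
inherited. -/
theorem bracketGerm_eq (s t : ℝ) : bracketGerm XX Y Y' s t =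
    (fun ω => Y t ω ⊗ₜ[ℝ] Y t ω) - (fun ω => Y s ω ⊗ₜ[ℝ] Y s ω) -
      compGerm XX (fun y : E => tmulL E E y) Y Y' s t -
      fun ω => commL E E (compGerm XX (fun y : E => tmulL E E y) Y Y' s t ω) := by
  ext ω
  have hcomm : ∀ τ : V ⊗[ℝ] V,
      TensorProduct.comm ℝ E E (TensorProduct.map (Y' s ω).toLinearMap (Y' s ω).toLinearMap τ) =
      TensorProduct.map (Y' s ω).toLinearMap (Y' s ω).toLinearMap (TensorProduct.comm ℝ V V τ) := by
    intro τ
    induction τ with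
    | zero => simp
    | tmul u w => simp
    | add σ τ hσ hτ => simp only [map_add, hσ, hτ]
  have hc : contract (pullBilin (fderiv ℝ (fun y : E => tmulL E E y) (Y s ω)) (Y' s ω)) (XX s t) =
      TensorProduct.map (Y' s ω).toLinearMap (Y' s ω).toLinearMap (XX s t) := by
    rw [(tmulL E E).hasFDerivAt.fderiv, pullBilin_eq, ← contract_map, contract_tmulL]
  simp only [Pi.sub_apply, bracketGerm, compGerm_apply, hc, symPart, map_smul, map_add, hcomm,
    tmulL_apply, commL_apply, TensorProduct.comm_tmul, TensorProduct.tmul_sub,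
    TensorProduct.sub_tmul, smul_smul, smul_add, map_sub]
  norm_num
  abel

namespace ControlledBounds

theorem tmul_stronglyMeasurable (h : ControlledBounds μ ℱ T a p M g X XX Y Y') {t : ℝ} (ht : 0 ≤ t)
    (htT : t ≤ T) : StronglyMeasurable[ℱ t] (fun ω => Y t ω ⊗ₜ[ℝ] Y t ω) := by
  have b := h.adapted t ⟨ht, htT⟩
  exact ((tmulL E E).continuous.comp_stronglyMeasurable b).clm_apply' b

theorem exists_deltaBound_bracketGerm (h : ControlledBounds μ ℱ T a p M g X XX Y Y') (hT : 0 ≤ T)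
    (ha : 2 ≤ a) (hp : 0 < p) : ∃ C : ℝ, 0 ≤ C ∧
      ∀ s u t, 0 ≤ s → s ≤ u → u ≤ t → t ≤ T → DeltaBound μ (ℱ s) a p (g u - g s) (g t - g u)
        (bracketGerm XX Y Y' s t - bracketGerm XX Y Y' s u - bracketGerm XX Y Y' u t) C := by
  obtain ⟨C, hC, H⟩ := h.exists_deltaBound_compGerm hT ha hp (isC2Bounded_tmulL (E := E))
  refine ⟨C + C, by positivity, fun s u t hs hsu hut ht => ?_⟩
  have b := H s u t hs hsu hut ht
  have ha1 : 1 ≤ a := by linarith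
  refine (b.add ha1 (b.clm_comp_le_one ha1 (commL E E) norm_commL_le)).neg.congr
    (.of_forall fun ω => ?_)
  simp only [bracketGerm_eq, Pi.neg_apply, Pi.add_apply, Pi.sub_apply, map_sub]
  abel

theorem bracketGerm_stronglyMeasurable (h : ControlledBounds μ ℱ T a p M g X XX Y Y') {s t : ℝ}
    (hs : 0 ≤ s) (hst : s ≤ t) (ht : t ≤ T) :
    StronglyMeasurable[ℱ t] (bracketGerm XX Y Y' s t) := by
  have b := h.compGerm_stronglyMeasurable (isC2Bounded_tmulL (E := E)) hs hst ht
  rw [bracketGerm_eq]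
  exact (((h.tmul_stronglyMeasurable (hs.trans hst) ht).sub
    ((h.tmul_stronglyMeasurable hs (hst.trans ht)).mono (ℱ.mono hst))).sub b).sub
    ((commL E E).continuous.comp_stronglyMeasurable b)

theorem norm_bracketGerm_le (s t : ℝ) (ω : Ω) : ‖bracketGerm XX Y Y' s t ω‖ ≤
    ‖(Y t - Y s) ω‖ ^ 2 + 2 * (‖Y' s ω‖ * ‖Y' s ω‖) * ‖XX s t‖ := by
  refine (norm_sub_le _ _).trans (add_le_add ((norm_tmul_le _ _).trans_eq (sq _).symm) ?_)
  rw [norm_smul, Real.norm_of_nonneg zero_le_two, mul_assoc]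
  refine mul_le_mul_of_nonneg_left ?_ zero_le_two
  exact (norm_map_le _ _ _).trans (mul_le_mul_of_nonneg_left (norm_symPart_le _) (by positivity))

/-- Weighted bounds for the germ of the bracket. -/
theorem bracketGerm_le (h : ControlledBounds μ ℱ T a p M g X XX Y Y') (ha : 2 ≤ a) {s t : ℝ}
    (hs : 0 ≤ s) (hst : s ≤ t) (ht : t ≤ T) {ζ : Ω → ℝ} {d : ℝ} (hζ : StronglyMeasurable[ℱ s] ζ)
    (hd : LpBound μ (2 * a) ζ d) : LpBound μ a (fun ω => ζ ω * ‖bracketGerm XX Y Y' s t ω‖)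
      ((1 + 2 * (M * M)) * (d * (g t - g s) ^ (2 / p))) := by
  have ha1 : 1 ≤ a := by linarith
  have hx : 0 ≤ (g t - g s) ^ (2 / p) := Real.rpow_nonneg (sub_nonneg.2 (g.mono hst)) _
  have b1 := h.Y_sq s t hs hst ht ζ d hζ hd
  have mΓ := ((h.bracketGerm_stronglyMeasurable hs hst ht).mono (ℱ.le t)).aestronglyMeasurable (μ := μ)
  have c := h.Y'_bound s hs (hst.trans ht)
  have b2 : LpBound μ a (fun ω => ζ ω * (2 * (‖Y' s ω‖ * ‖Y' s ω‖) * ‖XX s t‖))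
      (2 * (g t - g s) ^ (2 / p) * (d * (M * M))) := by
    refine hd.of_norm_le_mul_mul (h.Y'_sq hs (hst.trans ht))
      (hd.meas.mul (((c.meas.norm.mul c.meas.norm).const_mul 2).mul_const _)) (by positivity)
      (.of_forall fun ω => ?_)
    change ‖ζ ω * (2 * (‖Y' s ω‖ * ‖Y' s ω‖) * ‖XX s t‖)‖ ≤ _
    rw [norm_mul, Real.norm_of_nonneg
      (by positivity : 0 ≤ 2 * (‖Y' s ω‖ * ‖Y' s ω‖) * ‖XX s t‖),
      Real.norm_of_nonneg (by positivity : 0 ≤ ‖Y' s ω‖ * ‖Y' s ω‖)]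
    calc _ = ‖ζ ω‖ * (2 * (‖Y' s ω‖ * ‖Y' s ω‖)) * ‖XX s t‖ := by ring
      _ ≤ ‖ζ ω‖ * (2 * (‖Y' s ω‖ * ‖Y' s ω‖)) * (g t - g s) ^ (2 / p) :=
        mul_le_mul_of_nonneg_left (h.XX_le s t hs hst ht) (by positivity)
      _ = _ := by ring
  have e1 := b1.meas.norm
  have e2 := b2.meas.norm
  refine (((b1.of_norm_le e1 (.of_forall fun ω => (norm_norm _).le)).add ha1
    (b2.of_norm_le e2 (.of_forall fun ω => (norm_norm _).le))).of_norm_le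
    (hd.meas.mul mΓ.norm) (.of_forall fun ω => ?_)).mono (le_of_eq (by ring))
  change ‖ζ ω * ‖bracketGerm XX Y Y' s t ω‖‖ ≤
    ‖‖ζ ω * ‖(Y t - Y s) ω‖ ^ 2‖ + ‖ζ ω * (2 * (‖Y' s ω‖ * ‖Y' s ω‖) * ‖XX s t‖)‖‖
  have hn := norm_bracketGerm_le (XX := XX) (Y := Y) (Y' := Y') s t ω
  rw [Real.norm_of_nonneg (by positivity : (0 : ℝ) ≤ ‖ζ ω * ‖(Y t - Y s) ω‖ ^ 2‖ +
    ‖ζ ω * (2 * (‖Y' s ω‖ * ‖Y' s ω‖) * ‖XX s t‖)‖), norm_mul, norm_mul, norm_mul, norm_norm,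
    Real.norm_of_nonneg (by positivity : (0 : ℝ) ≤ ‖(Y t - Y s) ω‖ ^ 2),
    Real.norm_of_nonneg (by positivity : (0 : ℝ) ≤ 2 * (‖Y' s ω‖ * ‖Y' s ω‖) * ‖XX s t‖),
    ← mul_add]
  exact mul_le_mul_of_nonneg_left hn (norm_nonneg _)

theorem bracketGerm_lpBound (h : ControlledBounds μ ℱ T a p M g X XX Y Y') (ha : 2 ≤ a) {s t : ℝ}
    (hs : 0 ≤ s) (hst : s ≤ t) (ht : t ≤ T) : LpBound μ a (bracketGerm XX Y Y' s t)
      ((1 + 2 * (M * M)) * (g t - g s) ^ (2 / p)) := by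
  have b := h.bracketGerm_le ha hs hst ht (ζ := fun _ => 1) stronglyMeasurable_const
    (LpBound.of_bound aestronglyMeasurable_const zero_le_one (by simp))
  rw [one_mul] at b
  exact b.of_norm_le ((h.bracketGerm_stronglyMeasurable hs hst ht).mono (ℱ.le t)).aestronglyMeasurable
    (.of_forall fun ω => by simp)

theorem exists_isSewable_bracketGerm (h : ControlledBounds μ ℱ T a p M g X XX Y Y') (hT : 0 ≤ T)
    (ha : 2 ≤ a) (hp : 0 < p) : ∃ C : ℝ, IsSewable μ ℱ T a p g C (bracketGerm XX Y Y') := by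
  obtain ⟨C, hC, H⟩ := h.exists_deltaBound_bracketGerm hT ha hp
  exact ⟨C, hC, fun s t hs hst ht => h.bracketGerm_stronglyMeasurable hs hst ht,
    fun s t hs hst ht => (h.bracketGerm_lpBound ha hs hst ht).memLp,
    fun s u t hs hsu hut ht => (H s u t hs hsu hut ht).size,
    fun s u t hs hsu hut ht => (H s u t hs hsu hut ht).cond⟩

/-- For Γ the bracket germ and H = Dφ(Y), the defect of HΓ is H_s applied to the defect of Γ, minus
(H_u - H_s)Γ_{u,t}. The first part inherits both bounds because H is bounded; the second has order
x^{1/p} y^{2/p} outright. -/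
theorem exists_isSewable_contract_bracketGerm (h : ControlledBounds μ ℱ T a p M g X XX Y Y')
    (hT : 0 ≤ T) (ha : 2 ≤ a) (hp : 0 < p) {φ : E → E →L[ℝ] F} (hφ : IsC2Bounded K φ) :
    ∃ C : ℝ, IsSewable μ ℱ T a p g C
      (fun s t ω => contract (fderiv ℝ φ (Y s ω)) (bracketGerm XX Y Y' s t ω)) := by
  obtain ⟨C, hC, H⟩ := h.exists_deltaBound_bracketGerm hT ha hp
  have ha1 : 1 ≤ a := by linarith
  have hK := hφ.nonneg
  have hM := h.M_nonneg hT
  have hA : ∀ s, 0 ≤ s → s ≤ T → StronglyMeasurable[ℱ s]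
      (fun ω => contractL E E F (fderiv ℝ φ (Y s ω))) := fun s hs hsT =>
    (contractL E E F).continuous.comp_stronglyMeasurable
      (hφ.continuous_fderiv.comp_stronglyMeasurable (h.adapted s ⟨hs, hsT⟩))
  have hAK : ∀ s ω, ‖contractL E E F (fderiv ℝ φ (Y s ω))‖ ≤ K := fun s ω =>
    ContinuousLinearMap.opNorm_le_bound _ hK fun τ => (norm_contract_le _ _).trans
      (mul_le_mul_of_nonneg_right (hφ.bound _) (norm_nonneg _))
  have hadap : ∀ s t, 0 ≤ s → s ≤ t → t ≤ T → StronglyMeasurable[ℱ t]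
      (fun ω => contract (fderiv ℝ φ (Y s ω)) (bracketGerm XX Y Y' s t ω)) :=
    fun s t hs hst ht => ((hA s hs (hst.trans ht)).mono (ℱ.mono hst)).clm_apply'
      (h.bracketGerm_stronglyMeasurable hs hst ht)
  set w := g T - g 0 with hw
  have hw0 : 0 ≤ w := sub_nonneg.2 (g.mono hT)
  have key : ∀ s u t, 0 ≤ s → s ≤ u → u ≤ t → t ≤ T →
      DeltaBound μ (ℱ s) a p (g u - g s) (g t - g u)
        ((fun ω => contract (fderiv ℝ φ (Y s ω)) (bracketGerm XX Y Y' s t ω)) -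
          (fun ω => contract (fderiv ℝ φ (Y s ω)) (bracketGerm XX Y Y' s u ω)) -
          (fun ω => contract (fderiv ℝ φ (Y u ω)) (bracketGerm XX Y Y' u t ω)))
        (K * C + K * (1 + 2 * (M * M)) * (1 + 2 * w ^ (1 / p))) := by
    intro s u t hs hsu hut ht
    have hu : u ≤ T := hut.trans ht
    have hu0 : 0 ≤ u := hs.trans hsu
    have hx : 0 ≤ g u - g s := sub_nonneg.2 (g.mono hsu)
    have hy : 0 ≤ g t - g u := sub_nonneg.2 (g.mono hut)
    have hxw : g u - g s ≤ w := sub_le_sub (g.mono hu) (g.mono hs)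
    have hyw : g t - g u ≤ w := sub_le_sub (g.mono ht) (g.mono hu0)
    have b1 := (H s u t hs hsu hut ht).bounded_apply (ℱ.le s) ha1 (hA s hs (hsu.trans hu)) hK
      (hAK s)
    have bd := h.Y_le s u hs hsu hu
    -- |H_u - H_s| is at most K|δY_{s,u}|, which is unbounded but known at u. It therefore serves as
    -- weight in `bracketGerm_le`, whereas Hölder's inequality against Γ in L^a would fail.
    have hζ : StronglyMeasurable[ℱ u] (fun ω => ‖(Y u - Y s) ω‖) :=
      ((h.adapted u ⟨hu0, hu⟩).sub ((h.adapted s ⟨hs, hsu.trans hu⟩).mono (ℱ.mono hsu))).norm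
    have b2 := h.bracketGerm_le ha hu0 hut ht hζ
      (bd.of_norm_le bd.meas.norm (.of_forall fun ω => (norm_norm _).le))
    have b3 : LpBound μ a (fun ω => (contractL E E F (fderiv ℝ φ (Y u ω)) -
        contractL E E F (fderiv ℝ φ (Y s ω))) (bracketGerm XX Y Y' u t ω))
        (K * ((1 + 2 * (M * M)) * ((g u - g s) ^ (1 / p) * (g t - g u) ^ (2 / p)))) := by
      refine b2.of_norm_le_mul ?_ hK (.of_forall fun ω => ?_)
      · exact ((((hA u hu0 hu).sub ((hA s hs (hsu.trans hu)).mono (ℱ.mono hsu))).mono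
          (ℱ.mono hut)).clm_apply' (h.bracketGerm_stronglyMeasurable hu0 hut ht)).mono
            (ℱ.le t) |>.aestronglyMeasurable
      · rw [← map_sub, contractL_apply, norm_mul, norm_norm, norm_norm, ← mul_assoc]
        exact (norm_contract_le _ _).trans (mul_le_mul_of_nonneg_right (hφ.lip _ _) (norm_nonneg _))
    refine (b1.sub ha1 (.of_lpBound ha1 hp hx hy hxw hyw (by positivity) (b3.mono ?_))).congr
      (.of_forall fun ω => ?_)
    · have : 0 ≤ K * (1 + 2 * (M * M)) * ((g u - g s) ^ (2 / p) * (g t - g u) ^ (1 / p)) := by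
        positivity
      linarith
    · simp only [Pi.sub_apply, sub_apply, contractL_apply, map_sub]
      abel
  have hC' : 0 ≤ K * C + K * (1 + 2 * (M * M)) * (1 + 2 * w ^ (1 / p)) := by positivity
  refine ⟨_, hC', hadap, fun s t hs hst ht => ?_, fun s u t hs hsu hut ht =>
    (key s u t hs hsu hut ht).size, fun s u t hs hsu hut ht => (key s u t hs hsu hut ht).cond⟩
  refine ((h.bracketGerm_lpBound ha hs hst ht).of_norm_le_mul
    ((hadap s t hs hst ht).mono (ℱ.le t)).aestronglyMeasurable hK (.of_forall fun ω => ?_)).memLp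
  exact (norm_contract_le _ _).trans (mul_le_mul_of_nonneg_right (hφ.bound _) (norm_nonneg _))

end ControlledBounds

end BracketGerm

end RoughIto

namespace RoughIto

/-! ### The rough integral, the bracket and the Young integral -/

section Integrals

variable {Ω : Type*} {m0 : MeasurableSpace Ω} {μ : Measure Ω} [IsProbabilityMeasure μ]
variable {G : Type*} [NormedAddCommGroup G] [NormedSpace ℝ G]

theorem inVpLq_of_lpBound {T a p C : ℝ} (hT : 0 ≤ T) (ha : 1 ≤ a) (hp : 0 < p)
    {g : StieltjesFunction ℝ} {Z : ℝ → Ω → G} (hm : ∀ t ∈ Icc 0 T, AEStronglyMeasurable (Z t) μ)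
    (h0 : MemLp (Z 0) (ENNReal.ofReal a) μ)
    (h : ∀ s t, 0 ≤ s → s ≤ t → t ≤ T → LpBound μ a (Z t - Z s) (C * (g t - g s) ^ (1 / p))) :
    InVpLq μ T p a Z := by
  refine ⟨hm, fun s hs => ?_, h0, ?_⟩
  · classical
    -- Convergence in measure is deduced for a family measurable at all times, while Z is controlled
    -- only on [0, T]; outside, it is replaced by zero.
    set Z' : ℝ → Ω → G := fun t => if t ∈ Icc 0 T then Z t else 0 with hZ'
    have hm' : ∀ t, AEStronglyMeasurable (Z' t) μ := fun t => by
      by_cases ht : t ∈ Icc 0 T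
      · simpa only [hZ', if_pos ht] using hm t ht
      · simpa only [hZ', if_neg ht] using aestronglyMeasurable_zero
    have he : ∀ᶠ t in 𝓝[>] s, Z' t = Z t ∧ s < t ∧ t ≤ T := by
      filter_upwards [Ioo_mem_nhdsGT hs.2] with t ht
      exact ⟨if_pos ⟨hs.1.trans ht.1.le, ht.2.le⟩, ht.1, ht.2.le⟩
    have hlim := (tendsto_stieltjes_sub_rpow g s (e := 1 / p) (by positivity)).const_mul C
    rw [mul_zero] at hlim
    have key : TendstoInMeasure μ Z' (𝓝[>] s) (Z s) := by
      refine LpBound.tendstoInMeasure ha hm' (hm s ⟨hs.1, hs.2.le⟩) ?_ hlim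
      filter_upwards [he] with t ht
      rw [ht.1]
      exact h s t hs.1 ht.2.1.le ht.2.2
    exact key.congr' (he.mono fun t ht => by rw [ht.1]) .rfl
  · have hC : 0 ≤ C * (g T - g 0) ^ (1 / p) := (h 0 T le_rfl hT le_rfl).nonneg
    have key : pVarPow p (fun s t => eLpNorm (Z t - Z s) (ENNReal.ofReal a) μ) 0 T ≤
        ENNReal.ofReal (|C| ^ p * (g T - g 0)) := by
      refine iSup_le fun P => ?_
      rw [P.sum_eq_seq]
      have hw : ∀ i, 0 ≤ g (P.seq (i + 1)) - g (P.seq i) := fun i =>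
        sub_nonneg.2 (g.mono (P.seq_mono i.le_succ))
      calc ∑ i ∈ Finset.range P.n, eLpNorm (Z (P.seq (i + 1)) - Z (P.seq i)) (ENNReal.ofReal a) μ ^ p
          ≤ ∑ i ∈ Finset.range P.n,
            ENNReal.ofReal (|C| ^ p * (g (P.seq (i + 1)) - g (P.seq i))) := by
            refine Finset.sum_le_sum fun i _ => ?_
            have b := (h _ _ (P.seq_mem i).1 (P.seq_mono i.le_succ) (P.seq_mem (i + 1)).2).mono
              (mul_le_mul_of_nonneg_right (le_abs_self C) (Real.rpow_nonneg (hw i) (1 / p)))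
            refine (ENNReal.rpow_le_rpow b.le hp.le).trans_eq ?_
            rw [ENNReal.ofReal_rpow_of_nonneg b.nonneg hp.le, Real.mul_rpow (abs_nonneg _)
              (Real.rpow_nonneg (hw i) _), ← Real.rpow_mul (hw i), one_div_mul_cancel hp.ne',
              Real.rpow_one]
        _ = ENNReal.ofReal (|C| ^ p * (g T - g 0)) := by
            rw [← ENNReal.ofReal_sum_of_nonneg fun i _ =>
              mul_nonneg (Real.rpow_nonneg (abs_nonneg _) _) (hw i), ← Finset.mul_sum,
              Finset.sum_range_sub (fun i => g (P.seq i)), P.seq_eq le_rfl, P.seq_eq zero_le,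
              P.first, P.last]
    rw [pVar]
    exact (ENNReal.rpow_le_rpow key (by positivity)).trans_lt
      (ENNReal.rpow_lt_top_of_nonneg (by positivity) ENNReal.ofReal_ne_top)

/-- A small mesh forces small oscillation of g along the partition, so a rate in ε is a rate in the
mesh. -/
theorem isMeshLimit_of_osc {T a p K : ℝ} (hp : 2 ≤ p) (hp' : p < 3) {g : StieltjesFunction ℝ}
    {Ξ : ℝ → ℝ → Ω → G} {s t : ℝ} (hs : 0 ≤ s) (ht : t ≤ T) {L : Ω → G}
    (hL : MemLp L (ENNReal.ofReal a) μ)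
    (h : ∀ (P : TimePartition s t) (ε : ℝ), 0 < ε → P.Osc g ε →
      LpBound μ a (L - P.sum Ξ) (K * sewRate p ε)) : IsMeshLimit μ a Ξ s t L := by
  refine ⟨hL, fun η hη => ?_⟩
  obtain ⟨r, hr, hrη⟩ := ENNReal.lt_iff_exists_nnreal_btwn.1 hη
  obtain ⟨ε, hε, hεη⟩ := exists_sewRate_le hp hp' (K := K)
    (NNReal.coe_pos.2 (ENNReal.coe_pos.1 hr))
  obtain ⟨δ, hδ, H⟩ := exists_mesh_osc g T hε
  refine ⟨δ, hδ, fun P hP => ?_⟩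
  refine (h P ε hε (H P hs ht hP)).le.trans (le_trans ?_ hrη.le)
  rw [← ENNReal.ofReal_coe_nnreal]
  exact ENNReal.ofReal_le_ofReal hεη

theorem IsMeshLimit.congr {a s t : ℝ} {Ξ : ℝ → ℝ → Ω → G} {L L' : Ω → G}
    (h : IsMeshLimit μ a Ξ s t L) (hL : L =ᵐ[μ] L') : IsMeshLimit μ a Ξ s t L' := by
  refine ⟨(memLp_congr_ae hL).1 h.1, fun ε hε => ?_⟩
  obtain ⟨δ, hδ, H⟩ := h.2 ε hε
  refine ⟨δ, hδ, fun P hP => (eLpNorm_congr_ae ?_).trans_le (H P hP)⟩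
  filter_upwards [hL] with ω hω
  simp [hω]

variable {V E F : Type*} [NormedAddCommGroup V] [NormedSpace ℝ V] [FiniteDimensional ℝ V]
  [NormedAddCommGroup E] [NormedSpace ℝ E] [FiniteDimensional ℝ E]
  [NormedAddCommGroup F] [NormedSpace ℝ F] [FiniteDimensional ℝ F]
variable {ℱ : Filtration ℝ m0} {T a p M K : ℝ} {g : StieltjesFunction ℝ} {X : ℝ → V}
  {XX : ℝ → ℝ → V ⊗[ℝ] V} {Y : ℝ → Ω → E} {Y' : ℝ → Ω → V →L[ℝ] E}

theorem IsC3b.exists_isC2Bounded {f : E → F} (hf : IsC3b f) :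
    ∃ K, IsC2Bounded K f ∧ IsC2Bounded K (fderiv ℝ f) := by
  obtain ⟨h1, ⟨C, hC⟩, L, hL⟩ := hf
  have hC0 : 0 ≤ C := (norm_nonneg _).trans (hC 0).1
  have h2 : Differentiable ℝ (fderiv ℝ f) :=
    (h1.fderiv_right (m := 1) (by norm_num)).differentiable (by norm_num)
  have hlip : ∀ y z, ‖fderiv ℝ f y - fderiv ℝ f z‖ ≤ C * ‖y - z‖ := fun y z =>
    convex_univ.norm_image_sub_le_of_norm_fderiv_le (fun x _ => h2 x) (fun x _ => (hC x).2.2)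
      (mem_univ z) (mem_univ y)
  have hm : ∀ y z : E, 0 ≤ ‖y - z‖ := fun y z => norm_nonneg _
  refine ⟨C + L, ⟨by positivity, h1.differentiable (by norm_num), fun y => ?_, fun y z => ?_⟩,
    ⟨by positivity, h2, fun y => ?_, fun y z => ?_⟩⟩
  · exact (hC y).2.1.trans (le_add_of_nonneg_right L.2)
  · exact (hlip y z).trans (mul_le_mul_of_nonneg_right (le_add_of_nonneg_right L.2) (hm y z))
  · exact (hC y).2.2.trans (le_add_of_nonneg_right L.2)
  · have := hL.dist_le_mul y z
    rw [dist_eq_norm, dist_eq_norm] at this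
    exact this.trans (mul_le_mul_of_nonneg_right (le_add_of_nonneg_left hC0) (hm y z))

namespace ControlledBounds

/-- The bound on φ itself serves the p-variation: it makes the leading term φ(Y_s)δY of order (g t -
g s)^{1/p}. The sewing error and the term in 𝕏 have order 2/p, and half of that exponent is absorbed
into the constant. -/
theorem exists_controlledIntegral (h : ControlledBounds μ ℱ T a p M g X XX Y Y') (hT : 0 ≤ T)
    (ha : 2 ≤ a) (hp : 2 ≤ p) (hp' : p < 3) {φ : E → E →L[ℝ] F} (hφ : IsC2Bounded K φ)
    (hφK : ∀ y, ‖φ y‖ ≤ K) :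
    ∃ I : ℝ → Ω → F, IsControlledIntegral μ ℱ T p (2 * a) XX (fun s ω => φ (Y s ω))
      (fun s ω => (fderiv ℝ φ (Y s ω)).comp (Y' s ω)) Y Y' I := by
  have ha1 : 1 ≤ a := by linarith
  have hp0 : 0 < p := by linarith
  obtain ⟨C, hC⟩ := h.exists_isSewable_compGerm hT ha hp0 hφ
  obtain ⟨I, K', hK', hI0, hIa, hconv, -, hglob⟩ := hC.exists_integral ha hp hp'
  have e2 : 2 * a / 2 = a := by ring
  have hm : ∀ t ∈ Icc 0 T, AEStronglyMeasurable (I t) μ := fun t ht =>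
    ((hIa t ht).mono (ℱ.le t)).aestronglyMeasurable
  have hδ : ∀ s t, 0 ≤ s → s ≤ t → t ≤ T → LpBound μ a (I t - I s)
      ((K' * (g T - g 0) ^ (1 / p) + (K + K * (M * M) * (g T - g 0) ^ (1 / p))) *
        (g t - g s) ^ (1 / p)) := by
    intro s t hs hst ht
    have hx : 0 ≤ g t - g s := sub_nonneg.2 (g.mono hst)
    have hxw : (g t - g s) ^ (1 / p) ≤ (g T - g 0) ^ (1 / p) :=
      Real.rpow_le_rpow hx (sub_le_sub (g.mono ht) (g.mono hs)) (by positivity)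
    have hx1 : 0 ≤ (g t - g s) ^ (1 / p) := by positivity
    have ex : (g t - g s) ^ (2 / p) = (g t - g s) ^ (1 / p) * (g t - g s) ^ (1 / p) := by
      rw [← Real.rpow_add_of_nonneg hx (by positivity) (by positivity)]; congr 1; ring
    have hx2 : (g t - g s) ^ (2 / p) ≤ (g T - g 0) ^ (1 / p) * (g t - g s) ^ (1 / p) := by
      rw [ex]; exact mul_le_mul_of_nonneg_right hxw hx1
    have hM := h.M_nonneg hT
    have bJ := h.integralGerm_memLp ha hφ hs hst ht
    have b1 : LpBound μ a (fun ω => φ (Y s ω) (Y t ω - Y s ω)) (K * (g t - g s) ^ (1 / p)) :=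
      ((h.Y_le s t hs hst ht).exponent_mono (by linarith)).of_norm_le_mul bJ.1.1 hφ.nonneg
        (.of_forall fun ω => ((φ (Y s ω)).le_opNorm _).trans
          (mul_le_mul_of_nonneg_right (hφK _) (norm_nonneg _)))
    have b := (hglob s t hs hst ht).add ha1 (b1.add ha1 bJ.2)
    refine (b.mono ?_).congr (.of_forall fun ω => ?_)
    · have c1 := mul_le_mul_of_nonneg_left hx2 hK'
      have c2 := mul_le_mul_of_nonneg_left hx2 (mul_nonneg hφ.nonneg (mul_nonneg hM hM))
      linarith
    · simp only [Pi.add_apply, Pi.sub_apply, compGerm_apply]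
      abel
  have h0 : MemLp (I 0) (ENNReal.ofReal a) μ := (memLp_congr_ae (hI0 hT)).2 (MemLp.zero)
  refine ⟨I, hIa, ?_, hI0 hT, fun s t hs hst ht => ?_⟩
  · rw [e2]
    exact inVpLq_of_lpBound hT ha1 hp0 hm h0 hδ
  · rw [e2]
    exact isMeshLimit_of_osc hp hp' hs ht (hδ s t hs hst ht).memLp
      fun P ε hε hP => hconv P ε hs ht hε hP

/-- The bracket, the Young integral against it, and the convergence of the sums over the germ of
the bracket. -/
theorem exists_bracket_youngIntegral (h : ControlledBounds μ ℱ T a p M g X XX Y Y') (hT : 0 ≤ T)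
    (ha : 2 ≤ a) (hp : 2 ≤ p) (hp' : p < 3) {φ : E → E →L[ℝ] F} (hφ : IsC2Bounded K φ) :
    ∃ (B : ℝ → Ω → E ⊗[ℝ] E) (Z : ℝ → Ω → F), IsBracket μ ℱ T p (2 * a) XX Y Y' B ∧
      IsYoungIntegral μ T (2 * a / 2) (fun s ω => fderiv ℝ φ (Y s ω)) B Z ∧
      ∀ s t : ℝ, 0 ≤ s → s ≤ t → t ≤ T → IsMeshLimit μ a
        (fun u v ω => contract (fderiv ℝ φ (Y u ω)) (bracketGerm XX Y Y' u v ω)) s t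
        (Z t - Z s) := by
  have ha1 : 1 ≤ a := by linarith
  have hp0 : 0 < p := by linarith
  have hM := h.M_nonneg hT
  obtain ⟨C₁, hC₁⟩ := h.exists_isSewable_bracketGerm hT ha hp0
  obtain ⟨B, K₁, hK₁, hB0, hBa, hBconv, hBloc, hBglob⟩ := hC₁.exists_integral ha hp hp'
  obtain ⟨C₂, hC₂⟩ := h.exists_isSewable_contract_bracketGerm hT ha hp0 hφ
  obtain ⟨Z, K₂, hK₂, hZ0, hZa, hZconv, -, hZglob⟩ := hC₂.exists_integral ha hp hp'
  obtain ⟨K₃, hK₃, hsum⟩ := exists_lpBound_partition_sum (m0 := m0) μ F ha g T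
  have e2 : 2 * a / 2 = a := by ring
  have hm : ∀ t ∈ Icc 0 T, AEStronglyMeasurable (B t) μ := fun t ht =>
    ((hBa t ht).mono (ℱ.le t)).aestronglyMeasurable
  have h0 : MemLp (B 0) (ENNReal.ofReal a) μ := (memLp_congr_ae (hB0 hT)).2 (MemLp.zero)
  have hδ : ∀ s t, 0 ≤ s → s ≤ t → t ≤ T → LpBound μ a (B t - B s)
      ((K₁ + (1 + 2 * (M * M))) * (g t - g s) ^ (2 / p)) := by
    intro s t hs hst ht
    have b := (hBglob s t hs hst ht).add ha1 (h.bracketGerm_lpBound ha hs hst ht)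
    rw [sub_add_cancel] at b
    exact b.mono (le_of_eq (add_mul _ _ _).symm)
  have hZδ : ∀ s t, 0 ≤ s → s ≤ t → t ≤ T → MemLp (Z t - Z s) (ENNReal.ofReal a) μ := by
    intro s t hs hst ht
    have b := (hZglob s t hs hst ht).memLp.add (hC₂.memLp s t hs hst ht)
    rwa [sub_add_cancel] at b
  refine ⟨B, Z, ⟨hBa, ?_, fun t ht => ?_⟩, ⟨hZ0 hT, fun s t hs hst ht => ?_⟩,
    fun s t hs hst ht => isMeshLimit_of_osc hp hp' hs ht (hZδ s t hs hst ht)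
      fun P ε hε hP => hZconv P ε hs ht hε hP⟩
  · rw [e2]
    refine inVpLq_of_lpBound hT ha1 (by positivity) hm h0 (g := g) (C := K₁ + (1 + 2 * (M * M))) ?_
    rwa [show 1 / (p / 2) = 2 / p by field_simp]
  · rw [e2]
    refine IsMeshLimit.congr (isMeshLimit_of_osc (K := K₁) hp hp' le_rfl ht.2
      (hδ 0 t le_rfl ht.1 ht.2).memLp fun P ε hε hP => hBconv P ε le_rfl ht.2 hε hP) ?_
    filter_upwards [hB0 hT] with ω hω
    simp [hω]
  · rw [e2]
    -- The sewn integral Z of the contracted germ is also the Young integral: replacing the germ by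
    -- δB in the Riemann sum changes it by a sum that vanishes with ε. The constant is the rate for
    -- Z plus the rate of this replacement.
    refine isMeshLimit_of_osc (g := g) (K := K₂ + K₃ * (K * K₁)) hp hp' hs ht (hZδ s t hs hst ht)
      fun P ε hε hP => ?_
    have hA : ∀ s, 0 ≤ s → s ≤ T → StronglyMeasurable[ℱ s]
        (fun ω => contractL E E F (fderiv ℝ φ (Y s ω))) := fun s hs hsT =>
      (contractL E E F).continuous.comp_stronglyMeasurable
        (hφ.continuous_fderiv.comp_stronglyMeasurable (h.adapted s ⟨hs, hsT⟩))
    have hb : ∀ {s} {R : Ω → E ⊗[ℝ] E} {c : ℝ}, 0 ≤ s → s ≤ T → LpBound μ a R c →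
        LpBound μ a (fun ω => contract (fderiv ℝ φ (Y s ω)) (R ω)) (K * c) := by
      intro s R c hs hsT hR
      exact hR.of_norm_le_mul
        ((ContinuousLinearMap.id ℝ (E ⊗[ℝ] E →L[ℝ] F)).aestronglyMeasurable_comp₂
          ((hA s hs hsT).mono (ℱ.le s)).aestronglyMeasurable hR.meas) hφ.nonneg
        (.of_forall fun ω => (norm_contract_le _ _).trans
          (mul_le_mul_of_nonneg_right (hφ.bound _) (norm_nonneg _)))
    set R : ℕ → Ω → E ⊗[ℝ] E := fun i => B (P.seq (i + 1)) - B (P.seq i) -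
      bracketGerm XX Y Y' (P.seq i) (P.seq (i + 1)) with hR
    have hmem : ∀ i, 0 ≤ P.seq i ∧ P.seq i ≤ T := fun i =>
      ⟨hs.trans (P.seq_mem i).1, (P.seq_mem i).2.trans ht⟩
    have hlt : ∀ i < P.n, P.seq i < P.seq (i + 1) := fun i hi => by
      rw [P.seq_eq hi.le, P.seq_eq hi]; exact P.lt_succ i hi
    have hosc : ∀ i < P.n, OscLE g ε (P.seq i) (P.seq (i + 1)) := fun i hi => by
      rw [P.seq_eq hi.le, P.seq_eq hi]; exact hP i hi
    have hRa : ∀ i, StronglyMeasurable[ℱ (P.seq (i + 1))] (R i) := fun i =>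
      ((hBa _ (hmem _)).sub ((hBa _ (hmem i)).mono (ℱ.mono (P.seq_mono i.le_succ)))).sub
        (h.bracketGerm_stronglyMeasurable (hmem i).1 (P.seq_mono i.le_succ) (hmem _).2)
    have hRb := fun i (hi : i < P.n) => hBloc (P.seq i) (P.seq (i + 1)) ε (hmem i).1 (hlt i hi)
      (hmem _).2 hε (hosc i hi)
    -- D²-type factors are bounded and known at the left endpoint, so they preserve both the size
    -- and the conditional mean of the errors R. These then add up like martingale increments plus
    -- drift.
    have b := hsum P ℱ (fun i ω => contract (fderiv ℝ φ (Y (P.seq i) ω)) (R i ω)) (K * K₁)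
      (ε ^ (3 / p - 1)) hs ht (mul_nonneg hφ.nonneg hK₁) (by positivity)
      (fun i => ((hA _ (hmem i).1 (hmem i).2).mono (ℱ.mono (P.seq_mono i.le_succ))).clm_apply'
        (hRa i))
      (fun i hi => (hb (hmem i).1 (hmem i).2 (hRb i hi).1).mono (by rw [mul_assoc]))
      (fun i hi => by
        refine ((hb (hmem i).1 (hmem i).2 (hRb i hi).2).mono (by rw [mul_assoc])).congr ?_
        exact (condExp_bilin_of_stronglyMeasurable_left
          (ContinuousLinearMap.id ℝ (E ⊗[ℝ] E →L[ℝ] F)) (hA _ (hmem i).1 (hmem i).2)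
          ((hb (hmem i).1 (hmem i).2 (hRb i hi).1).integrable ha1)
          ((hRb i hi).1.integrable ha1)).symm)
    refine (((hZconv P ε hs ht hε hP).sub ha1 b).mono ?_).congr (.of_forall fun ω => ?_)
    · rw [add_mul]; rfl
    · simp only [Pi.sub_apply, P.sum_eq_seq, Finset.sum_apply, hR, map_sub,
        Finset.sum_sub_distrib]
      abel

end ControlledBounds

end Integrals

end RoughIto

namespace RoughIto

/-! ### Taylor expansion -/

section Taylor

variable {E F : Type*} [NormedAddCommGroup E] [NormedSpace ℝ E]
  [NormedAddCommGroup F] [NormedSpace ℝ F]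

/-- The remainder of the second order Taylor expansion of `f` at `y`. -/
noncomputable def taylorRem (f : E → F) (y z : E) : F :=
  f z - f y - fderiv ℝ f y (z - y) - (1 / 2 : ℝ) • fderiv ℝ (fderiv ℝ f) y (z - y) (z - y)

/-- `f` is twice differentiable with symmetric, bounded and Lipschitz second derivative. -/
structure IsC3Bounded (K : ℝ) (f : E → F) : Prop where
  isC2 : IsC2Bounded K f
  isC2' : IsC2Bounded K (fderiv ℝ f)
  symm : ∀ y v w, fderiv ℝ (fderiv ℝ f) y v w = fderiv ℝ (fderiv ℝ f) y w v

namespace IsC3Bounded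

variable {K : ℝ} {f : E → F}

/-- Mean value inequality for f minus its quadratic part. By symmetry of D²f the derivative at x is
Df(x) - D²f(y)(x - y), which stays within K|z - y|² of Df(y) along the segment. -/
theorem norm_taylorRem_le (h : IsC3Bounded K f) (y z : E) :
    ‖taylorRem f y z‖ ≤ K * ‖z - y‖ ^ 3 := by
  set D := fderiv ℝ (fderiv ℝ f) y with hD
  have hderiv : ∀ x, HasFDerivAt (fun z => f z - (1 / 2 : ℝ) • D (z - y) (z - y))
      (fderiv ℝ f x - D (x - y)) x := by
    intro x
    have h1 : HasFDerivAt (fun z : E => z - y) (ContinuousLinearMap.id ℝ E) x :=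
      (hasFDerivAt_id x).sub_const y
    have h2 : HasFDerivAt (fun z : E => D (z - y)) D x :=
      (D.hasFDerivAt.comp x h1).congr_fderiv D.comp_id
    have h3 := ((h.isC2.diff x).hasFDerivAt).sub ((h2.clm_apply h1).const_smul (1 / 2 : ℝ))
    refine h3.congr_fderiv ?_
    ext v
    simp only [sub_apply, smul_apply, add_apply, ContinuousLinearMap.comp_apply,
      ContinuousLinearMap.flip_apply, ContinuousLinearMap.id_apply]
    rw [hD, h.symm y v (x - y), ← two_smul ℝ, smul_smul]
    norm_num
  have h1 : ∀ x ∈ segment ℝ y z, ‖fderiv ℝ f x - D (x - y) - fderiv ℝ f y‖ ≤ K * ‖z - y‖ ^ 2 := by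
    intro x hx
    have e := h.isC2'.taylor y x
    rw [sub_right_comm] at e
    refine e.trans (mul_le_mul_of_nonneg_left ?_ h.isC2.nonneg)
    exact pow_le_pow_left₀ (norm_nonneg _) (norm_sub_le_of_mem_segment hx) 2
  have h2 := (convex_segment y z).norm_image_sub_le_of_norm_hasFDerivWithin_le'
    (fun x _ => (hderiv x).hasFDerivWithinAt) h1 (left_mem_segment ℝ y z) (right_mem_segment ℝ y z)
  refine le_trans (le_of_eq ?_) (h2.trans_eq (by ring))
  congr 1
  simp only [taylorRem, sub_self, map_zero, smul_zero, sub_zero, ← hD]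
  abel

/-- Expanding at x by way of y: symmetry merges the cross terms, and the corrections are the Taylor
errors of Df and D²f between x and y, applied to z - y. -/
theorem taylorRem_three_point (h : IsC3Bounded K f) (x y z : E) :
    taylorRem f x z = taylorRem f y z + taylorRem f x y +
      (fderiv ℝ f y - fderiv ℝ f x - fderiv ℝ (fderiv ℝ f) x (y - x)) (z - y) +
      (1 / 2 : ℝ) • (fderiv ℝ (fderiv ℝ f) y - fderiv ℝ (fderiv ℝ f) x) (z - y) (z - y) := by
  have e : z - x = (z - y) + (y - x) := by abel
  have hs := h.symm x (z - y) (y - x)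
  simp only [taylorRem, e, map_add, sub_apply, add_apply, smul_add, smul_sub, hs]
  have h2 : fderiv ℝ (fderiv ℝ f) x (y - x) (z - y) =
      (1 / 2 : ℝ) • fderiv ℝ (fderiv ℝ f) x (y - x) (z - y) +
      (1 / 2 : ℝ) • fderiv ℝ (fderiv ℝ f) x (y - x) (z - y) := by
    rw [← add_smul]; norm_num
  nth_rewrite 3 [h2]
  abel

/-- The point of this bound is that it is linear in the displacement of (y, z) and only quadratic in
the overall size: a small displacement then makes the difference small even across a large jump. -/
theorem norm_taylorRem_sub_le (h : IsC3Bounded K f) (y z y' z' : E) :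
    ‖taylorRem f y z - taylorRem f y' z'‖ ≤
      6 * K * ((‖y - y'‖ + ‖z - z'‖) * (‖z - y‖ + ‖y - y'‖ + ‖z - z'‖) *
        (‖z - y‖ + ‖y - y'‖ + ‖z - z'‖)) := by
  have hK := h.isC2.nonneg
  have key : ∀ a b c : E, ‖taylorRem f a c - taylorRem f b c - taylorRem f a b‖ ≤
      K * ‖b - a‖ ^ 2 * ‖c - b‖ + 1 / 2 * (K * ‖b - a‖ * ‖c - b‖ * ‖c - b‖) := by
    intro a b c
    rw [h.taylorRem_three_point a b c]
    have e : ∀ p q r s : F, p + q + r + s - p - q = r + s := fun p q r s => by abel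
    rw [e]
    refine (norm_add_le _ _).trans (add_le_add ?_ ?_)
    · exact (ContinuousLinearMap.le_opNorm _ _).trans
        (mul_le_mul_of_nonneg_right (h.isC2'.taylor a b) (norm_nonneg _))
    · rw [norm_smul, Real.norm_of_nonneg (by norm_num : (0 : ℝ) ≤ 1 / 2)]
      refine mul_le_mul_of_nonneg_left ?_ (by norm_num)
      refine (ContinuousLinearMap.le_opNorm₂ _ _ _).trans ?_
      gcongr
      exact h.isC2'.lip b a
  have k1 := key y z' z
  have k2 := key y' y z'
  have r1 := h.norm_taylorRem_le z' z
  have r2 := h.norm_taylorRem_le y' y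
  have hS : ‖z' - y‖ ≤ ‖z - y‖ + ‖z - z'‖ := by
    have := norm_sub_le (z - y) (z - z')
    rwa [sub_sub_sub_cancel_left] at this
  -- Both remainders are compared with the remainder from y to z', changing one argument at a time.
  have e : taylorRem f y z - taylorRem f y' z' =
      (taylorRem f y z - taylorRem f z' z - taylorRem f y z') + taylorRem f z' z -
      ((taylorRem f y' z' - taylorRem f y z' - taylorRem f y' y) + taylorRem f y' y) := by abel
  rw [e]
  refine (norm_sub_le _ _).trans ((add_le_add ((norm_add_le _ _).trans (add_le_add k1 r1))
    ((norm_add_le _ _).trans (add_le_add k2 r2))).trans ?_)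
  have n1 := norm_nonneg (z' - y)
  have n2 := norm_nonneg (z - z')
  have n3 := norm_nonneg (y - y')
  have n4 := norm_nonneg (z - y)
  generalize ‖z' - y‖ = α at *
  generalize ‖z - z'‖ = β at *
  generalize ‖y - y'‖ = γ at *
  generalize ‖z - y‖ = ν at *
  set σ := ν + γ + β with hσ
  have a1 : α ≤ σ := by linarith
  have a2 : β ≤ σ := by linarith
  have a3 : γ ≤ σ := by linarith
  have σ0 : 0 ≤ σ := by linarith
  have t1 : K * α ^ 2 * β ≤ K * σ ^ 2 * β := by gcongr
  have t2 : K * α * β * β ≤ K * σ * β * σ := by gcongr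
  have t3 : K * β ^ 3 ≤ K * (σ ^ 2 * β) := by
    gcongr; calc β ^ 3 = β ^ 2 * β := by ring
      _ ≤ σ ^ 2 * β := by gcongr
  have t4 : K * γ ^ 2 * α ≤ K * (γ * σ) * σ := by
    rw [sq]; gcongr
  have t5 : K * γ * α * α ≤ K * γ * σ * σ := by gcongr
  have t6 : K * γ ^ 3 ≤ K * (σ ^ 2 * γ) := by
    gcongr; calc γ ^ 3 = γ ^ 2 * γ := by ring
      _ ≤ σ ^ 2 * γ := by gcongr
  have p1 : 0 ≤ K * (σ ^ 2 * β) := by positivity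
  have p2 : 0 ≤ K * (σ ^ 2 * γ) := by positivity
  linarith

theorem continuous_taylorRem (h : IsC3Bounded K f) :
    Continuous fun P : E × E => taylorRem f P.1 P.2 := by
  have c0 := h.isC2.diff.continuous
  have c1 := h.isC2'.diff.continuous
  have c2 := h.isC2'.continuous_fderiv
  have d : Continuous fun P : E × E => P.2 - P.1 := continuous_snd.sub continuous_fst
  have e1 : Continuous fun P : E × E => fderiv ℝ f P.1 (P.2 - P.1) :=
    (c1.comp continuous_fst).clm_apply d
  have e2 : Continuous fun P : E × E => fderiv ℝ (fderiv ℝ f) P.1 (P.2 - P.1) (P.2 - P.1) :=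
    ((c2.comp continuous_fst).clm_apply d).clm_apply d
  exact (((c0.comp continuous_snd).sub (c0.comp continuous_fst)).sub e1).sub (e2.const_smul _)

theorem taylorRem_self (y : E) : taylorRem f y y = 0 := by simp [taylorRem]

end IsC3Bounded

theorem IsC3b.exists_isC3Bounded [FiniteDimensional ℝ E] [FiniteDimensional ℝ F] {f : E → F}
    (hf : IsC3b f) : ∃ K, IsC3Bounded K f := by
  obtain ⟨K, h1, h2⟩ := hf.exists_isC2Bounded
  exact ⟨K, h1, h2, fun y v w => (hf.1.contDiffAt.isSymmSndFDerivAt (by simp)).eq v w⟩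

end Taylor

/-! ### Left limits -/

section LeftLimits

variable {Ω : Type*} {m0 : MeasurableSpace Ω} {μ : Measure Ω} [IsProbabilityMeasure μ]
variable {V E F : Type*} [NormedAddCommGroup V] [NormedSpace ℝ V] [FiniteDimensional ℝ V]
  [NormedAddCommGroup E] [NormedSpace ℝ E] [FiniteDimensional ℝ E]
  [NormedAddCommGroup F] [NormedSpace ℝ F] [FiniteDimensional ℝ F]
variable {ℱ : Filtration ℝ m0} {T a p M K : ℝ} {g : StieltjesFunction ℝ} {X : ℝ → V}
  {XX : ℝ → ℝ → V ⊗[ℝ] V} {Y : ℝ → Ω → E} {Y' : ℝ → Ω → V →L[ℝ] E}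

theorem tendsto_leftLim_sub_rpow (g : StieltjesFunction ℝ) (t : ℝ) {e : ℝ} (he : 0 < e) :
    Tendsto (fun u => (Function.leftLim g t - g u) ^ e) (𝓝[<] t) (𝓝 0) := by
  have h1 : Tendsto (fun u => Function.leftLim g t - g u) (𝓝[<] t) (𝓝 0) := by
    simpa using (g.mono.tendsto_leftLim t).const_sub (Function.leftLim g t)
  have := (Real.continuousAt_rpow_const 0 e (Or.inr he.le)).tendsto.comp h1
  rwa [Real.zero_rpow he.ne'] at this

namespace ControlledBounds

/-- As u increases to t, g u converges to its left limit, so Y_u is Cauchy in L^{2a}. Passing to the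
limit in the increment bounds gives the rate g(t-) - g(u) and bounds the jump of Y by that of g. -/
theorem exists_leftLimit (h : ControlledBounds μ ℱ T a p M g X XX Y Y') (ha : 2 ≤ a) (hp : 0 < p)
    {t : ℝ} (ht : 0 < t) (htT : t ≤ T) : ∃ L : Ω → E, MemLp L (ENNReal.ofReal (2 * a)) μ ∧
      (∀ u, 0 ≤ u → u < t →
        LpBound μ (2 * a) (Y u - L) ((Function.leftLim g t - g u) ^ (1 / p))) ∧
      LpBound μ (2 * a) (Y t - L) ((g t - Function.leftLim g t) ^ (1 / p)) := by
  have ha2 : 1 ≤ 2 * a := by linarith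
  have hgl : ∀ u, u < t → g u ≤ Function.leftLim g t := fun u hu => g.mono.le_leftLim hu
  have hgt : Function.leftLim g t ≤ g t := g.mono.leftLim_le le_rfl
  have hp1 : 0 < 1 / p := by positivity
  have hlim := tendsto_leftLim_sub_rpow g t hp1
  have hgap : ∀ u v, 0 ≤ u → u < t → 0 ≤ v → v < t → LpBound μ (2 * a) (Y u - Y v)
      (max ((Function.leftLim g t - g u) ^ (1 / p)) ((Function.leftLim g t - g v) ^ (1 / p))) := by
    intro u v hu hut hv hvt
    rcases le_total u v with huv | huv
    · have b := (h.Y_le u v hu huv (hvt.le.trans htT)).neg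
      rw [neg_sub] at b
      refine b.mono (le_max_of_le_left ?_)
      exact Real.rpow_le_rpow (sub_nonneg.2 (g.mono huv)) (by linarith [hgl v hvt]) hp1.le
    · refine (h.Y_le v u hv huv (hut.le.trans htT)).mono (le_max_of_le_right ?_)
      exact Real.rpow_le_rpow (sub_nonneg.2 (g.mono huv)) (by linarith [hgl u hut]) hp1.le
  have hex : ∀ n : ℕ, ∃ u, 0 ≤ u ∧ u < t ∧
      (Function.leftLim g t - g u) ^ (1 / p) < (1 / 2) ^ n := by
    intro n
    obtain ⟨u, h1, h2⟩ := ((hlim.eventually (gt_mem_nhds (show (0 : ℝ) < (1 / 2) ^ n by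
      positivity))).and (Ioo_mem_nhdsLT ht)).exists
    exact ⟨u, h2.1.le, h2.2, h1⟩
  choose u hu0 hut hu using hex
  have : CompleteSpace E := FiniteDimensional.complete ℝ E
  obtain ⟨L, hL, hLlim⟩ := Lp.cauchy_complete_eLpNorm (p := ENNReal.ofReal (2 * a)) (μ := μ)
    (by rw [← ENNReal.ofReal_one]; exact ENNReal.ofReal_le_ofReal ha2)
    (fun n => h.Y_memLp (u n) (hu0 n) ((hut n).le.trans htT))
    (B := fun n => ENNReal.ofReal ((1 / 2) ^ n))
    (by
      rw [← ENNReal.ofReal_tsum_of_nonneg (fun n => by positivity) summable_geometric_two]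
      exact ENNReal.ofReal_ne_top)
    (fun N n m hn hm => by
      have hN : ∀ k, N ≤ k → (Function.leftLim g t - g (u k)) ^ (1 / p) < (1 / 2) ^ N := fun k hk =>
        (hu k).trans_le (pow_le_pow_of_le_one (by norm_num) (by norm_num) hk)
      refine (hgap _ _ (hu0 n) (hut n) (hu0 m) (hut m)).le.trans_lt ?_
      exact (ENNReal.ofReal_lt_ofReal_iff (by positivity)).2 (max_lt (hN n hn) (hN m hm)))
  have hLr : Tendsto (fun n => (eLpNorm (Y (u n) - L) (ENNReal.ofReal (2 * a)) μ).toReal +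
      (1 / 2 : ℝ) ^ n) atTop (𝓝 0) := by
    have h2 := (ENNReal.tendsto_toReal ENNReal.zero_ne_top).comp hLlim
    have h3 := tendsto_pow_atTop_nhds_zero_of_lt_one (r := (1 / 2 : ℝ)) (by norm_num) (by norm_num)
    simpa using h2.add h3
  have hleft : ∀ v, 0 ≤ v → v < t →
      LpBound μ (2 * a) (Y v - L) ((Function.leftLim g t - g v) ^ (1 / p)) := by
    intro v hv hvt
    have hv0 : 0 ≤ (Function.leftLim g t - g v) ^ (1 / p) :=
      Real.rpow_nonneg (sub_nonneg.2 (hgl v hvt)) _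
    refine LpBound.of_forall_pos hv0 fun η hη => ?_
    obtain ⟨n, hn⟩ := (hLr.eventually (gt_mem_nhds hη)).exists
    have b := (hgap v (u n) hv hvt (hu0 n) (hut n)).add ha2
      ((h.Y_memLp (u n) (hu0 n) ((hut n).le.trans htT)).sub hL).lpBound
    rw [sub_add_sub_cancel] at b
    refine b.mono ?_
    have hmax : max ((Function.leftLim g t - g v) ^ (1 / p))
        ((Function.leftLim g t - g (u n)) ^ (1 / p)) ≤
        (Function.leftLim g t - g v) ^ (1 / p) + (1 / 2) ^ n :=
      max_le (le_add_of_nonneg_right (by positivity)) ((hu n).le.trans (le_add_of_nonneg_left hv0))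
    linarith
  refine ⟨L, hL, hleft, ?_⟩
  refine LpBound.of_forall_pos (Real.rpow_nonneg (sub_nonneg.2 hgt) _) fun η hη => ?_
  have hlim2 : Tendsto (fun u => (g t - g u) ^ (1 / p) + (Function.leftLim g t - g u) ^ (1 / p))
      (𝓝[<] t) (𝓝 ((g t - Function.leftLim g t) ^ (1 / p))) := by
    have h1 := (Real.continuousAt_rpow_const (g t - Function.leftLim g t) (1 / p)
      (Or.inr hp1.le)).tendsto.comp ((g.mono.tendsto_leftLim t).const_sub (g t))
    simpa using h1.add hlim
  obtain ⟨v, h1, h2⟩ := ((hlim2.eventually (gt_mem_nhds (lt_add_of_pos_right _ hη))).and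
    (Ioo_mem_nhdsLT ht)).exists
  have b := (h.Y_le v t h2.1.le h2.2.le htT).add ha2 (hleft v h2.1.le h2.2)
  rw [sub_add_sub_cancel] at b
  exact b.mono h1.le

end ControlledBounds

end LeftLimits

end RoughIto

namespace RoughIto

/-! ### Jumps -/

section Jumps

variable {Ω : Type*} {m0 : MeasurableSpace Ω} {μ : Measure Ω}

theorem exists_isL1Sum {ι G : Type*} [NormedAddCommGroup G] [CompleteSpace G]
    {J : ι → Ω → G} (hJ : ∀ i, MemLp (J i) 1 μ) (hs : ∑' i, eLpNorm (J i) 1 μ < ∞) :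
    ∃ S, IsL1Sum μ J S := by
  have hsum : Summable fun i => (hJ i).toLp (J i) := by
    refine Summable.of_norm ?_
    simp only [Lp.norm_toLp]
    exact ENNReal.summable_toReal hs.ne
  refine ⟨↑↑(∑' i, (hJ i).toLp (J i)), Lp.memLp _, hJ, hs, ?_⟩
  have h1 := tendsto_iff_edist_tendsto_0.1 hsum.hasSum
  refine h1.congr fun A => ?_
  rw [edist_comm, Lp.edist_def]
  refine eLpNorm_congr_ae ?_
  have h2 : ∀ᵐ ω ∂μ, ∀ i ∈ A, (((hJ i).toLp (J i) : Lp G 1 μ) : Ω → G) ω = J i ω := by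
    rw [Finset.eventually_all]
    exact fun i _ => (hJ i).coeFn_toLp
  filter_upwards [Lp.coeFn_fun_finsetSum A (fun i => (hJ i).toLp (J i)), h2] with ω h3 h4
  simp only [Pi.sub_apply, Finset.sum_apply, h3]
  rw [Finset.sum_congr rfl h4]

/-- The sum of the jumps of a monotone function is at most its increment. -/
theorem sum_jump_le (g : StieltjesFunction ℝ) {t : ℝ} (ht : 0 ≤ t) {A : Finset ℝ}
    (hA : (A : Set ℝ) ⊆ Ioc 0 t) : ∑ s ∈ A, (g s - Function.leftLim g s) ≤ g t - g 0 := by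
  have h0 : ∀ s, 0 ≤ g s - Function.leftLim g s := fun s => sub_nonneg.2 (g.mono.leftLim_le le_rfl)
  have h1 : ∑ s ∈ A, ENNReal.ofReal (g s - Function.leftLim g s) ≤ ENNReal.ofReal (g t - g 0) := by
    -- The jumps of g are the atoms of its Stieltjes measure.
    simp only [← StieltjesFunction.measure_singleton, ← StieltjesFunction.measure_Ioc]
    rw [sum_measure_singleton]
    exact measure_mono hA
  rw [← ENNReal.ofReal_sum_of_nonneg fun s _ => h0 s] at h1
  exact (ENNReal.ofReal_le_ofReal_iff (sub_nonneg.2 (g.mono ht))).1 h1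

variable [IsProbabilityMeasure μ]

/-- Since 2a ≥ 4, Hölder's inequality applies with U and V in L^4 and W in L^2. This is where cubic
remainders become integrable. -/
theorem lpBound_one_of_le_mul_mul {G : Type*} [NormedAddCommGroup G] {a : ℝ} (ha : 2 ≤ a)
    {U V W : Ω → ℝ} {u v w K : ℝ} (hU : LpBound μ (2 * a) U u) (hV : LpBound μ (2 * a) V v)
    (hW : LpBound μ (2 * a) W w) {Z : Ω → G} (hZ : AEStronglyMeasurable Z μ) (hK : 0 ≤ K)
    (hle : ∀ ω, ‖Z ω‖ ≤ K * (U ω * V ω * W ω)) : LpBound μ 1 Z (K * (u * v * w)) := by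
  have h1 : LpBound μ (2 * 1) (fun ω => U ω * V ω) (u * v) := by
    have := (hU.exponent_mono (b := 2 * (2 * 1)) (by linarith)).of_norm_le_mul_mul
      (hV.exponent_mono (by linarith)) (hU.meas.mul hV.meas) zero_le_one
      (.of_forall fun ω => by rw [one_mul, ← norm_mul]; rfl)
    rwa [one_mul] at this
  refine h1.of_norm_le_mul_mul (hW.exponent_mono (by linarith)) hZ hK (.of_forall fun ω => ?_)
  refine (hle ω).trans (mul_le_mul_of_nonneg_left ?_ hK)
  rw [← norm_mul]
  exact le_abs_self _

variable {E F : Type*} [NormedAddCommGroup E] [NormedSpace ℝ E] [FiniteDimensional ℝ E]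
  [NormedAddCommGroup F] [NormedSpace ℝ F] [FiniteDimensional ℝ F]

theorem jumpTerm_eq (f : E → F) (Y Ym : ℝ → Ω → E) (s : ℝ) :
    jumpTerm f Y Ym s = fun ω => taylorRem f (Ym s ω) (Y s ω) := by
  ext ω
  simp [jumpTerm, taylorRem, D2]

theorem LpBound.norm_fun {G : Type*} [NormedAddCommGroup G] {a c : ℝ} {Z : Ω → G}
    (h : LpBound μ a Z c) : LpBound μ a (fun ω => ‖Z ω‖) c :=
  h.of_norm_le h.meas.norm (.of_forall fun _ => (norm_norm _).le)

theorem lpBound_taylorRem {a K c : ℝ} (ha : 2 ≤ a) {f : E → F} (hf : IsC3Bounded K f)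
    {y z : Ω → E} (hy : AEStronglyMeasurable y μ) (hz : AEStronglyMeasurable z μ)
    (h : LpBound μ (2 * a) (z - y) c) :
    LpBound μ 1 (fun ω => taylorRem f (y ω) (z ω)) (K * (c * c * c)) := by
  refine lpBound_one_of_le_mul_mul ha h.norm_fun h.norm_fun h.norm_fun
    (hf.continuous_taylorRem.comp_aestronglyMeasurable (hy.prodMk hz)) hf.isC2.nonneg fun ω => ?_
  refine (hf.norm_taylorRem_le _ _).trans_eq ?_
  simp only [Pi.sub_apply]
  ring

theorem lpBound_taylorRem_sub {a K c d : ℝ} (ha : 2 ≤ a) {f : E → F} (hf : IsC3Bounded K f)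
    {y z y' z' : Ω → E} (hy : AEStronglyMeasurable y μ) (hz : AEStronglyMeasurable z μ)
    (hy' : AEStronglyMeasurable y' μ) (hz' : AEStronglyMeasurable z' μ)
    (h : LpBound μ (2 * a) (z - y) c) (h1 : LpBound μ (2 * a) (y - y') d)
    (h2 : LpBound μ (2 * a) (z - z') d) :
    LpBound μ 1 ((fun ω => taylorRem f (y ω) (z ω)) - fun ω => taylorRem f (y' ω) (z' ω))
      (6 * K * ((d + d) * (c + d + d) * (c + d + d))) := by
  have ha2 : 1 ≤ 2 * a := by linarith
  have b1 := h1.norm_fun.add ha2 h2.norm_fun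
  have b2 := (h.norm_fun.add ha2 h1.norm_fun).add ha2 h2.norm_fun
  exact lpBound_one_of_le_mul_mul ha b1 b2 b2
    ((hf.continuous_taylorRem.comp_aestronglyMeasurable (hy.prodMk hz)).sub
      (hf.continuous_taylorRem.comp_aestronglyMeasurable (hy'.prodMk hz')))
    (mul_nonneg (by norm_num) hf.isC2.nonneg) fun ω => hf.norm_taylorRem_sub_le _ _ _ _

variable {V : Type*} [NormedAddCommGroup V] [NormedSpace ℝ V] [FiniteDimensional ℝ V]
variable {ℱ : Filtration ℝ m0} {T a p M K : ℝ} {g : StieltjesFunction ℝ} {X : ℝ → V}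
  {XX : ℝ → ℝ → V ⊗[ℝ] V} {Y Ym : ℝ → Ω → E} {Y' : ℝ → Ω → V →L[ℝ] E}

/-- `Ym` is the process of left limits of `Y`, with rates given by `g`. -/
structure LeftLimits (μ : Measure Ω) (T a p : ℝ) (g : StieltjesFunction ℝ) (Y Ym : ℝ → Ω → E) :
    Prop where
  memLp : ∀ t, 0 < t → t ≤ T → MemLp (Ym t) (ENNReal.ofReal (2 * a)) μ
  left : ∀ u t, 0 ≤ u → u < t → t ≤ T →
    LpBound μ (2 * a) (Y u - Ym t) ((Function.leftLim g t - g u) ^ (1 / p))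
  jump : ∀ t, 0 < t → t ≤ T →
    LpBound μ (2 * a) (Y t - Ym t) ((g t - Function.leftLim g t) ^ (1 / p))

theorem rpow_one_div_mul_mul {x p : ℝ} (hx : 0 ≤ x) (hp : 0 < p) (hp' : p < 3) :
    x ^ (1 / p) * x ^ (1 / p) * x ^ (1 / p) = x ^ (3 / p - 1) * x := by
  have hΘ : 0 ≤ 3 / p - 1 := by
    rw [sub_nonneg, le_div_iff₀ hp]; linarith
  have hp1 : 0 ≤ 1 / p := by positivity
  nth_rewrite 5 [← Real.rpow_one x]
  rw [← Real.rpow_add_of_nonneg hx hp1 hp1, ← Real.rpow_add_of_nonneg hx (by positivity) hp1,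
    ← Real.rpow_add_of_nonneg hx hΘ zero_le_one]
  congr 1
  ring

/-- Write 1/p = (3/p - 1) + (1 - 2/p). The first exponent of m gives ε^{3/p-1}; the second is given
to w, which then has total power 1. -/
theorem rpow_one_div_mul_le {m ε w p : ℝ} (hm : 0 ≤ m) (hmε : m ≤ ε) (hmw : m ≤ w) (hp : 2 ≤ p)
    (hp' : p < 3) : m ^ (1 / p) * w ^ (1 / p) * w ^ (1 / p) ≤ ε ^ (3 / p - 1) * w := by
  have hw : 0 ≤ w := hm.trans hmw
  have hε : 0 ≤ ε := hm.trans hmε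
  have hεp : 0 ≤ ε ^ (3 / p - 1) := Real.rpow_nonneg hε _
  have hp0 : 0 < p := by linarith
  have hΘ : 0 ≤ 3 / p - 1 := by
    rw [sub_nonneg, le_div_iff₀ hp0]; linarith
  have h2 : 0 ≤ 1 - 2 / p := by
    rw [sub_nonneg, div_le_one hp0]; exact hp
  have hp1 : 0 ≤ 1 / p := by positivity
  have e1 : m ^ (1 / p) = m ^ (3 / p - 1) * m ^ (1 - 2 / p) := by
    rw [← Real.rpow_add_of_nonneg hm hΘ h2]; congr 1; ring
  have e2 : w = w ^ (1 - 2 / p) * w ^ (1 / p) * w ^ (1 / p) := by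
    rw [← Real.rpow_add_of_nonneg hw h2 hp1, ← Real.rpow_add_of_nonneg hw (by
      rw [show 1 - 2 / p + 1 / p = 1 - 1 / p by ring, sub_nonneg, div_le_one hp0]; linarith) hp1]
    conv_lhs => rw [← Real.rpow_one w]
    congr 1; ring
  calc m ^ (1 / p) * w ^ (1 / p) * w ^ (1 / p)
      = m ^ (3 / p - 1) * m ^ (1 - 2 / p) * w ^ (1 / p) * w ^ (1 / p) := by rw [e1]
    _ ≤ ε ^ (3 / p - 1) * w ^ (1 - 2 / p) * w ^ (1 / p) * w ^ (1 / p) := by gcongr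
    _ = ε ^ (3 / p - 1) * (w ^ (1 - 2 / p) * w ^ (1 / p) * w ^ (1 / p)) := by ring
    _ = _ := by rw [← e2]

namespace ControlledBounds

theorem jumpTerm_le (h : ControlledBounds μ ℱ T a p M g X XX Y Y') (hYm : LeftLimits μ T a p g Y Ym)
    (ha : 2 ≤ a) (hp : 0 < p) (hp' : p < 3) {f : E → F} (hf : IsC3Bounded K f) {s ε : ℝ}
    (hs : 0 < s) (hsT : s ≤ T) (hε : g s - Function.leftLim g s ≤ ε) :
    LpBound μ 1 (jumpTerm f Y Ym s) (K * (ε ^ (3 / p - 1) * (g s - Function.leftLim g s))) := by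
  have h0 : 0 ≤ g s - Function.leftLim g s := sub_nonneg.2 (g.mono.leftLim_le le_rfl)
  have hΘ : 0 ≤ 3 / p - 1 := by
    rw [sub_nonneg, le_div_iff₀ hp]; linarith
  rw [jumpTerm_eq]
  refine (lpBound_taylorRem ha hf (hYm.memLp s hs hsT).1 (h.Y_memLp s hs.le hsT).1
    (hYm.jump s hs hsT)).mono (mul_le_mul_of_nonneg_left ?_ hf.isC2.nonneg)
  rw [rpow_one_div_mul_mul h0 hp hp']
  gcongr

/-- Moving from Y_u to Y_{τ-} and from Y_v to Y_τ changes both arguments by at most m^{1/p}, where m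
≤ ε bounds the variation of g off the jump. The comparison of Taylor remainders then costs m^{1/p}
w^{2/p}. -/
theorem taylorRem_sub_jumpTerm_le (h : ControlledBounds μ ℱ T a p M g X XX Y Y')
    (hYm : LeftLimits μ T a p g Y Ym) (ha : 2 ≤ a) (hp : 2 ≤ p) (hp' : p < 3) {f : E → F}
    (hf : IsC3Bounded K f) {u v τ ε : ℝ} (hu : 0 ≤ u) (hv : v ≤ T) (hτ : τ ∈ Ioc u v)
    (h1 : ∀ y ∈ Ico u τ, g y - g u ≤ ε) (h2 : g v - g τ ≤ ε) :
    LpBound μ 1 ((fun ω => taylorRem f (Y u ω) (Y v ω)) - jumpTerm f Y Ym τ)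
      (108 * K * (ε ^ (3 / p - 1) * (g v - g u))) := by
  have hp0 : 0 < p := by linarith
  have hp1 : 0 ≤ 1 / p := by positivity
  have hτ0 : 0 < τ := hu.trans_lt hτ.1
  have hτT : τ ≤ T := hτ.2.trans hv
  have huv : u ≤ v := hτ.1.le.trans hτ.2
  have hul : g u ≤ Function.leftLim g τ := g.mono.le_leftLim hτ.1
  have hlτ : Function.leftLim g τ ≤ g τ := g.mono.leftLim_le le_rfl
  have hτv : g τ ≤ g v := g.mono hτ.2
  have h1' : Function.leftLim g τ - g u ≤ ε := by
    refine le_of_tendsto ((g.mono.tendsto_leftLim τ).sub_const (g u)) ?_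
    filter_upwards [Ico_mem_nhdsLT hτ.1] with y hy using h1 y hy
  set w := g v - g u with hw
  set m := max (Function.leftLim g τ - g u) (g v - g τ) with hm
  have hm0 : 0 ≤ m := le_max_of_le_right (sub_nonneg.2 hτv)
  have hmε : m ≤ ε := max_le h1' h2
  have hmw : m ≤ w := max_le (by linarith) (by linarith)
  have b := h.Y_le u v hu huv hv
  have b1 := (hYm.left u τ hu hτ.1 hτT).mono
    (Real.rpow_le_rpow (sub_nonneg.2 hul) (le_max_left _ (g v - g τ)) hp1)
  have b2 := (h.Y_le τ v hτ0.le hτ.2 hv).mono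
    (Real.rpow_le_rpow (sub_nonneg.2 hτv) (le_max_right (Function.leftLim g τ - g u) _) hp1)
  rw [jumpTerm_eq]
  refine (lpBound_taylorRem_sub ha hf (h.Y_memLp u hu (huv.trans hv)).1
    (h.Y_memLp v (hu.trans huv) hv).1 (hYm.memLp τ hτ0 hτT).1 (h.Y_memLp τ hτ0.le hτT).1
    b b1 b2).mono ?_
  have hmw' : m ^ (1 / p) ≤ w ^ (1 / p) := Real.rpow_le_rpow hm0 hmw hp1
  have hm1 : 0 ≤ m ^ (1 / p) := Real.rpow_nonneg hm0 _
  have hK := hf.isC2.nonneg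
  have key := rpow_one_div_mul_le hm0 hmε hmw hp hp'
  generalize m ^ (1 / p) = α at *
  generalize w ^ (1 / p) = β at *
  have hβ : 0 ≤ β := hm1.trans hmw'
  -- 108 = 6·2·3·3: two displacements, and each of the two size factors is at most 3β.
  calc 6 * K * ((α + α) * (β + α + α) * (β + α + α))
      ≤ 6 * K * ((α + α) * (β + β + β) * (β + β + β)) := by gcongr
    _ = 108 * K * (α * β * β) := by ring
    _ ≤ _ := by gcongr

/-- Each jump term is bounded in L^1 by a constant times the jump of g to the power 3/p, hence by
ε^{3/p-1} times the jump if the latter is at most ε, and the jumps of g have total at most g t - g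
0. The tail estimate allows an arbitrary finite set A of times, because the exceptional times of a
partition need not be jump times of Y. -/
theorem exists_jumpSum (h : ControlledBounds μ ℱ T a p M g X XX Y Y')
    (hYm : LeftLimits μ T a p g Y Ym) (ha : 2 ≤ a) (hp : 0 < p) (hp' : p < 3) {f : E → F}
    (hf : IsC3Bounded K f) {t : ℝ} (ht : 0 ≤ t) (htT : t ≤ T) :
    ∃ S : Ω → F, IsL1Sum μ (fun s : jumpTimes μ (2 * a) Y Ym t => jumpTerm f Y Ym s) S ∧
      ∀ (A : Finset ℝ) (ε : ℝ), 0 ≤ ε → (A : Set ℝ) ⊆ Ioc 0 t →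
        (∀ s ∈ Ioc 0 t, s ∉ A → g s - Function.leftLim g s ≤ ε) →
        LpBound μ 1 (S - ∑ s ∈ A, jumpTerm f Y Ym s) (K * (ε ^ (3 / p - 1) * (g t - g 0))) := by
  classical
  have hK := hf.isC2.nonneg
  have hΔ : ∀ s, 0 ≤ g s - Function.leftLim g s := fun s => sub_nonneg.2 (g.mono.leftLim_le le_rfl)
  have hW : 0 ≤ g t - g 0 := sub_nonneg.2 (g.mono ht)
  have hsub : ∀ s, s ∈ jumpTimes μ (2 * a) Y Ym t → s ∈ Ioc 0 t := fun s hs => ⟨hs.1, hs.2.1⟩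
  have hbd : ∀ s ∈ Ioc 0 t, g s - Function.leftLim g s ≤ g t - g 0 := fun s hs =>
    sub_le_sub (g.mono hs.2) (g.mono.le_leftLim hs.1)
  have hJ : ∀ s ∈ Ioc 0 t, ∀ ε, g s - Function.leftLim g s ≤ ε → LpBound μ 1 (jumpTerm f Y Ym s)
      (K * (ε ^ (3 / p - 1) * (g s - Function.leftLim g s))) := fun s hs ε hε =>
    h.jumpTerm_le hYm ha hp hp' hf hs.1 (hs.2.trans htT) hε
  have hfin : ∀ (A : Finset ℝ) ε, 0 ≤ ε → (A : Set ℝ) ⊆ Ioc 0 t →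
      (∀ s ∈ A, g s - Function.leftLim g s ≤ ε) →
      ∑ s ∈ A, K * (ε ^ (3 / p - 1) * (g s - Function.leftLim g s)) ≤
        K * (ε ^ (3 / p - 1) * (g t - g 0)) := by
    intro A ε hε hA _
    rw [← Finset.mul_sum, ← Finset.mul_sum]
    have := sum_jump_le g ht hA
    gcongr
  have hone : ENNReal.ofReal 1 = 1 := ENNReal.ofReal_one
  have hmap : ∀ A : Finset (jumpTimes μ (2 * a) Y Ym t),
      ((A.map (Function.Embedding.subtype _) : Finset ℝ) : Set ℝ) ⊆ Ioc 0 t := by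
    intro A s hs
    obtain ⟨x, _, rfl⟩ := Finset.mem_map.1 (Finset.mem_coe.1 hs)
    exact hsub _ x.2
  have hmem : ∀ s : jumpTimes μ (2 * a) Y Ym t, MemLp (jumpTerm f Y Ym s) 1 μ := fun s => by
    rw [← hone]; exact (hJ s (hsub _ s.2) _ (hbd s (hsub _ s.2))).memLp
  have hsum : ∑' s : jumpTimes μ (2 * a) Y Ym t, eLpNorm (jumpTerm f Y Ym s) 1 μ < ∞ := by
    refine lt_of_le_of_lt ?_ (ENNReal.ofReal_lt_top
      (r := K * ((g t - g 0) ^ (3 / p - 1) * (g t - g 0))))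
    rw [ENNReal.tsum_eq_iSup_sum]
    refine iSup_le fun A => ?_
    have e := hfin (A.map (Function.Embedding.subtype _)) (g t - g 0) hW (hmap A)
      (fun s hs => hbd s (hmap A hs))
    refine le_trans ?_ (ENNReal.ofReal_le_ofReal e)
    rw [ENNReal.ofReal_sum_of_nonneg fun s _ => mul_nonneg hK
      (mul_nonneg (Real.rpow_nonneg hW _) (hΔ s)), Finset.sum_map]
    refine Finset.sum_le_sum fun s _ => ?_
    rw [← hone]
    exact (hJ s (hsub _ s.2) _ (hbd s (hsub _ s.2))).le
  have : CompleteSpace F := FiniteDimensional.complete ℝ F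
  obtain ⟨S, hS⟩ := exists_isL1Sum hmem hsum
  refine ⟨S, hS, fun A ε hε hA hAε => ?_⟩
  refine LpBound.of_forall_pos (by positivity) fun η hη => ?_
  -- Times in A at which Y does not jump contribute a term that vanishes almost surely.
  have hzero : ∀ s ∈ A, s ∉ jumpTimes μ (2 * a) Y Ym t → jumpTerm f Y Ym s =ᵐ[μ] 0 := by
    intro s hs hs'
    have hst := hA (Finset.mem_coe.2 hs)
    have e : eLpNorm (Y s - Ym s) (ENNReal.ofReal (2 * a)) μ = 0 := by
      by_contra hne
      exact hs' ⟨hst.1, hst.2, hne⟩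
    have hm := (hYm.jump s hst.1 (hst.2.trans htT)).meas
    rw [eLpNorm_eq_zero_iff hm (by simp; linarith)] at e
    filter_upwards [e] with ω hω
    have : Y s ω = Ym s ω := sub_eq_zero.1 hω
    simp only [jumpTerm_eq, this, IsC3Bounded.taylorRem_self, Pi.zero_apply]
  set A' : Finset (jumpTimes μ (2 * a) Y Ym t) := A.subtype _ with hA'
  have hsumA : ∑ s ∈ A, jumpTerm f Y Ym s =ᵐ[μ] ∑ s ∈ A', jumpTerm f Y Ym (s : ℝ) := by
    rw [hA', Finset.sum_subtype_eq_sum_filter, Finset.sum_filter]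
    have : ∀ᵐ ω ∂μ, ∀ s ∈ A, s ∉ jumpTimes μ (2 * a) Y Ym t → jumpTerm f Y Ym s ω = 0 := by
      rw [Finset.eventually_all]
      intro s hs
      by_cases hs' : s ∈ jumpTimes μ (2 * a) Y Ym t
      · exact .of_forall fun ω h => absurd hs' h
      · filter_upwards [hzero s hs hs'] with ω hω _ using hω
    filter_upwards [this] with ω hω
    rw [Finset.sum_apply, Finset.sum_apply]
    refine Finset.sum_congr rfl fun s hs => ?_
    by_cases hs' : s ∈ jumpTimes μ (2 * a) Y Ym t
    · rw [if_pos hs']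
    · rw [if_neg hs', hω s hs hs']; rfl
  -- B contains A' and its partial sum is within η of S; the terms in B outside A' come from jumps
  -- of g of size at most ε.
  obtain ⟨B, hB, hB'⟩ := ((hS.2.2.2.eventually (gt_mem_nhds (ENNReal.ofReal_pos.2 hη))).and
    (eventually_ge_atTop A')).exists
  have b1 : LpBound μ 1 (S - ∑ s ∈ B, jumpTerm f Y Ym (s : ℝ)) η := by
    refine ⟨hS.1.1.sub ?_, hη.le, by rw [hone]; exact hB.le⟩
    exact Finset.aestronglyMeasurable_sum _ fun s _ => (hmem s).1
  have b2 : LpBound μ 1 (∑ s ∈ B \ A', jumpTerm f Y Ym (s : ℝ))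
      (K * (ε ^ (3 / p - 1) * (g t - g 0))) := by
    have hnot : ∀ s ∈ B \ A', (s : ℝ) ∉ A := fun s hs hsA =>
      (Finset.mem_sdiff.1 hs).2 (Finset.mem_subtype.2 hsA)
    have e := hfin ((B \ A').map (Function.Embedding.subtype _)) ε hε (hmap _) (fun s hs => by
      obtain ⟨x, hx, rfl⟩ := Finset.mem_map.1 hs
      exact hAε _ (hsub _ x.2) (hnot x hx))
    rw [Finset.sum_map] at e
    exact (LpBound.sum le_rfl (B \ A')
      (Z := fun s : jumpTimes μ (2 * a) Y Ym t => jumpTerm f Y Ym s) fun s hs =>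
      hJ s (hsub _ s.2) ε (hAε _ (hsub _ s.2) (hnot s hs))).mono e
  have b := b2.add le_rfl b1
  refine b.congr ?_
  filter_upwards [hsumA] with ω hω
  have e3 := Finset.sum_sdiff (f := fun s : jumpTimes μ (2 * a) Y Ym t =>
    jumpTerm f Y Ym (s : ℝ) ω) hB'
  simp only [Pi.add_apply, Pi.sub_apply, hω, Finset.sum_apply]
  rw [← e3]
  abel

end ControlledBounds

end Jumps

end RoughIto

namespace RoughIto

/-! ### Itô's formula -/

section Formula

variable {Ω : Type*} {m0 : MeasurableSpace Ω} {μ : Measure Ω}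

theorem IsMeshLimit.exists_lpBound {G : Type*} [NormedAddCommGroup G] [NormedSpace ℝ G]
    {a s t η : ℝ} {Ξ : ℝ → ℝ → Ω → G} {L : Ω → G} (h : IsMeshLimit μ a Ξ s t L) (hη : 0 < η) :
    ∃ δ > 0, ∀ P : TimePartition s t, P.MeshLT δ → AEStronglyMeasurable (P.sum Ξ) μ →
      LpBound μ a (L - P.sum Ξ) η := by
  obtain ⟨δ, hδ, H⟩ := h.2 (ENNReal.ofReal η) (ENNReal.ofReal_pos.2 hη)
  exact ⟨δ, hδ, fun P hP hm => ⟨h.1.1.sub hm, hη.le, H P hP⟩⟩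

/-- Every interval of a partition of oscillation `ε` contains a time such that all other jumps of
`g` are at most `ε`. -/
theorem TimePartition.Osc.exists_times {g : StieltjesFunction ℝ} {s t ε : ℝ}
    {P : TimePartition s t} (hP : P.Osc g ε) : ∃ τ : ℕ → ℝ,
      (∀ i < P.n, τ i ∈ Ioc (P.seq i) (P.seq (i + 1)) ∧
        (∀ y ∈ Ico (P.seq i) (τ i), g y - g (P.seq i) ≤ ε) ∧ g (P.seq (i + 1)) - g (τ i) ≤ ε) ∧
      Set.InjOn τ (Finset.range P.n) ∧
      ∀ x ∈ Ioc s t, x ∉ (Finset.range P.n).image τ → g x - Function.leftLim g x ≤ ε := by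
  have h : ∀ i, ∃ τ, i < P.n → τ ∈ Ioc (P.seq i) (P.seq (i + 1)) ∧
        (∀ y ∈ Ico (P.seq i) τ, g y - g (P.seq i) ≤ ε) ∧ g (P.seq (i + 1)) - g τ ≤ ε := by
    intro i
    by_cases hi : i < P.n
    · obtain ⟨τ, hτ⟩ := hP i hi
      refine ⟨τ, fun _ => ?_⟩
      rwa [P.seq_eq hi.le, P.seq_eq hi]
    · exact ⟨0, fun h => absurd h hi⟩
  choose τ hτ using h
  refine ⟨τ, hτ, ?_, ?_⟩
  -- The chosen times lie in disjoint half-open cells, so they are distinct.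
  · have key : ∀ i j, i < j → j < P.n → τ i < τ j := fun i j hij hj =>
      ((hτ i (hij.trans hj)).1.2.trans (P.seq_mono hij)).trans_lt (hτ j hj).1.1
    intro i hi j hj hij
    have hi' := Finset.mem_range.1 (Finset.mem_coe.1 hi)
    have hj' := Finset.mem_range.1 (Finset.mem_coe.1 hj)
    rcases lt_trichotomy i j with h | h | h
    · exact absurd hij (key i j h hj').ne
    · exact h
    · exact absurd hij (key j i h hi').ne'
  -- Any other time lies strictly before or strictly after the chosen time of its cell, where g
  -- varies by at most ε.
  · intro x hx hxA
    obtain ⟨i, -, hi, h1, h2⟩ := exists_crossing (x := P.seq) (i := 0) (j := P.n) (τ := x)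
      (by rw [P.seq_eq zero_le, P.first]; exact hx.1)
      (by rw [P.seq_eq le_rfl, P.last]; exact hx.2) zero_le
    obtain ⟨hτi, h3, h4⟩ := hτ i hi
    have hne : x ≠ τ i := fun e => hxA (Finset.mem_image.2 ⟨i, Finset.mem_range.2 hi, e.symm⟩)
    rcases hne.lt_or_gt with h | h
    · exact (sub_le_sub_left (g.mono.le_leftLim h1) _).trans (h3 x ⟨h1.le, h⟩)
    · exact (sub_le_sub (g.mono h2) (g.mono.le_leftLim h)).trans h4

variable {V E F : Type*} [NormedAddCommGroup V] [NormedSpace ℝ V] [FiniteDimensional ℝ V]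
  [NormedAddCommGroup E] [NormedSpace ℝ E] [FiniteDimensional ℝ E]
  [NormedAddCommGroup F] [NormedSpace ℝ F] [FiniteDimensional ℝ F]
variable {ℱ : Filtration ℝ m0} {T a p M K : ℝ} {g : StieltjesFunction ℝ} {X : ℝ → V}
  {XX : ℝ → ℝ → V ⊗[ℝ] V} {Y Ym : ℝ → Ω → E} {Y' : ℝ → Ω → V →L[ℝ] E}

theorem contract_symPart {B : V →L[ℝ] V →L[ℝ] F} (hB : ∀ v w, B v w = B w v) (τ : V ⊗[ℝ] V) :
    contract B (symPart τ) = contract B τ := by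
  have hflip : B.flip = B := by
    ext v w; exact hB w v
  rw [symPart, map_smul, map_add, contract_comm, hflip, ← two_smul ℝ, smul_smul]
  norm_num

/-- Taylor's formula with δY ⊗ δY rewritten through the bracket germ. The correction ½·2·Sym(𝕏)
cancels the term in 𝕏 of the integral germ, since the symmetric D²f(Y_u) does not see the
antisymmetric part of 𝕏. -/
theorem IsC3Bounded.comp_sub_eq {f : E → F} (hf : IsC3Bounded K f) (u v : ℝ) (ω : Ω) :
    f (Y v ω) - f (Y u ω) = compGerm XX (fderiv ℝ f) Y Y' u v ω +
      (1 / 2 : ℝ) • contract (fderiv ℝ (fderiv ℝ f) (Y u ω)) (bracketGerm XX Y Y' u v ω) +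
      taylorRem f (Y u ω) (Y v ω) := by
  have hsym := contract_symPart (B := pullBilin (fderiv ℝ (fderiv ℝ f) (Y u ω)) (Y' u ω))
    (fun v w => by rw [pullBilin_apply, pullBilin_apply, hf.symm]) (XX u v)
  rw [pullBilin_eq] at hsym
  rw [compGerm_apply, bracketGerm, LinearMap.map_sub, LinearMap.map_smul, contract_map, hsym,
    contract_tmul, pullBilin_eq, taylorRem, smul_sub, smul_smul,
    show (1 / 2 : ℝ) * 2 = 1 by norm_num, one_smul]
  abel

variable [IsProbabilityMeasure μ]

namespace ControlledBounds

/-- The exact identity is summed over one fine partition, and each of the three sums is compared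
with its limit. The discrepancy in the formula is thus arbitrarily small in L^1, hence zero. -/
theorem ae_eq_ito (h : ControlledBounds μ ℱ T a p M g X XX Y Y')
    (hYm : LeftLimits μ T a p g Y Ym) (hT : 0 ≤ T) (ha : 2 ≤ a) (hp : 2 ≤ p) (hp' : p < 3)
    {f : E → F} (hf : IsC3Bounded K f) {t : ℝ} (ht : 0 ≤ t) (htT : t ≤ T) {I Z S : Ω → F}
    (hI : IsMeshLimit μ a (compGerm XX (fderiv ℝ f) Y Y') 0 t I)
    (hZ : IsMeshLimit μ a (fun u v ω => contract (fderiv ℝ (fderiv ℝ f) (Y u ω))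
      (bracketGerm XX Y Y' u v ω)) 0 t Z)
    (hS : ∀ (A : Finset ℝ) (ε : ℝ), 0 ≤ ε → (A : Set ℝ) ⊆ Ioc 0 t →
      (∀ s ∈ Ioc 0 t, s ∉ A → g s - Function.leftLim g s ≤ ε) →
      LpBound μ 1 (S - ∑ s ∈ A, jumpTerm f Y Ym s) (K * (ε ^ (3 / p - 1) * (g t - g 0)))) :
    ∀ᵐ ω ∂μ, f (Y t ω) = f (Y 0 ω) + I ω + (1 / 2 : ℝ) • Z ω + S ω := by
  classical
  have hp0 : 0 < p := by linarith
  have hK := hf.isC2.nonneg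
  have hw : 0 ≤ g t - g 0 := sub_nonneg.2 (g.mono ht)
  obtain ⟨C₁, hC₁⟩ := h.exists_isSewable_compGerm hT ha hp0 hf.isC2'
  obtain ⟨C₂, hC₂⟩ := h.exists_isSewable_contract_bracketGerm hT ha hp0 hf.isC2'
  suffices hD : LpBound μ 1 (fun ω => S ω - (f (Y t ω) - f (Y 0 ω)) + I ω + (1 / 2 : ℝ) • Z ω) 0 by
    filter_upwards [hD.ae_eq_zero le_rfl] with ω hω
    have e : f (Y 0 ω) + I ω + (1 / 2 : ℝ) • Z ω + S ω = f (Y t ω) +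
      (S ω - (f (Y t ω) - f (Y 0 ω)) + I ω + (1 / 2 : ℝ) • Z ω) := by abel
    rw [e, hω, Pi.zero_apply, add_zero]
  refine LpBound.of_forall_pos le_rfl fun η hη => ?_
  rw [zero_add]
  -- 109 = 108 + 1: the comparison of Taylor remainders with jump terms, plus the jumps left out.
  -- The two integrals use the other η/2.
  obtain ⟨ε, hε, hεη⟩ := exists_sewRate_le hp hp' (K := 109 * K * (g t - g 0)) (half_pos hη)
  obtain ⟨δ₁, hδ₁, H₁⟩ := hI.exists_lpBound (by positivity : 0 < η / 4)
  obtain ⟨δ₂, hδ₂, H₂⟩ := hZ.exists_lpBound (by positivity : 0 < η / 4)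
  obtain ⟨δ₃, hδ₃, H₃⟩ := exists_mesh_osc g T hε
  obtain ⟨P, hP⟩ := TimePartition.exists_meshLT ht (lt_min hδ₁ (lt_min hδ₂ hδ₃))
  have hmesh : ∀ {δ}, min δ₁ (min δ₂ δ₃) ≤ δ → P.MeshLT δ := fun hδ i hi =>
    (hP i hi).trans_le hδ
  have b₁ := H₁ P (hmesh (min_le_left _ _)) (hC₁.sum_memLp le_rfl htT P).1.1
  have b₂ := H₂ P (hmesh ((min_le_right _ _).trans (min_le_left _ _)))
    (hC₂.sum_memLp le_rfl htT P).1.1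
  obtain ⟨τ, hτ, hinj, hout⟩ :=
    (H₃ P le_rfl htT (hmesh ((min_le_right _ _).trans (min_le_right _ _)))).exists_times
  have hmem : ∀ i, 0 ≤ P.seq i ∧ P.seq i ≤ T := fun i =>
    ⟨(P.seq_mem i).1, (P.seq_mem i).2.trans htT⟩
  have b₃ := hS ((Finset.range P.n).image τ) ε hε.le (by
    intro x hx
    obtain ⟨i, hi, rfl⟩ := Finset.mem_image.1 (Finset.mem_coe.1 hx)
    have := (hτ i (Finset.mem_range.1 hi)).1
    exact ⟨(P.seq_mem i).1.trans_lt this.1, this.2.trans (P.seq_mem _).2⟩) hout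
  -- Injectivity turns the sum over chosen times into a sum over cells, matching the Taylor
  -- remainders term by term.
  rw [Finset.sum_image hinj] at b₃
  have b₄ := LpBound.sum le_rfl (Finset.range P.n) (Z := fun i =>
    (fun ω => taylorRem f (Y (P.seq i) ω) (Y (P.seq (i + 1)) ω)) - jumpTerm f Y Ym (τ i))
    fun i hi => by
      obtain ⟨t1, t2, t3⟩ := hτ i (Finset.mem_range.1 hi)
      exact h.taylorRem_sub_jumpTerm_le hYm ha hp hp' hf (hmem i).1 (hmem _).2 t1 t2 t3
  have e0 : P.seq 0 = 0 := by rw [P.seq_eq zero_le, P.first]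
  have e1 : P.seq P.n = t := by rw [P.seq_eq le_rfl, P.last]
  rw [← Finset.mul_sum, ← Finset.mul_sum, Finset.sum_range_sub (fun i => g (P.seq i)), e0, e1] at b₄
  have b₂' := (b₂.exponent_mono (b := 1) (by linarith)).of_norm_le_mul
    (Z := fun ω => (1 / 2 : ℝ) • (Z ω - (P.sum fun u v ω => contract
      (fderiv ℝ (fderiv ℝ f) (Y u ω)) (bracketGerm XX Y Y' u v ω)) ω))
    (b₂.meas.const_smul (1 / 2 : ℝ)) zero_le_one (.of_forall fun ω => by
      rw [norm_smul, Real.norm_of_nonneg (by norm_num)]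
      exact mul_le_mul_of_nonneg_right (by norm_num) (norm_nonneg _))
  have b := ((b₁.exponent_mono (b := 1) (by linarith)).add le_rfl b₂').add le_rfl
    (b₃.sub le_rfl b₄)
  refine (b.mono ?_).congr (.of_forall fun ω => ?_)
  · have hΘ : ε ^ (3 / p - 1) ≤ sewRate p ε := le_add_of_nonneg_left (Real.sqrt_nonneg _)
    have := mul_le_mul_of_nonneg_left hΘ (by positivity : 0 ≤ 109 * K * (g t - g 0))
    linarith
  · have e2 : f (Y t ω) - f (Y 0 ω) = ∑ i ∈ Finset.range P.n,
        (f (Y (P.seq (i + 1)) ω) - f (Y (P.seq i) ω)) := by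
      rw [Finset.sum_range_sub (fun i => f (Y (P.seq i) ω)), e0, e1]
    beta_reduce
    rw [e2, Finset.sum_congr rfl fun i _ => hf.comp_sub_eq (XX := XX) (Y' := Y') _ _ ω]
    simp only [Pi.add_apply, Pi.sub_apply, Finset.sum_apply, P.sum_eq_seq,
      Finset.sum_add_distrib, Finset.sum_sub_distrib, ← Finset.smul_sum, smul_sub]
    abel

end ControlledBounds

end Formula

end RoughIto

namespace RoughIto

/-! ### Left limits of Y and f(Y) from the rates -/

section LeftLimits

variable {Ω : Type*} {m0 : MeasurableSpace Ω} {μ : Measure Ω} [IsProbabilityMeasure μ]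
variable {V E F : Type*} [NormedAddCommGroup V] [NormedSpace ℝ V] [FiniteDimensional ℝ V]
  [NormedAddCommGroup E] [NormedSpace ℝ E] [FiniteDimensional ℝ E]
  [NormedAddCommGroup F] [NormedSpace ℝ F] [FiniteDimensional ℝ F]
variable {ℱ : Filtration ℝ m0} {T a p M K : ℝ} {g : StieltjesFunction ℝ} {X : ℝ → V}
  {XX : ℝ → ℝ → V ⊗[ℝ] V} {Y Ym : ℝ → Ω → E} {Y' : ℝ → Ω → V →L[ℝ] E}

theorem isLeftLimit_of_lpBound {G : Type*} [NormedAddCommGroup G] [NormedSpace ℝ G] {C q : ℝ}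
    (hp : 0 < p) {Z : ℝ → Ω → G} {t : ℝ} (ht : 0 < t) {L : Ω → G}
    (hL : MemLp L (ENNReal.ofReal q) μ) (h : ∀ u, 0 ≤ u → u < t →
      LpBound μ q (Z u - L) (C * (Function.leftLim g t - g u) ^ (1 / p))) :
    IsLeftLimit μ q Z t L := by
  refine ⟨hL, ?_⟩
  have h1 := ((tendsto_leftLim_sub_rpow g t (by positivity : 0 < 1 / p)).const_mul C)
  rw [mul_zero] at h1
  have h2 := ENNReal.tendsto_ofReal h1
  rw [ENNReal.ofReal_zero] at h2
  refine tendsto_of_tendsto_of_tendsto_of_le_of_le' tendsto_const_nhds h2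
    (.of_forall fun _ => zero_le) ?_
  filter_upwards [Ico_mem_nhdsLT ht] with u hu using (h u hu.1 hu.2).le

namespace LeftLimits

theorem isLeftLimit (hYm : LeftLimits μ T a p g Y Ym) (hp : 0 < p) {t : ℝ} (ht : 0 < t)
    (htT : t ≤ T) : IsLeftLimit μ (2 * a) Y t (Ym t) :=
  isLeftLimit_of_lpBound (C := 1) hp ht (hYm.memLp t ht htT) fun u hu hut =>
    (hYm.left u t hu hut htT).mono (one_mul _).ge

theorem isLeftLimit_comp (hYm : LeftLimits μ T a p g Y Ym)
    (h : ControlledBounds μ ℱ T a p M g X XX Y Y') (hp : 0 < p) {f : E → F}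
    (hf : IsC2Bounded K f) {t : ℝ} (ht : 0 < t) (htT : t ≤ T) :
    IsLeftLimit μ (2 * a) (fun s ω => f (Y s ω)) t (fun ω => f (Ym t ω)) := by
  have hm := hYm.memLp t ht htT
  have hfm : AEStronglyMeasurable (fun ω => f (Ym t ω)) μ :=
    hf.diff.continuous.comp_aestronglyMeasurable hm.1
  refine isLeftLimit_of_lpBound (g := g) (C := K) hp ht ?_ fun u hu hut => ?_
  · refine ((memLp_const ‖f 0‖).add (hm.norm.const_mul K)).mono' hfm
      (.of_forall fun ω => hf.norm_le _)
  · exact (hYm.left u t hu hut htT).of_norm_le_mul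
      ((hf.diff.continuous.comp_aestronglyMeasurable (h.Y_memLp u hu (hut.le.trans htT)).1).sub hfm)
      hf.nonneg (.of_forall fun ω => hf.norm_sub_le _ _)

end LeftLimits

end LeftLimits

end RoughIto

/-! ### Assembly of the theorem -/

theorem theorem5p1 {Ω : Type*} {m0 : MeasurableSpace Ω} (μ : Measure Ω) [IsProbabilityMeasure μ]
    (T : ℝ) (hT : 0 < T) (ℱ : Filtration ℝ m0)
    {V E F : Type*} [NormedAddCommGroup V] [NormedSpace ℝ V] [FiniteDimensional ℝ V]
    [NormedAddCommGroup E] [NormedSpace ℝ E] [FiniteDimensional ℝ E]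
    [NormedAddCommGroup F] [NormedSpace ℝ F] [FiniteDimensional ℝ F]
    (p q : ℝ) (r : ℝ≥0∞) (hp : 2 ≤ p) (hp' : p < 3) (hq : 4 ≤ q) (hr : 2 ≤ r)
    (f : E → F) (hf : IsC3b f)
    (X : ℝ → V) (XX : ℝ → ℝ → V ⊗[ℝ] V) (hX : IsRoughPath T p X XX)
    (Y : ℝ → Ω → E) (Y' : ℝ → Ω → V →L[ℝ] E) (hY : IsControlledPath μ ℱ T p q r X Y Y') :
    ∃ (Ym : ℝ → Ω → E) (B : ℝ → Ω → E ⊗[ℝ] E) (I K S : ℝ → Ω → F),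
      -- `Ym t = Y_{t-}`, and `f(Ym t) = f(Y)_{t-}`
      (∀ t ∈ Ioc 0 T, IsLeftLimit μ q Y t (Ym t) ∧
        IsLeftLimit μ q (fun s ω => f (Y s ω)) t (fun ω => f (Ym t ω))) ∧
      -- `B = [Y]`
      IsBracket μ ℱ T p q XX Y Y' B ∧
      -- `I = ∫ Df(Y) dY`
      IsControlledIntegral μ ℱ T p q XX (fun s ω => fderiv ℝ f (Y s ω))
        (fun s ω => (D2 f (Y s ω)).comp (Y' s ω)) Y Y' I ∧
      -- `K = ∫ D²f(Y) d[Y]`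
      IsYoungIntegral μ T (q / 2) (fun s ω => D2 f (Y s ω)) B K ∧
      ∀ t ∈ Icc 0 T,
        IsL1Sum μ (fun s : jumpTimes μ q Y Ym t => jumpTerm f Y Ym s) (S t) ∧
        ∀ᵐ ω ∂μ, f (Y t ω) = f (Y 0 ω) + I t ω + (1 / 2 : ℝ) • K t ω + S t ω := by
  -- With q = 2a the target space is L^a, and q ≥ 4 becomes the condition a ≥ 2 for two-smoothness.
  obtain ⟨a, rfl⟩ : ∃ a, q = 2 * a := ⟨q / 2, by ring⟩
  have ha : 2 ≤ a := by linarith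
  have hp0 : 0 < p := by linarith
  have hp1 : 0 < 1 / p := by positivity
  have e2 : 2 * a / 2 = a := by ring
  obtain ⟨g, M, h⟩ := exists_controlledBounds hT.le hp ha hr hX hY
  obtain ⟨K, hK⟩ := hf.exists_isC3Bounded
  have hYm : ∃ Ym : ℝ → Ω → E, LeftLimits μ T a p g Y Ym := by
    have H : ∀ t, ∃ L : Ω → E, 0 < t → t ≤ T → MemLp L (ENNReal.ofReal (2 * a)) μ ∧
        (∀ u, 0 ≤ u → u < t →
          LpBound μ (2 * a) (Y u - L) ((Function.leftLim g t - g u) ^ (1 / p))) ∧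
        LpBound μ (2 * a) (Y t - L) ((g t - Function.leftLim g t) ^ (1 / p)) := by
      intro t
      by_cases ht : 0 < t ∧ t ≤ T
      · obtain ⟨L, hL⟩ := h.exists_leftLimit ha hp0 ht.1 ht.2
        exact ⟨L, fun _ _ => hL⟩
      · exact ⟨0, fun h1 h2 => absurd ⟨h1, h2⟩ ht⟩
    choose Ym H using H
    exact ⟨Ym, fun t h1 h2 => (H t h1 h2).1, fun u t hu hut ht =>
      (H t (hu.trans_lt hut) ht).2.1 u hu hut, fun t h1 h2 => (H t h1 h2).2.2⟩
  obtain ⟨Ym, hYm⟩ := hYm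
  obtain ⟨I, hI⟩ := h.exists_controlledIntegral hT.le ha hp hp' hK.isC2' hK.isC2.bound
  obtain ⟨B, Z, hB, hZ, hZ'⟩ := h.exists_bracket_youngIntegral hT.le ha hp hp' hK.isC2'
  have hS : ∀ t, ∃ S : Ω → F, t ∈ Icc 0 T →
      IsL1Sum μ (fun s : jumpTimes μ (2 * a) Y Ym t => jumpTerm f Y Ym s) S ∧
      ∀ᵐ ω ∂μ, f (Y t ω) = f (Y 0 ω) + I t ω + (1 / 2 : ℝ) • Z t ω + S ω := by
    intro t
    by_cases ht : t ∈ Icc 0 T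
    · obtain ⟨S, hS, hS'⟩ := h.exists_jumpSum hYm ha hp0 hp' hK ht.1 ht.2
      refine ⟨S, fun _ => ⟨hS, ?_⟩⟩
      have hIt := hI.limit 0 t le_rfl ht.1 ht.2
      rw [e2] at hIt
      -- The limits identify increments from time 0; the processes themselves vanish there only
      -- almost surely.
      filter_upwards [h.ae_eq_ito hYm hT.le ha hp hp' hK ht.1 ht.2 hIt
        (hZ' 0 t le_rfl ht.1 ht.2) hS', hI.init, hZ.init] with ω hω h1 h2
      rw [hω, Pi.sub_apply, Pi.sub_apply, h1, h2, Pi.zero_apply, sub_zero, sub_zero]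
    · exact ⟨0, fun h => absurd h ht⟩
  choose S hS using hS
  exact ⟨Ym, B, I, Z, S, fun t ht => ⟨hYm.isLeftLimit hp0 ht.1 ht.2,
    hYm.isLeftLimit_comp h hp0 hK.isC2 ht.1 ht.2⟩, hB, hI, hZ, hS⟩
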